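/- Let $k$ be a field of characteristic zero and let $Q=(Q_0,Q_1,s,t)$ be any quiver, with a unital associative $k$-algebra $A_v$ for every vertex $v\in Q_0$ and an $A_{s(e)}$-$A_{t(e)}$-bimodule $M_e$ (with equal left and right $k$-action) for every edge $e\in Q_1$. Write $(V[j])_i=V_{i-j}$ for shifts of $\mathbb Z$-graded $k$-vector spaces. Let $\mathcal A_Q=\bigoplus_{v\in Q_0}A_v\oplus\bigoplus_{e\in Q_1}M_e[-1]$ be the $\mathbb Z$-graded algebra (with $A_v$ in degree $0$ and $M_e$ in degree $-1$; it is non-unital if infinitely many $A_v$ are non-zero) with product $(a,m)(a',m')=(aa',am'+ma')$: the $A_v$ are orthogonal to each other, $A_{s(e)}$ and $A_{t(e)}$ act on $M_e$ from the left and from the right, and all other products are zero. For a $\mathbb Z$-graded $k$-algebra $A$, let $HC_\bullet(A)$ be the homology of the (direct sum) total complex of the cyclic bicomplex $CC_{p,q}(A)=A^{\otimes (q+1)}$, $p,q\ge 0$, whose columns are $(A^{\otimes(q+1)},b)$ for $p$ even and $(A^{\otimes (q+1)},-b')$ for $p$ odd, and whose rows are $1-t$ (from odd $p$) and $N=1+t+\dots+t^q$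 (from even $p\geq 2$), where $$d_i(a_0\otimes\dots\otimes a_q)=a_0\otimes\dots\otimes a_ia_{i+1}\otimes\dots\otimes a_q\ (i<q),\quad d_q(a_0\otimes\dots\otimes a_q)=\epsilon\, a_qa_0\otimes a_1\otimes\dots\otimes a_{q-1},$$ $$b=\sum_{i=0}^{q}(-1)^id_i,\quad b'=\sum_{i=0}^{q-1}(-1)^id_i,\quad t(a_0\otimes\dots\otimes a_q)=(-1)^q\epsilon\, a_q\otimes a_0\otimes\dots\otimes a_{q-1},$$ with the Koszul sign $\epsilon=(-1)^{|a_q|(|a_0|+\dots+|a_{q-1}|)}$; elements of $CC_{p,q}$ of internal degree $w$ have total degree $p+q+w$. An ungraded algebra such as $A_v$ is placed in degree $0$. A pointed cycle of length $n\ge1$ is a sequence of edges $(e_1,\dots,e_n)$ with $t(e_i)=s(e_{i+1})$ for $i<n$ and $t(e_n)=s(e_1)$; $\mathrm{Cyc}(Q)$ is the set of pointed cycles of all lengths $n\ge 1$ modulo cyclic permutation. The degree $\deg\ell$ of a cycle $\ell$ is the largest $d$ such that $\ell=\ell_0^d$ for some cycle $\ell_0$. For $\ell$ represented by $(e_1,\dots,e_n)$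 let $$\mathcal F_\ell=H_\bullet\left(M_{e_1}\otimes^{\mathbb L}_{A_{t(e_1)}}M_{e_2}\otimes^{\mathbb L}_{A_{t(e_2)}}\dots\otimes^{\mathbb L}_{A_{t(e_{n-1})}}M_{e_n}\otimes^{\mathbb L}_{A_{t(e_n)}}\right)_{\mathbb Z_{\deg\ell}}$$ be the coinvariants of the homology of the cyclic derived tensor product, where the last $\otimes^{\mathbb L}_{A_{t(e_n)}}$ is with the first factor $M_{e_1}$. The cyclic derived tensor product is given by the bar complex $$M_{e_1}\otimes T(A_{t(e_1)}[1])\otimes M_{e_2}\otimes T(A_{t(e_2)}[1])\otimes\dots\otimes M_{e_n}\otimes T(A_{t(e_n)}[1]),$$ where $T$ is the tensor algebra over $k$, whose differential is the signed sum of the products of cyclically adjacent letters (products of two letters from the $M_e$ being dropped), the sign being $(-1)^r$ if $r$ letters from the algebras stand up to and including the first of the two; the generator of $\mathbb Z_{\deg\ell}$ acts by the rotation by $n/\deg\ell$ blocks $M_e\otimes T(A_{t(e)}[1])$, with the Koszul sign. Up to isomorphism $\mathcal F_\ell$ does not depend on the representative. Then there is an isomorphism of $\mathbb Z$-graded $k$-vector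 spaces $$HC_\bullet(\mathcal A_Q)\;\cong\;\bigoplus_{v\in Q_0}HC_\bullet(A_v)\;\oplus\bigoplus_{\ell\in\mathrm{Cyc}(Q)}\mathcal F_\ell[-1],$$ that is, $HC_n(\mathcal A_Q)\cong\bigoplus_{v}HC_n(A_v)\oplus\bigoplus_{\ell}(\mathcal F_\ell)_{n+1}$ for every $n\in\mathbb Z$. -/

import Mathlib

open scoped TensorProduct DirectSum

noncomputable section

namespace QuiverCyclic

/-! ### Homology of a graded differential module -/

section Homology

variable {k : Type*} [CommRing k] {T : Type*} [AddCommGroup T] [Module k T]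

/-- The `n`-cycles: degree `n` elements killed by the differential `D`. -/
def cycles (D : T →ₗ[k] T) (G : ℤ → Submodule k T) (n : ℤ) : Submodule k T :=
  LinearMap.ker D ⊓ G n

/-- The `n`-boundaries `D (G (n + 1))`, inside the `n`-cycles. -/
def boundaries (D : T →ₗ[k] T) (G : ℤ → Submodule k T) (n : ℤ) :
    Submodule k (cycles D G n) :=
  ((G (n + 1)).map D).comap (cycles D G n).subtype

/-- `H_n` of a module `T` with grading `G` and differential `D` of degree `-1`. -/
def gradedHomology (D : T →ₗ[k] T) (G : ℤ → Submodule k T) (n : ℤ) : Type _ :=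
  cycles D G n ⧸ boundaries D G n

instance (D : T →ₗ[k] T) (G : ℤ → Submodule k T) (n : ℤ) : AddCommGroup (gradedHomology D G n) :=
  inferInstanceAs (AddCommGroup (cycles D G n ⧸ boundaries D G n))

instance (D : T →ₗ[k] T) (G : ℤ → Submodule k T) (n : ℤ) : Module k (gradedHomology D G n) :=
  inferInstanceAs (Module k (cycles D G n ⧸ boundaries D G n))

/-- The homology class of a cycle. -/
def homologyClass (D : T →ₗ[k] T) (G : ℤ → Submodule k T) (n : ℤ) :
    cycles D G n →ₗ[k] gradedHomology D G n :=
  (boundaries D G n).mkQ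

end Homology

/-! ### Tensors: the Koszul rotation, faces, splitting off letters -/

section Koszul

variable (k : Type*) [CommRing k] {m : ℕ} {X : Fin (m + 1) → Type*}
  [∀ i, AddCommGroup (X i)] [∀ i, Module k (X i)]

/-- For `ℤ/2`-graded modules `X i`, with projections `ev i`, `od i` on the even and odd parts:
the rotation `x₀ ⊗ ⋯ ⊗ x_m ↦ (-1)^{|x_m| (|x₀| + ⋯ + |x_{m-1}|)} x_m ⊗ x₀ ⊗ ⋯ ⊗ x_{m-1}`.
(An even `x_m` moves freely; an odd `x_m` makes each odd letter that it passes change sign.) -/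
def koszulRotate (ev od : ∀ i, X i →ₗ[k] X i) :
    (⨂[k] i, X i) →ₗ[k] ⨂[k] i, X ((finRotate (m + 1)).symm i) :=
  (PiTensorProduct.reindex k X (finRotate (m + 1))).toLinearMap ∘ₗ
    (PiTensorProduct.map (fun i => if i = Fin.last m then ev i else LinearMap.id) +
      PiTensorProduct.map (fun i => if i = Fin.last m then od i else ev i - od i))

variable {k} in
/-- Given `f : X j → X j ⊗ C`, apply `f` to the `j`-th factor and move the resulting `C`-factor
out of the tensor product to the right. -/
def extractAt {C : Type*} [AddCommGroup C] [Module k C] (j : Fin (m + 1))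
    (f : X j →ₗ[k] X j ⊗[k] C) : (⨂[k] i, X i) →ₗ[k] (⨂[k] i, X i) ⊗[k] C :=
  PiTensorProduct.lift
    { toFun := fun x =>
        TensorProduct.map ((PiTensorProduct.tprod k).toLinearMap x j) LinearMap.id (f (x j))
      map_update_add' := by
        intro inst x i y z
        obtain rfl : inst = instDecidableEqFin (m + 1) := Subsingleton.elim _ _
        by_cases h : i = j
        · subst h
          have key : ∀ v, (PiTensorProduct.tprod k).toLinearMap (Function.update x i v) i
              = (PiTensorProduct.tprod k).toLinearMap x i := by
            intro v; ext p; simp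
          simp only [key, Function.update_self, map_add]
        · have hj : ∀ v, Function.update x i v j = x j := fun v =>
            Function.update_of_ne (Ne.symm h) _ _
          rw [hj, hj, hj, ← LinearMap.add_apply, ← TensorProduct.map_add_left]
          congr 2
          ext p
          simp [Function.update_comm h]
      map_update_smul' := by
        intro inst x i c y
        obtain rfl : inst = instDecidableEqFin (m + 1) := Subsingleton.elim _ _
        by_cases h : i = j
        · subst h
          have key : ∀ v, (PiTensorProduct.tprod k).toLinearMap (Function.update x i v) i
              = (PiTensorProduct.tprod k).toLinearMap x i := by
            intro v; ext p; simp
          simp only [key, Function.update_self, map_smul]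
        · have hj : ∀ v, Function.update x i v j = x j := fun v =>
            Function.update_of_ne (Ne.symm h) _ _
          rw [hj, hj, ← LinearMap.smul_apply, ← TensorProduct.map_smul_left]
          congr 2
          ext p
          simp [Function.update_comm h] }

end Koszul

section TensorPower

variable (k : Type*) [CommRing k] (A : Type*) [NonUnitalRing A] [Module k A]

/-- `a₀ ⊗ ⋯ ⊗ aₙ ↦ (a₀ ⊗ ⋯ ⊗ aₙ₋₁) ⊗ aₙ`. -/
def splitLast (n : ℕ) : (⨂[k]^(n + 1) A) →ₗ[k] (⨂[k]^n A) ⊗[k] A :=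
  PiTensorProduct.lift
    ((TensorProduct.mk k (⨂[k]^n A) A).compMultilinearMap (PiTensorProduct.tprod k)).uncurryRight

/-- `a₀ ⊗ ⋯ ⊗ aₙ ↦ a₀ ⊗ (a₁ ⊗ ⋯ ⊗ aₙ)`. -/
def splitFirst (n : ℕ) : (⨂[k]^(n + 1) A) →ₗ[k] A ⊗[k] (⨂[k]^n A) :=
  PiTensorProduct.lift (LinearMap.uncurryLeft
    { toFun := fun a =>
        (TensorProduct.mk k A (⨂[k]^n A) a).compMultilinearMap (PiTensorProduct.tprod k)
      map_add' := by intro a b; ext; simp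
      map_smul' := by intro c a; ext; simp })

variable [IsScalarTower k A A] [SMulCommClass k A A]

/-- The face `a₀ ⊗ ⋯ ⊗ aₙ ↦ a₀ ⊗ ⋯ ⊗ a_l a_{l+1} ⊗ ⋯ ⊗ aₙ`, for `0 ≤ l < n`. -/
def face (n : ℕ) (l : Fin n) : (⨂[k]^(n + 1) A) →ₗ[k] (⨂[k]^n A) :=
  have key : ∀ [DecidableEq (Fin (n + 1))] (x : Fin (n + 1) → A) (i : Fin (n + 1)),
      ∃ (j : Fin n) (φ : A →ₗ[k] A), ∀ y,
        Fin.contractNth l.castSucc (· * ·) (Function.update x i y) =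
          Function.update (Fin.contractNth l.castSucc (· * ·) x) j (φ y) := by
    intro inst x i
    obtain rfl : inst = instDecidableEqFin (n + 1) := Subsingleton.elim _ _
    rcases lt_trichotomy (i : ℕ) l with h | h | h
    · refine ⟨⟨i, by omega⟩, LinearMap.id, fun y => ?_⟩
      funext j
      simp only [Fin.contractNth, Function.update_apply, Fin.ext_iff, Fin.val_castSucc,
        Fin.val_succ, LinearMap.id_apply]
      split_ifs <;> first | rfl | omega
    · refine ⟨l, LinearMap.mulRight k (x l.succ), fun y => ?_⟩
      funext j
      simp only [Fin.contractNth, Function.update_apply, Fin.ext_iff, Fin.val_castSucc,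
        Fin.val_succ, LinearMap.mulRight_apply]
      split_ifs <;> first | rfl | omega | (obtain rfl : j = l := Fin.ext (by omega); rfl)
    · by_cases h' : (i : ℕ) = l + 1
      · refine ⟨l, LinearMap.mulLeft k (x l.castSucc), fun y => ?_⟩
        funext j
        simp only [Fin.contractNth, Function.update_apply, Fin.ext_iff, Fin.val_castSucc,
          Fin.val_succ, LinearMap.mulLeft_apply]
        split_ifs <;> first | rfl | omega | (obtain rfl : j = l := Fin.ext (by omega); rfl)
      · refine ⟨⟨i - 1, by omega⟩, LinearMap.id, fun y => ?_⟩
        funext j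
        simp only [Fin.contractNth, Function.update_apply, Fin.ext_iff, Fin.val_castSucc,
          Fin.val_succ, LinearMap.id_apply]
        split_ifs <;> first | rfl | omega
  PiTensorProduct.lift
    { toFun := fun x => PiTensorProduct.tprod k (Fin.contractNth l.castSucc (· * ·) x)
      map_update_add' := by
        intro _ x i y z
        obtain ⟨j, φ, h⟩ := key x i
        rw [h, h, h, map_add, MultilinearMap.map_update_add]
      map_update_smul' := by
        intro _ x i c y
        obtain ⟨j, φ, h⟩ := key x i
        rw [h, h, map_smul, MultilinearMap.map_update_smul] }

end TensorPower

/-! ### Cyclic homology of a graded algebra -/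

section CyclicHomology

variable (k : Type*) [CommRing k] {A : Type*} [NonUnitalRing A] [Module k A]
  (𝒜 : ℤ → Submodule k A) [DirectSum.Decomposition 𝒜]

/-- Projection of a graded module on its even part. -/
def evenPart : A →ₗ[k] A :=
  DirectSum.toModule k ℤ A (fun d => if Even d then (𝒜 d).subtype else 0) ∘ₗ
    (DirectSum.decomposeLinearEquiv 𝒜).toLinearMap

/-- Projection of a graded module on its odd part. -/
def oddPart : A →ₗ[k] A :=
  DirectSum.toModule k ℤ A (fun d => if Even d then 0 else (𝒜 d).subtype) ∘ₗ
    (DirectSum.decomposeLinearEquiv 𝒜).toLinearMap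

/-- `a₀ ⊗ ⋯ ⊗ aₙ ↦ (-1)^{|aₙ| (|a₀| + ⋯ + |aₙ₋₁|)} aₙ ⊗ a₀ ⊗ ⋯ ⊗ aₙ₋₁`. -/
def rotation (n : ℕ) : (⨂[k]^(n + 1) A) →ₗ[k] (⨂[k]^(n + 1) A) :=
  koszulRotate k (X := fun _ : Fin (n + 1) => A) (fun _ => evenPart k 𝒜) (fun _ => oddPart k 𝒜)

/-- The cyclic operator `t = (-1)ⁿ · rotation` on `A^{⊗ (n + 1)}`. -/
def cyclicT (n : ℕ) : (⨂[k]^(n + 1) A) →ₗ[k] (⨂[k]^(n + 1) A) :=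
  (-1 : k) ^ n • rotation k 𝒜 n

/-- The norm operator `N = 1 + t + ⋯ + tⁿ` on `A^{⊗ (n + 1)}`. -/
def cyclicNorm (n : ℕ) : (⨂[k]^(n + 1) A) →ₗ[k] (⨂[k]^(n + 1) A) :=
  ∑ i ∈ Finset.range (n + 1), cyclicT k 𝒜 n ^ i

variable [IsScalarTower k A A] [SMulCommClass k A A]

variable (A) in
/-- `b' = ∑_{i < n} (-1)^i d_i`, from `A^{⊗ (n + 1)}` to `A^{⊗ n}`. -/
def barB' (n : ℕ) : (⨂[k]^(n + 1) A) →ₗ[k] (⨂[k]^n A) :=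
  ∑ l : Fin n, (-1 : k) ^ (l : ℕ) • face k A n l

/-- The Hochschild differential `b = b' + (-1)ⁿ d_n` from `A^{⊗ (n + 1)}` to `A^{⊗ n}`, with
`n = q + 1`. Its last face is
`d_n (a₀ ⊗ ⋯ ⊗ aₙ) = (-1)^{|aₙ| (|a₀| + ⋯ + |aₙ₋₁|)} aₙ a₀ ⊗ a₁ ⊗ ⋯ ⊗ aₙ₋₁`. -/
def hochschildB (q : ℕ) : (⨂[k]^(q + 1 + 1) A) →ₗ[k] (⨂[k]^(q + 1) A) :=
  barB' k A (q + 1) + (-1 : k) ^ (q + 1) • (face k A (q + 1) 0 ∘ₗ rotation k 𝒜 (q + 1))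

variable (A) in
/-- The direct sum of all the entries `CC_{p,q} = A^{⊗ (q + 1)}`, `p, q ≥ 0`, of the cyclic
bicomplex. -/
abbrev CyclicTot : Type _ := ⨁ pq : ℕ × ℕ, ⨂[k]^(pq.2 + 1) A

/-- The horizontal differential `CC_{p,q} → CC_{p-1,q}`: `1 - t` for `p` odd and `N` for `p ≥ 2`
even. -/
def cyclicHor : (p q : ℕ) → (⨂[k]^(q + 1) A) →ₗ[k] CyclicTot k A
  | 0, _ => 0
  | p + 1, q => DirectSum.lof k (ℕ × ℕ) (fun pq => ⨂[k]^(pq.2 + 1) A) (p, q) ∘ₗ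
      (if Even p then LinearMap.id - cyclicT k 𝒜 q else cyclicNorm k 𝒜 q)

/-- The vertical differential `CC_{p,q} → CC_{p,q-1}`: `b` for `p` even and `-b'` for `p` odd. -/
def cyclicVert : (p q : ℕ) → (⨂[k]^(q + 1) A) →ₗ[k] CyclicTot k A
  | _, 0 => 0
  | p, q + 1 => DirectSum.lof k (ℕ × ℕ) (fun pq => ⨂[k]^(pq.2 + 1) A) (p, q) ∘ₗ
      (if Even p then hochschildB k 𝒜 q else -barB' k A (q + 1))

/-- The total differential of the cyclic bicomplex. -/
def cyclicD : CyclicTot k A →ₗ[k] CyclicTot k A :=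
  DirectSum.toModule k (ℕ × ℕ) (CyclicTot k A)
    (fun pq => cyclicHor k 𝒜 pq.1 pq.2 + cyclicVert k 𝒜 pq.1 pq.2)

/-- The part of internal degree `w` of `A^{⊗ m}`. -/
def tensorDegree (m : ℕ) (w : ℤ) : Submodule k (⨂[k]^m A) :=
  Submodule.span k {x | ∃ (a : Fin m → A) (d : Fin m → ℤ),
    (∀ i, a i ∈ 𝒜 (d i)) ∧ ∑ i, d i = w ∧ x = PiTensorProduct.tprod k a}

/-- The part of total degree `n` of the cyclic bicomplex, where the elements of internal degree `w`
in `CC_{p,q}` have total degree `p + q + w`. -/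
def cyclicDegree (n : ℤ) : Submodule k (CyclicTot k A) :=
  ⨆ pq : ℕ × ℕ, (tensorDegree k 𝒜 (pq.2 + 1) (n - pq.1 - pq.2)).map
    (DirectSum.lof k (ℕ × ℕ) (fun pq => ⨂[k]^(pq.2 + 1) A) pq)

/-- The cyclic homology `HC_n` of the graded algebra `A = ⨁ 𝒜 d` (with Koszul signs): the homology
of the total complex of the cyclic bicomplex. -/
abbrev cyclicHomology (n : ℤ) : Type _ :=
  gradedHomology (cyclicD k 𝒜) (cyclicDegree k 𝒜) n

end CyclicHomology

/-! ### Ungraded algebras, in degree zero -/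

section DegreeZero

variable (k : Type*) [CommRing k] (A : Type*) [NonUnitalRing A] [Module k A]

/-- The grading of `A` that is concentrated in degree `0`. -/
def degreeZero (d : ℤ) : Submodule k A where
  carrier := {a | d ≠ 0 → a = 0}
  add_mem' := by intro a b ha hb h; simp [ha h, hb h]
  zero_mem' := fun _ => rfl
  smul_mem' := by intro c a ha h; simp [ha h]

instance : DirectSum.Decomposition (degreeZero k A) :=
  DirectSum.Decomposition.ofLinearMap (degreeZero k A)
    (DirectSum.lof k ℤ (fun d => degreeZero k A d) 0 ∘ₗ
      LinearMap.codRestrict (degreeZero k A 0) LinearMap.id (fun _ h => (h rfl).elim))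
    (by
      refine LinearMap.ext fun a => ?_
      simp
      rfl)
    (by
      ext d a : 2
      by_cases h : d = 0
      · subst h; simp; rfl
      · obtain rfl : a = 0 := Subtype.ext (a.2 h)
        simp)

end DegreeZero

/-! ### The super algebra of a quiver -/

section QuiverAlgebra

variable {k V E : Type*} [CommRing k] (s t : E → V) (A : V → Type*) (M : E → Type*)
  [∀ v, Ring (A v)] [∀ e, AddCommGroup (M e)]

/-- The module `⨁_v A_v ⊕ ⨁_e M_e` of a quiver with vertices `V`, edges `E`, source `s` and
target `t`. -/
@[nolint unusedArguments]
def QuiverAlgebra (_s _t : E → V) (A : V → Type*) (M : E → Type*)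
    [∀ v, Ring (A v)] [∀ e, AddCommGroup (M e)] : Type _ :=
  (Π₀ v, A v) × (Π₀ e, M e)

namespace QuiverAlgebra

instance : AddCommGroup (QuiverAlgebra s t A M) :=
  inferInstanceAs (AddCommGroup ((Π₀ v, A v) × (Π₀ e, M e)))

instance [∀ v, Algebra k (A v)] [∀ e, Module k (M e)] : Module k (QuiverAlgebra s t A M) :=
  inferInstanceAs (Module k ((Π₀ v, A v) × (Π₀ e, M e)))

variable {s t A M} in
@[ext]
theorem ext' {x y : QuiverAlgebra s t A M} (h₁ : ∀ v, x.1 v = y.1 v) (h₂ : ∀ e, x.2 e = y.2 e) :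
    x = y :=
  Prod.ext (DFinsupp.ext h₁) (DFinsupp.ext h₂)

section

variable {s t A M}

@[simp] theorem add_fst (x y : QuiverAlgebra s t A M) (v : V) :
    (x + y).1 v = x.1 v + y.1 v := rfl

@[simp] theorem add_snd (x y : QuiverAlgebra s t A M) (e : E) :
    (x + y).2 e = x.2 e + y.2 e := rfl

@[simp] theorem zero_fst (v : V) : (0 : QuiverAlgebra s t A M).1 v = 0 := rfl

@[simp] theorem zero_snd (e : E) : (0 : QuiverAlgebra s t A M).2 e = 0 := rfl

@[simp] theorem smul_fst [∀ v, Algebra k (A v)] [∀ e, Module k (M e)] (c : k)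
    (x : QuiverAlgebra s t A M) (v : V) : (c • x).1 v = c • x.1 v := rfl

@[simp] theorem smul_snd [∀ v, Algebra k (A v)] [∀ e, Module k (M e)] (c : k)
    (x : QuiverAlgebra s t A M) (e : E) : (c • x).2 e = c • x.2 e := rfl

end

variable [∀ e, Module (A (s e)) (M e)] [∀ e, Module (A (t e))ᵐᵒᵖ (M e)]

/-- The product `(a, m) (a', m') = (a a', a m' + m a')`: the algebras of distinct vertices are
orthogonal, `M_e` is a left module over `A_{s(e)}` and a right module over `A_{t(e)}`, all the
other products of a vertex part with an edge part are zero, and so are all the products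
`M_e M_{e'}`. -/
instance : Mul (QuiverAlgebra s t A M) where
  mul x y :=
    (DFinsupp.zipWith (fun _ a b => a * b) (fun _ => mul_zero 0) x.1 y.1,
      DFinsupp.mapRange (fun e (m : M e) => x.1 (s e) • m) (fun _ => smul_zero _) y.2 +
      DFinsupp.mapRange (fun e (m : M e) => MulOpposite.op (y.1 (t e)) • m)
        (fun _ => smul_zero _) x.2)

variable {s t A M}

@[simp] theorem mul_fst (x y : QuiverAlgebra s t A M) (v : V) :
    (x * y).1 v = x.1 v * y.1 v :=
  DFinsupp.zipWith_apply _ (fun _ => mul_zero 0) x.1 y.1 v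

@[simp] theorem mul_snd (x y : QuiverAlgebra s t A M) (e : E) :
    (x * y).2 e = x.1 (s e) • y.2 e + MulOpposite.op (y.1 (t e)) • x.2 e := by
  change (_ + _ : Π₀ e, M e) e = _
  simp

instance [∀ e, SMulCommClass (A (s e)) (A (t e))ᵐᵒᵖ (M e)] :
    NonUnitalRing (QuiverAlgebra s t A M) where
  left_distrib x y z := by
    ext i
    · simp [mul_add]
    · simp [smul_add, add_smul]; abel
  right_distrib x y z := by
    ext i
    · simp [add_mul]
    · simp [smul_add, add_smul]; abel
  zero_mul x := by ext i <;> simp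
  mul_zero x := by ext i <;> simp
  mul_assoc x y z := by
    ext i
    · simp [mul_assoc]
    · simp [smul_add, mul_smul, smul_comm, add_assoc]

section Linear

variable [∀ v, Algebra k (A v)] [∀ e, Module k (M e)]
  [∀ e, SMulCommClass (A (s e)) (A (t e))ᵐᵒᵖ (M e)]
  [∀ e, IsScalarTower k (A (s e)) (M e)] [∀ e, IsScalarTower k (A (t e))ᵐᵒᵖ (M e)]

instance : IsScalarTower k (QuiverAlgebra s t A M) (QuiverAlgebra s t A M) where
  smul_assoc c x y := by
    ext i
    · simp
    · simp only [smul_eq_mul, mul_snd, smul_fst, smul_snd, smul_add, smul_assoc]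
      rw [smul_comm c (MulOpposite.op (y.1 (t i)))]

instance : SMulCommClass k (QuiverAlgebra s t A M) (QuiverAlgebra s t A M) where
  smul_comm c x y := by
    ext i
    · simp
    · simp only [smul_eq_mul, mul_snd, smul_fst, smul_snd, smul_add, smul_assoc,
        MulOpposite.op_smul]
      rw [smul_comm c (x.1 (s i))]

end Linear

end QuiverAlgebra

section Grading

variable (k) [∀ v, Algebra k (A v)] [∀ e, Module k (M e)]

/-- The grading of the algebra of a quiver in which the `A_v` have degree `0` and the `M_e` have
degree `-1` (that is, the `M_e` enter as `M_e[-1]`). -/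
def quiverGrading (d : ℤ) : Submodule k (QuiverAlgebra s t A M) where
  carrier := {x | (d ≠ 0 → x.1 = 0) ∧ (d ≠ -1 → x.2 = 0)}
  add_mem' := by
    intro x y hx hy
    exact ⟨fun h => (congrArg₂ (· + ·) (hx.1 h) (hy.1 h)).trans (add_zero _),
      fun h => (congrArg₂ (· + ·) (hx.2 h) (hy.2 h)).trans (add_zero _)⟩
  zero_mem' := ⟨fun _ => rfl, fun _ => rfl⟩
  smul_mem' := by
    intro c x hx
    exact ⟨fun h => (congrArg (c • ·) (hx.1 h)).trans (smul_zero _),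
      fun h => (congrArg (c • ·) (hx.2 h)).trans (smul_zero _)⟩

/-- The vertex part `(a, m) ↦ (a, 0)`. -/
def vertexPart : QuiverAlgebra s t A M →ₗ[k] quiverGrading k s t A M 0 where
  toFun x := ⟨(x.1, 0), fun h => (h rfl).elim, fun _ => rfl⟩
  map_add' _ _ := Subtype.ext (Prod.ext rfl (add_zero _).symm)
  map_smul' _ _ := Subtype.ext (Prod.ext rfl (smul_zero _).symm)

/-- The edge part `(a, m) ↦ (0, m)`. -/
def edgePart : QuiverAlgebra s t A M →ₗ[k] quiverGrading k s t A M (-1) where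
  toFun x := ⟨(0, x.2), fun _ => rfl, fun h => (h rfl).elim⟩
  map_add' _ _ := Subtype.ext (Prod.ext (add_zero _).symm rfl)
  map_smul' _ _ := Subtype.ext (Prod.ext (smul_zero _).symm rfl)

instance : DirectSum.Decomposition (quiverGrading k s t A M) :=
  DirectSum.Decomposition.ofLinearMap (quiverGrading k s t A M)
    (DirectSum.lof k ℤ (fun d => quiverGrading k s t A M d) 0 ∘ₗ vertexPart k s t A M +
      DirectSum.lof k ℤ (fun d => quiverGrading k s t A M d) (-1) ∘ₗ edgePart k s t A M)
    (by
      refine LinearMap.ext fun x => ?_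
      simp only [LinearMap.comp_apply, LinearMap.add_apply, map_add, DirectSum.coeLinearMap_lof]
      exact Prod.ext (add_zero _) (zero_add _))
    (by
      refine DirectSum.linearMap_ext k fun d => LinearMap.ext fun a => ?_
      simp only [LinearMap.comp_apply, LinearMap.add_apply, DirectSum.coeLinearMap_lof,
        LinearMap.id_apply]
      by_cases h₀ : d = 0
      · subst h₀
        have e₁ : vertexPart k s t A M a = a :=
          Subtype.ext (Prod.ext rfl (a.2.2 (by decide)).symm)
        have e₂ : edgePart k s t A M a = 0 :=
          Subtype.ext (Prod.ext rfl (a.2.2 (by decide)))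
        rw [e₁, e₂, map_zero, add_zero]
      · by_cases h₁ : d = -1
        · subst h₁
          have e₁ : vertexPart k s t A M a = 0 :=
            Subtype.ext (Prod.ext (a.2.1 (by decide)) rfl)
          have e₂ : edgePart k s t A M a = a :=
            Subtype.ext (Prod.ext (a.2.1 (by decide)).symm rfl)
          rw [e₁, e₂, map_zero, zero_add]
        · obtain rfl : a = 0 := Subtype.ext (Prod.ext (a.2.1 h₀) (a.2.2 h₁))
          simp)

/-- The product respects the grading, so that this is a graded algebra. -/
instance [∀ e, Module (A (s e)) (M e)] [∀ e, Module (A (t e))ᵐᵒᵖ (M e)] :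
    SetLike.GradedMul (quiverGrading k s t A M) where
  mul_mem {i j x y} hx hy := by
    refine ⟨fun h => DFinsupp.ext fun v => ?_, fun h => DFinsupp.ext fun e => ?_⟩
    · rw [QuiverAlgebra.mul_fst]
      by_cases hi : i = 0
      · rw [hy.1 (by omega)]; simp
      · rw [hx.1 hi]; simp
    · rw [QuiverAlgebra.mul_snd]
      by_cases hi : i = 0
      · rw [hx.2 (by omega), hy.2 (by omega)]; simp
      · rw [hx.1 hi]
        by_cases hj : j = 0
        · rw [hx.2 (by omega)]; simp
        · rw [hy.1 hj]; simp

end Grading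

end QuiverAlgebra

/-! ### The bar complex of a cyclic derived tensor product -/

section BarBlock

variable (k : Type*) [CommRing k] (R : Type*) [Ring R] [Algebra k R]
  (N : Type*) [AddCommGroup N] [Module k N]

/-- `N ⊗ T(R[1]) = ⨁ₙ N ⊗ R^{⊗ n}`, the part `N ⊗ R^{⊗ n}` having degree `n`. -/
abbrev BarBlock : Type _ := ⨁ n : ℕ, N ⊗[k] (⨂[k]^n R)

namespace BarBlock

/-- Inclusion of the part of degree `n`. -/
abbrev incl (n : ℕ) : N ⊗[k] (⨂[k]^n R) →ₗ[k] BarBlock k R N :=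
  DirectSum.lof k ℕ (fun n => N ⊗[k] (⨂[k]^n R)) n

/-- Projection on the part of even degree. -/
def even : BarBlock k R N →ₗ[k] BarBlock k R N :=
  DirectSum.toModule k ℕ _ (fun n => if Even n then incl k R N n else 0)

/-- Projection on the part of odd degree. -/
def odd : BarBlock k R N →ₗ[k] BarBlock k R N :=
  DirectSum.toModule k ℕ _ (fun n => if Even n then 0 else incl k R N n)

/-- The sign operator, `(-1)ⁿ` in degree `n`. -/
def sgn : BarBlock k R N →ₗ[k] BarBlock k R N := even k R N - odd k R N

/-- Split off the last letter: `x ⊗ a₁ ⊗ ⋯ ⊗ aₙ ↦ (x ⊗ a₁ ⊗ ⋯ ⊗ aₙ₋₁) ⊗ aₙ`, and `x ↦ 0` in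
degree `0`. -/
def strip : BarBlock k R N →ₗ[k] BarBlock k R N ⊗[k] R :=
  DirectSum.toModule k ℕ _ (fun n => match n with
    | 0 => 0
    | n + 1 => (incl k R N n).rTensor R ∘ₗ
        (TensorProduct.assoc k N (⨂[k]^n R) R).symm.toLinearMap ∘ₗ (splitLast k R n).lTensor N)

/-- The right action of `R` on `N`, as the map `x ⊗ a ↦ x a`. -/
def rightAct [Module Rᵐᵒᵖ N] [IsScalarTower k Rᵐᵒᵖ N] : N ⊗[k] R →ₗ[k] N :=
  TensorProduct.lift (LinearMap.mk₂ k (fun x a => MulOpposite.op a • x)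
    (fun x y a => smul_add _ _ _) (fun c x a => smul_comm _ _ _)
    (fun x a b => by rw [MulOpposite.op_add, add_smul])
    (fun c x a => by rw [MulOpposite.op_smul, smul_assoc]))

/-- The internal part of the bar differential,
`x ⊗ a₁ ⊗ ⋯ ⊗ aₙ ↦ x a₁ ⊗ a₂ ⊗ ⋯ ⊗ aₙ + ∑_{l = 1}^{n - 1} (-1)^l x ⊗ ⋯ ⊗ a_l a_{l+1} ⊗ ⋯`. -/
def inner [Module Rᵐᵒᵖ N] [IsScalarTower k Rᵐᵒᵖ N] : BarBlock k R N →ₗ[k] BarBlock k R N :=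
  DirectSum.toModule k ℕ _ (fun n => match n with
    | 0 => 0
    | n + 1 => incl k R N n ∘ₗ
        ((rightAct k R N).rTensor _ ∘ₗ
            (TensorProduct.assoc k N R (⨂[k]^n R)).symm.toLinearMap ∘ₗ
            (splitFirst k R n).lTensor N +
          ∑ l : Fin n, (-1 : k) ^ ((l : ℕ) + 1) • (face k R n l).lTensor N))

/-- The left action of an algebra `L` on `N`, extended to `N ⊗ T(R[1])`. -/
def leftAct (L : Type*) [Ring L] [Algebra k L] [Module L N] [IsScalarTower k L N] :
    L →ₗ[k] (BarBlock k R N →ₗ[k] BarBlock k R N) where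
  toFun a := DirectSum.toModule k ℕ _
    (fun n => incl k R N n ∘ₗ (Algebra.lsmul k k N a).rTensor _)
  map_add' a b := by
    refine DirectSum.linearMap_ext k fun n => LinearMap.ext fun x => ?_
    simp [LinearMap.rTensor_add]
  map_smul' c a := by
    refine DirectSum.linearMap_ext k fun n => LinearMap.ext fun x => ?_
    simp [LinearMap.rTensor_smul]

end BarBlock

end BarBlock

section Cycles

/-- A pointed cycle of length `m + 1`: a sequence of edges `e₀, …, e_m` such that each of them ends
where the next one (cyclically) begins. The index `i + 1` is computed in `Fin (m + 1)`, so that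
`m + 1 = 0`. -/
def IsPointedCycle {V E : Type*} (s t : E → V) {m : ℕ} (c : Fin (m + 1) → E) : Prop :=
  ∀ i, t (c i) = s (c (i + 1))

/-- Cyclic permutation of pointed cycles of length `m + 1`. -/
def cycleSetoid {V E : Type*} (s t : E → V) (m : ℕ) :
    Setoid {c : Fin (m + 1) → E // IsPointedCycle s t c} where
  r c c' := ∃ r : Fin (m + 1), ∀ i, c'.1 i = c.1 (i + r)
  iseqv :=
    { refl := fun c => ⟨0, fun i => by rw [add_zero]⟩
      symm := by
        rintro c c' ⟨r, h⟩
        exact ⟨-r, fun i => by rw [h, neg_add_cancel_right]⟩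
      trans := by
        rintro c c' c'' ⟨r, h⟩ ⟨r', h'⟩
        exact ⟨r' + r, fun i => by rw [h', h, add_assoc]⟩ }

/-- `Cyc(Q)`: the cycles of length `≥ 1`, as classes of pointed cycles up to cyclic permutation. -/
def Cyc {V E : Type*} (s t : E → V) : Type _ := Σ m : ℕ, Quotient (cycleSetoid s t m)

/-- The pointed cycle `c` is the `d`-th power of some pointed cycle `c₀`. -/
def IsCyclePower {V E : Type*} (s t : E → V) {m : ℕ} (c : Fin (m + 1) → E) (d : ℕ) : Prop :=
  ∃ (l : ℕ) (c₀ : Fin (l + 1) → E), IsPointedCycle s t c₀ ∧ d * (l + 1) = m + 1 ∧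
    ∀ i : Fin (m + 1), c i = c₀ (Fin.ofNat (l + 1) i)

/-- The degree of a cycle: the largest `d` such that it is a `d`-th power. -/
def cycleDegree {V E : Type*} (s t : E → V) {m : ℕ} (c : Fin (m + 1) → E) : ℕ :=
  sSup {d | IsCyclePower s t c d}

end Cycles

section CyclicBar

variable (k : Type*) {V E : Type*} [CommRing k] (s t : E → V) (A : V → Type*) (M : E → Type*)
  [∀ v, Ring (A v)] [∀ v, Algebra k (A v)]
  [∀ e, AddCommGroup (M e)] [∀ e, Module k (M e)]

/-- The block `M_e ⊗ T(A_{t(e)}[1])`. -/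
abbrev Block (e : E) : Type _ := BarBlock k (A (t e)) (M e)

/-- For edges `c = (e₀, …, e_m)`, the module
`M_{e₀} ⊗ T(A_{t(e₀)}[1]) ⊗ M_{e₁} ⊗ T(A_{t(e₁)}[1]) ⊗ ⋯ ⊗ M_{e_m} ⊗ T(A_{t(e_m)}[1])`. If `c` is a
pointed cycle, this is the cyclic tensor product over the `A_{t(e_i)}` of the bar resolutions
`M_e ⊗ T(A_{t(e)}[1]) ⊗ A_{t(e)}` of the bimodules `M_e`. -/
abbrev CyclicBar {m : ℕ} (c : Fin (m + 1) → E) : Type _ := ⨂[k] j, Block k t A M (c j)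

/-- The part of degree `n`: in all, there are `n` letters from the algebras. -/
def cyclicBarDegree {m : ℕ} (c : Fin (m + 1) → E) (n : ℤ) : Submodule k (CyclicBar k t A M c) :=
  Submodule.span k {x | ∃ (y : ∀ j, Block k t A M (c j)) (d : Fin (m + 1) → ℕ),
    (∀ j, y j ∈ LinearMap.range (BarBlock.incl k (A (t (c j))) (M (c j)) (d j))) ∧
      ((∑ j, d j : ℕ) : ℤ) = n ∧ x = PiTensorProduct.tprod k y}

section Differential

variable [∀ e, Module (A (s e)) (M e)] [∀ e, Module (A (t e))ᵐᵒᵖ (M e)]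
  [∀ e, IsScalarTower k (A (s e)) (M e)] [∀ e, IsScalarTower k (A (t e))ᵐᵒᵖ (M e)]

/-- If `v` is the source of `e`, the left action of `A_v` on the block of `e`. -/
def blockLeftAct {v : V} {e : E} (h : v = s e) :
    A v →ₗ[k] (Block k t A M e →ₗ[k] Block k t A M e) :=
  h ▸ BarBlock.leftAct k (A (t e)) (M e) (A (s e))

variable {s}

/-- Multiply the last letter of the block `j` into the module `M` of the next block, from the
left (the result is `0` where the block `j` has no letter from the algebra). -/
def glue {m : ℕ} {c : Fin (m + 1) → E} (hc : IsPointedCycle s t c) (j : Fin (m + 1)) :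
    CyclicBar k t A M c →ₗ[k] CyclicBar k t A M c :=
  TensorProduct.lift
      ((PiTensorProduct.mapMultilinear k _ _).toLinearMap (fun _ => LinearMap.id) (j + 1) ∘ₗ
        blockLeftAct k s t A M (hc j)).flip ∘ₗ
    extractAt j (BarBlock.strip k (A (t (c j))) (M (c j)))

/-- The bar differential: the signed sum of the products of (cyclically) adjacent letters, with
`M M = 0`. The product of a letter with the next one has the sign `(-1)^r`, where `r` is the number
of letters from the algebras up to and including the first of the two. -/
def cyclicBarD {m : ℕ} {c : Fin (m + 1) → E} (hc : IsPointedCycle s t c) :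
    CyclicBar k t A M c →ₗ[k] CyclicBar k t A M c :=
  ∑ j : Fin (m + 1),
    (PiTensorProduct.map (fun i => if i < j then BarBlock.sgn k (A (t (c i))) (M (c i)) else
        if i = j then BarBlock.inner k (A (t (c i))) (M (c i)) else LinearMap.id) +
      glue k t A M hc j ∘ₗ
        PiTensorProduct.map (fun i =>
          if i ≤ j then BarBlock.sgn k (A (t (c i))) (M (c i)) else LinearMap.id))

/-- `H_n (M_{e₀} ⊗ᴸ M_{e₁} ⊗ᴸ ⋯ ⊗ᴸ M_{e_m} ⊗ᴸ)`, the homology of the cyclic derived tensor product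
of the bimodules along a pointed cycle, with the tensor products over the `A_{t(e_i)}`. -/
abbrev cyclicTorsion {m : ℕ} {c : Fin (m + 1) → E} (hc : IsPointedCycle s t c) (n : ℤ) : Type _ :=
  gradedHomology (T := CyclicBar k t A M c) (cyclicBarD k t A M hc) (cyclicBarDegree k t A M c) n

end Differential

open Classical in
/-- The rotation by one block of the direct sum of the `CyclicBar k t A M c` over all the sequences
`c` of length `m + 1`: it moves the last block to the front, with the Koszul sign. -/
def blockRotate (m : ℕ) :
    (⨁ c : Fin (m + 1) → E, CyclicBar k t A M c) →ₗ[k]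
      ⨁ c : Fin (m + 1) → E, CyclicBar k t A M c :=
  DirectSum.toModule k _ _ (fun c =>
    DirectSum.lof k (Fin (m + 1) → E) (fun c => CyclicBar k t A M c)
        (c ∘ (finRotate (m + 1)).symm) ∘ₗ
      koszulRotate k (X := fun j => Block k t A M (c j))
        (fun j => BarBlock.even k (A (t (c j))) (M (c j)))
        (fun j => BarBlock.odd k (A (t (c j))) (M (c j))))

open Classical in
/-- The rotation by `r` blocks as an endomorphism of `CyclicBar k t A M c`, for a sequence `c` that
is invariant under rotation by `r`. -/
def blockRotation {m : ℕ} (c : Fin (m + 1) → E) (r : ℕ) :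
    CyclicBar k t A M c →ₗ[k] CyclicBar k t A M c :=
  DirectSum.component k _ _ c ∘ₗ (blockRotate k t A M m ^ r) ∘ₗ DirectSum.lof k _ _ c

variable [∀ e, Module (A (s e)) (M e)] [∀ e, Module (A (t e))ᵐᵒᵖ (M e)]
  [∀ e, IsScalarTower k (A (s e)) (M e)] [∀ e, IsScalarTower k (A (t e))ᵐᵒᵖ (M e)]

variable {s}

/-- The differences `h - g h`, for `h` in the homology of the pointed cycle `c` and `g` in the
group `ℤ/(deg c)`, whose generator acts by the rotation by `(m + 1) / deg c` blocks, which maps `c`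
to itself. -/
def rotationRelations {m : ℕ} {c : Fin (m + 1) → E} (hc : IsPointedCycle s t c) (n : ℤ) :
    Submodule k (cyclicTorsion k t A M hc n) :=
  Submodule.span k {x | ∃ (i : ℕ) (z z' : cycles (T := CyclicBar k t A M c) (cyclicBarD k t A M hc)
      (cyclicBarDegree k t A M c) n),
    (z' : CyclicBar k t A M c) =
      blockRotation k t A M c (i * ((m + 1) / cycleDegree s t c)) z ∧
    x = homologyClass _ _ n z - homologyClass _ _ n z'}

/-- `(ℱ_ℓ)_n`: the `ℤ/(deg ℓ)`-coinvariants of the homology in degree `n` of the cyclic derived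
tensor product along the cycle `ℓ` (computed for a representative of `ℓ`). -/
abbrev cycleHomology (ℓ : Cyc s t) (n : ℤ) : Type _ :=
  cyclicTorsion k t A M ℓ.2.out.2 n ⧸ rotationRelations k t A M ℓ.2.out.2 n

end CyclicBar

end QuiverCyclic

end

/-! Choose bases of all the `A_v` and `M_e`. Together they form a basis of `𝒜_Q`, and tensors of
basis elements become words in a free algebra. Letters carry their suspended degree: `1` for a
vertex letter, `0` for an edge letter. After a sign twist (`tens`) the cyclic operator is the bare
Koszul rotation `rot`, `b'` is minus `bar`, and `b` is minus `hoch`. In characteristic zero the rows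
of the cyclic bicomplex are exact except in column `0`, where the norm `N` maps onto the
rotation-invariant words. Since `N` intertwines `hoch` with `bar` (`IsGradedMul.cycNorm_hoch`) and
the vertical differentials shorten words, cyclic homology is the homology of the invariant words
under `bar` (`IsGradedMul.nonempty_cyclicHomology_equiv_invariants`).

Two letters have product zero unless the first ends where the second begins. Hence the number of
breaks, the cyclically adjacent pairs that do not compose, is unchanged by rotation and by the
differential. Prefixing a word with the unit at its source and then applying `N` gives a homotopy:
for an invariant cycle its boundary is minus the cycle, each word being weighted by its number of
breaks (`bar_cycNorm_unitCons`). In characteristic zero the words with breaks therefore contribute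
nothing. A word without breaks is a closed path; it either stays at one vertex or its edge letters
run through a cycle, and the complex splits accordingly (`nonempty_invariants_equiv_components`).
The part of a vertex `v` is the complex of invariant words of `A_v` itself, which computes
`HC(A_v)`.

For a cycle represented by `c`, the break-free words that begin with an edge letter and whose edges
read exactly `c` are a basis of the cyclic bar complex, and the bar differential becomes `hoch`
(`cyclicWords_cyclicBarD`). So `N` is a chain map from the cyclic bar complex onto the invariants of
this component. Going back by selecting the words that read `c`, the composite is the sum of the
rotations by blocks that fix `c`, that is, the sum over the group `ℤ/(deg ℓ)`
(`unword_cycNorm_cyclicWords`, `sum_blockRotation`, `cycleDegree_spec`). The order of this group is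
invertible, so the homology of the invariants is the group of coinvariants of the homology. A word
with `n + 1` algebra letters has suspended degree `n + 1` but lies in degree `n` of the invariant
complex; this is the shift `[-1]`. -/

noncomputable section

namespace QuiverCyclic

open Module

/-! ### Maps between homologies -/

section HomologyMaps

variable {k : Type*} [Field k] {T T' : Type*} [AddCommGroup T] [Module k T]
  [AddCommGroup T'] [Module k T'] {D : T →ₗ[k] T} {D' : T' →ₗ[k] T'}
  {G : ℤ → Submodule k T} {G' : ℤ → Submodule k T'} {n : ℤ}

theorem mem_cycles {x : T} : x ∈ cycles D G n ↔ D x = 0 ∧ x ∈ G n := Iff.rfl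

theorem mem_boundaries {x : cycles D G n} :
    x ∈ boundaries D G n ↔ ∃ y ∈ G (n + 1), D y = x := Iff.rfl

theorem homologyClass_surjective : Function.Surjective (homologyClass D G n) :=
  Submodule.mkQ_surjective _

theorem homologyClass_eq_zero {x : cycles D G n} :
    homologyClass D G n x = 0 ↔ ∃ y ∈ G (n + 1), D y = x :=
  (Submodule.Quotient.mk_eq_zero _).trans mem_boundaries

theorem homologyClass_eq_iff {x y : cycles D G n} :
    homologyClass D G n x = homologyClass D G n y ↔ ∃ z ∈ G (n + 1), D z = (x : T) - y := by
  rw [← sub_eq_zero, ← map_sub, homologyClass_eq_zero]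
  rfl

/-- The map induced on homology by a linear map that respects cycles and boundaries. -/
noncomputable def homologyMap (f : T →ₗ[k] T') (h₁ : ∀ x ∈ cycles D G n, f x ∈ cycles D' G' n)
    (h₂ : ∀ y ∈ G (n + 1), ∃ z ∈ G' (n + 1), D' z = f (D y)) :
    gradedHomology D G n →ₗ[k] gradedHomology D' G' n :=
  (boundaries D G n).mapQ (boundaries D' G' n) (f.restrict h₁) (by
    rintro x ⟨y, hy, hx⟩
    obtain ⟨z, hz, h⟩ := h₂ y hy
    exact ⟨z, hz, by rw [h, hx]; rfl⟩)

theorem homologyMap_class (f : T →ₗ[k] T') (h₁ : ∀ x ∈ cycles D G n, f x ∈ cycles D' G' n)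
    (h₂ : ∀ y ∈ G (n + 1), ∃ z ∈ G' (n + 1), D' z = f (D y)) (x : cycles D G n) :
    homologyMap f h₁ h₂ (homologyClass D G n x) = homologyClass D' G' n ⟨f x, h₁ x x.2⟩ := rfl

/-- A surjective map of complexes with acyclic kernel is an isomorphism on homology. (The map may
commute with the differentials up to a constant.) -/
theorem nonempty_homology_equiv_of_surjective (f : T →ₗ[k] T') (c : k) (hc : c ≠ 0)
    (hfD : ∀ m, ∀ x ∈ G m, D' (f x) = c • f (D x)) (hfG : ∀ m, ∀ x ∈ G m, f x ∈ G' m)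
    (hsurj : ∀ m, ∀ y ∈ G' m, ∃ x ∈ G m, f x = y)
    (hDG : ∀ m, ∀ x ∈ G (m + 1), D x ∈ G m) (hDD : ∀ x, D (D x) = 0)
    (hac : ∀ m, ∀ x ∈ G m, D x = 0 → f x = 0 → ∃ y ∈ G (m + 1), f y = 0 ∧ D y = x) :
    Nonempty (gradedHomology D G n ≃ₗ[k] gradedHomology D' G' n) := by
  have h₁ : ∀ x ∈ cycles D G n, f x ∈ cycles D' G' n := fun x hx =>
    mem_cycles.2 ⟨by rw [hfD n x hx.2, mem_cycles.1 hx |>.1, map_zero, smul_zero],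
      hfG n x hx.2⟩
  have h₂ : ∀ y ∈ G (n + 1), ∃ z ∈ G' (n + 1), D' z = f (D y) := fun y hy =>
    ⟨c⁻¹ • f y, Submodule.smul_mem _ _ (hfG _ y hy), by
      rw [map_smul, hfD _ y hy, smul_smul, inv_mul_cancel₀ hc, one_smul]⟩
  refine ⟨LinearEquiv.ofBijective (homologyMap f h₁ h₂) ⟨?_, ?_⟩⟩
  · rw [← LinearMap.ker_eq_bot, LinearMap.ker_eq_bot']
    intro q hq
    obtain ⟨x, rfl⟩ := homologyClass_surjective q
    rw [homologyMap_class, homologyClass_eq_zero] at hq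
    obtain ⟨y', hy', hyx⟩ := hq
    obtain ⟨y, hy, rfl⟩ := hsurj _ y' hy'
    -- Here `f x = D' (f y) = c • f (D y)`, so this difference is a cycle in the kernel of `f`, and
    -- acyclicity bounds it.
    obtain ⟨z, hz, hz0, hzx⟩ := hac n (x - c • D y)
      (Submodule.sub_mem _ x.2.2 (Submodule.smul_mem _ _ (hDG n y hy)))
      (by rw [map_sub, map_smul, hDD, mem_cycles.1 x.2 |>.1, smul_zero, sub_zero])
      (by rw [map_sub, map_smul, ← hfD _ y hy, hyx]; simp)
    rw [homologyClass_eq_zero]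
    exact ⟨z + c • y, Submodule.add_mem _ hz (Submodule.smul_mem _ _ hy), by
      rw [map_add, map_smul, hzx]; simp⟩
  · intro q
    obtain ⟨y, rfl⟩ := homologyClass_surjective q
    obtain ⟨x, hx, hxy⟩ := hsurj n y y.2.2
    have hDx : D x ∈ G (n - 1) := hDG _ x (by simpa using hx)
    have hfDx : f (D x) = 0 := by
      have := hfD n x hx
      rw [hxy, mem_cycles.1 y.2 |>.1] at this
      exact (smul_eq_zero.1 this.symm).resolve_left hc
    -- The lift `x` need not be a cycle, but `D x` lies in the acyclic kernel; subtracting `z` makes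
    -- the lift a cycle without changing its image.
    obtain ⟨z, hz, hz0, hzx⟩ := hac _ (D x) hDx (hDD x) hfDx
    rw [sub_add_cancel] at hz
    refine ⟨homologyClass D G n ⟨x - z, by simp [hzx], Submodule.sub_mem _ hx hz⟩, ?_⟩
    rw [homologyMap_class]
    congr 1
    exact Subtype.ext (by simp [hz0, hxy])

/-- If a complex splits, up to an acyclic part, into subcomplexes, its homology is the direct sum
of their homologies. -/
theorem nonempty_homology_equiv_directSum {I : Type*} (G : ℤ → Submodule k T)
    (Gᵢ : I → ℤ → Submodule k T) (P : I → T →ₗ[k] T)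
    (hle : ∀ i m, Gᵢ i m ≤ G m) (hP : ∀ i m, ∀ x ∈ G m, P i x ∈ Gᵢ i m)
    (hPD : ∀ i x, P i (D x) = D (P i x)) (hPi : ∀ i m, ∀ x ∈ Gᵢ i m, P i x = x)
    (hPj : ∀ i j m, i ≠ j → ∀ x ∈ Gᵢ i m, P j x = 0) (hfin : ∀ x, {i | P i x ≠ 0}.Finite)
    (hac : ∀ x ∈ G n, D x = 0 → (∀ i, P i x = 0) → ∃ y ∈ G (n + 1), D y = x) :
    Nonempty (gradedHomology D G n ≃ₗ[k] ⨁ i, gradedHomology D (Gᵢ i) n) := by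
  classical
  let φ : ∀ i, gradedHomology D (Gᵢ i) n →ₗ[k] gradedHomology D G n := fun i =>
    homologyMap LinearMap.id (fun x hx => ⟨hx.1, hle i n hx.2⟩) (fun y hy => ⟨y, hle i _ hy, rfl⟩)
  refine ⟨(LinearEquiv.ofBijective (DirectSum.toModule k I _ φ) ⟨?_, ?_⟩).symm⟩
  · rw [← LinearMap.ker_eq_bot, LinearMap.ker_eq_bot']
    intro q hq
    choose x hx using fun i => homologyClass_surjective (q i)
    have hq' : q = ∑ i ∈ DFinsupp.support q,
        DirectSum.lof k I _ i (homologyClass D (Gᵢ i) n (x i)) := by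
      conv_lhs => rw [← DFinsupp.sum_single (f := q)]
      exact Finset.sum_congr rfl fun i _ => by rw [hx]; rfl
    have hφ : ∀ i, φ i (homologyClass D (Gᵢ i) n (x i)) =
        homologyClass D G n ⟨x i, (x i).2.1, hle i n (x i).2.2⟩ := fun i => rfl
    rw [hq', map_sum] at hq
    simp only [DirectSum.toModule_lof, hφ] at hq
    rw [← map_sum, homologyClass_eq_zero] at hq
    obtain ⟨y, hy, hyx⟩ := hq
    simp only [AddSubmonoidClass.coe_finsetSum] at hyx
    refine DFinsupp.ext fun i => ?_
    change q i = 0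
    by_cases hi : i ∈ DFinsupp.support q
    · rw [← hx, homologyClass_eq_zero]
      -- Projecting a primitive of the whole sum gives a primitive of its `i`-th summand.
      refine ⟨P i y, hP i _ y hy, ?_⟩
      rw [← hPD, hyx, map_sum, Finset.sum_eq_single i]
      · exact hPi i n _ (x i).2.2
      · exact fun j _ hj => hPj j i n hj _ (x j).2.2
      · exact fun h => (h hi).elim
    · exact DFinsupp.notMem_support_iff.1 hi
  · intro q
    obtain ⟨x, rfl⟩ := homologyClass_surjective q
    have hx := mem_cycles.1 x.2
    let F := (hfin x).toFinset
    have hxi : ∀ i, P i x ∈ cycles D (Gᵢ i) n := fun i =>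
      mem_cycles.2 ⟨by rw [← hPD, hx.1, map_zero], hP i n _ hx.2⟩
    -- The difference is a cycle with all projections zero, hence a boundary, and `x` is homologous
    -- to the sum of its projections.
    obtain ⟨y, hy, hyx⟩ := hac (x - ∑ i ∈ F, P i x)
      (Submodule.sub_mem _ hx.2 (Submodule.sum_mem _ fun i _ => hle i n (hxi i).2))
      (by
        rw [map_sub, hx.1, map_sum, zero_sub, neg_eq_zero]
        exact Finset.sum_eq_zero fun i _ => (hxi i).1)
      (fun j => by
        rw [map_sub, map_sum, sub_eq_zero]
        by_cases hj : j ∈ F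
        · rw [Finset.sum_eq_single j, hPi j n _ (hxi j).2]
          · exact fun i _ hi => hPj i j n hi _ (hxi i).2
          · exact fun h => (h hj).elim
        · rw [Finset.sum_eq_zero]
          · simpa [F] using hj
          · exact fun i hi => hPj i j n (fun h => hj (h ▸ hi)) _ (hxi i).2)
    refine ⟨∑ i ∈ F, DirectSum.lof k I _ i (homologyClass D (Gᵢ i) n ⟨P i x, hxi i⟩), ?_⟩
    have hφ : ∀ i, φ i (homologyClass D (Gᵢ i) n ⟨P i x, hxi i⟩) =
        homologyClass D G n ⟨P i x, (hxi i).1, hle i n (hxi i).2⟩ := fun i => rfl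
    rw [map_sum]
    simp only [DirectSum.toModule_lof, hφ]
    rw [← map_sum, homologyClass_eq_iff]
    refine ⟨-y, Submodule.neg_mem _ hy, ?_⟩
    rw [map_neg, hyx, AddSubmonoidClass.coe_finsetSum, neg_sub]

/-- Homology of invariants and coinvariants of homology: `f` is given by averaging over the
operators `ρ j`, and `g` is its inverse up to the constant `d`. -/
theorem nonempty_homology_equiv_coinvariants {J : Type*} (f : T →ₗ[k] T') (g : T' →ₗ[k] T)
    (ρ : J → T →ₗ[k] T) (F : Finset J) (d : k) (hd : d ≠ 0)
    (R : Submodule k (gradedHomology D G n))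
    (hR : R = Submodule.span k {q | ∃ (j : J) (z z' : cycles D G n), (z' : T) = ρ j z ∧
      q = homologyClass D G n z - homologyClass D G n z'})
    (hfD : ∀ x, D' (f x) = f (D x)) (hfG : ∀ m, ∀ x ∈ G m, f x ∈ G' m)
    (hgD : ∀ m, ∀ x ∈ G' m, D (g x) = g (D' x)) (hgG : ∀ m, ∀ x ∈ G' m, g x ∈ G m)
    (hρ : ∀ j m, ∀ x ∈ G m, ρ j x ∈ G m) (hρD : ∀ j x, D x = 0 → D (ρ j x) = 0)
    (hF : (F.card : k) = d)
    (hgf : ∀ m, ∀ x ∈ G m, g (f x) = ∑ j ∈ F, ρ j x) (hfg : ∀ m, ∀ x ∈ G' m, f (g x) = d • x)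
    (hfρ : ∀ j x, f (ρ j x) = f x) :
    Nonempty (gradedHomology D' G' n ≃ₗ[k] gradedHomology D G n ⧸ R) := by
  have h₁ : ∀ x ∈ cycles D G n, f x ∈ cycles D' G' n := fun x hx =>
    mem_cycles.2 ⟨by rw [hfD, (mem_cycles.1 hx).1, map_zero], hfG n x hx.2⟩
  have h₂ : ∀ y ∈ G (n + 1), ∃ z ∈ G' (n + 1), D' z = f (D y) := fun y hy =>
    ⟨f y, hfG _ y hy, hfD y⟩
  have hρc : ∀ j, ∀ x ∈ cycles D G n, ρ j x ∈ cycles D G n := fun j x hx =>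
    ⟨hρD j x hx.1, hρ j n x hx.2⟩
  have hle : R ≤ LinearMap.ker (homologyMap (D' := D') (G' := G') f h₁ h₂) := by
    rw [hR, Submodule.span_le]
    rintro _ ⟨j, z, z', hz, rfl⟩
    rw [SetLike.mem_coe, LinearMap.mem_ker, map_sub, homologyMap_class, homologyMap_class,
      sub_eq_zero]
    congr 1
    exact Subtype.ext (by simp [hz, hfρ])
  refine ⟨(LinearEquiv.ofBijective (R.liftQ _ hle) ⟨?_, ?_⟩).symm⟩
  · rw [← LinearMap.ker_eq_bot, LinearMap.ker_eq_bot']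
    intro q hq
    obtain ⟨q, rfl⟩ := R.mkQ_surjective q
    obtain ⟨x, rfl⟩ := homologyClass_surjective q
    rw [Submodule.mkQ_apply, Submodule.liftQ_apply, homologyMap_class, homologyClass_eq_zero] at hq
    obtain ⟨y, hy, hyx⟩ := hq
    rw [Submodule.mkQ_apply, Submodule.Quotient.mk_eq_zero]
    -- If `f x = D' y`, then `∑ ρ j x = g (f x) = D (g y)` is a boundary. Thus `d` times the class
    -- of `x` is a sum of the relations spanning `R`.
    have key : d • homologyClass D G n x =
        ∑ j ∈ F, (homologyClass D G n x - homologyClass D G n ⟨ρ j x, hρc j x x.2⟩) := by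
      rw [Finset.sum_sub_distrib, Finset.sum_const, ← Nat.cast_smul_eq_nsmul k, hF]
      rw [eq_comm, sub_eq_self, ← map_sum, homologyClass_eq_zero]
      refine ⟨g y, hgG _ y hy, ?_⟩
      rw [hgD _ y hy, hyx, hgf n x x.2.2, AddSubmonoidClass.coe_finsetSum]
    rw [← one_smul k (homologyClass D G n x), ← inv_mul_cancel₀ hd, mul_smul, key]
    refine R.smul_mem _ (R.sum_mem fun j _ => ?_)
    rw [hR]
    exact Submodule.subset_span ⟨j, x, _, rfl, rfl⟩
  · intro q
    obtain ⟨x, rfl⟩ := homologyClass_surjective q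
    have hx := mem_cycles.1 x.2
    -- The preimage is `d⁻¹ • g x`, because `f (g x) = d • x`.
    refine ⟨R.mkQ (d⁻¹ • homologyClass D G n ⟨g x,
      mem_cycles.2 ⟨by rw [hgD _ x hx.2, hx.1, map_zero], hgG n x hx.2⟩⟩), ?_⟩
    rw [Submodule.mkQ_apply, Submodule.liftQ_apply, map_smul, homologyMap_class, ← map_smul]
    congr 1
    refine Subtype.ext ?_
    change d⁻¹ • f (g x) = x
    rw [hfg n x hx.2, smul_smul, inv_mul_cancel₀ hd, one_smul]

end HomologyMaps

/-! ### Words -/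

section Words

variable (k : Type*) [Field k] {B : Type*}

/-- A word in the letters `B`, as an element of the free algebra. -/
def word (w : List B) : FreeAlgebra k B := (w.map (FreeAlgebra.ι k)).prod

@[simp] theorem word_nil : word k ([] : List B) = 1 := rfl

@[simp] theorem word_cons (x : B) (w : List B) :
    word k (x :: w) = FreeAlgebra.ι k x * word k w := by simp [word]

@[simp] theorem word_append (u v : List B) : word k (u ++ v) = word k u * word k v := by
  simp [word]

variable (B) in
/-- The words are a basis of the free algebra. -/
def wordBasis : Basis (List B) k (FreeAlgebra k B) :=
  (FreeAlgebra.basisFreeMonoid k B).reindex FreeMonoid.toList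

@[simp] theorem wordBasis_apply (w : List B) : wordBasis k B w = word k w := by
  have : FreeAlgebra.equivMonoidAlgebraFreeMonoid (word k w) =
      MonoidAlgebra.single (FreeMonoid.ofList w) (1 : k) := by
    induction w with
    | nil => simp; rfl
    | cons x w ih =>
      rw [word_cons, map_mul, ih, FreeAlgebra.equivMonoidAlgebraFreeMonoid]
      simp [MonoidAlgebra.single_mul_single]
  rw [wordBasis, Basis.reindex_apply, FreeAlgebra.basisFreeMonoid, Basis.map_apply]
  change FreeAlgebra.equivMonoidAlgebraFreeMonoid.symm _ = _
  rw [AlgEquiv.symm_apply_eq, this]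
  simp

/-- Linear maps on the free algebra are determined by their values on words. -/
theorem word_ext {N : Type*} [AddCommGroup N] [Module k N] {f g : FreeAlgebra k B →ₗ[k] N}
    (h : ∀ w, f (word k w) = g (word k w)) : f = g :=
  (wordBasis k B).ext fun w => by simpa using h w

/-- The operator that multiplies each word `w` by `φ w`. -/
def diag (φ : List B → k) : FreeAlgebra k B →ₗ[k] FreeAlgebra k B :=
  (wordBasis k B).constr k fun w => φ w • word k w

@[simp] theorem diag_word (φ : List B → k) (w : List B) :
    diag k φ (word k w) = φ w • word k w := by
  rw [← wordBasis_apply, diag, Basis.constr_basis, wordBasis_apply]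

theorem repr_diag (φ : List B → k) (x : FreeAlgebra k B) (w : List B) :
    (wordBasis k B).repr (diag k φ x) w = φ w * (wordBasis k B).repr x w := by
  have : (wordBasis k B).coord w ∘ₗ diag k φ = φ w • (wordBasis k B).coord w := by
    refine word_ext k fun v => ?_
    simp only [LinearMap.comp_apply, diag_word, map_smul, LinearMap.smul_apply, smul_eq_mul]
    rw [← wordBasis_apply, Basis.coord_apply, Basis.repr_self]
    by_cases h : v = w
    · rw [h]
    · simp [h]
  exact LinearMap.congr_fun this x

theorem diag_diag (φ ψ : List B → k) (x : FreeAlgebra k B) :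
    diag k φ (diag k ψ x) = diag k (fun w => φ w * ψ w) x := by
  have : diag k φ ∘ₗ diag k ψ = diag k (fun w => φ w * ψ w) :=
    word_ext k fun w => by simp [smul_smul, mul_comm]
  exact LinearMap.congr_fun this x

/-- The combinations of words with the property `P`. -/
def wordSpan (P : List B → Prop) : Submodule k (FreeAlgebra k B) :=
  Submodule.span k (word k '' {w | P w})

variable {k}

theorem word_mem_wordSpan {P : List B → Prop} {w : List B} (h : P w) : word k w ∈ wordSpan k P :=
  Submodule.subset_span ⟨w, h, rfl⟩

theorem mem_wordSpan {P : List B → Prop} {x : FreeAlgebra k B} :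
    x ∈ wordSpan k P ↔ ∀ w, (wordBasis k B).repr x w ≠ 0 → P w := by
  rw [wordSpan, show word k = ⇑(wordBasis k B) from funext fun w => (wordBasis_apply k w).symm,
    Basis.mem_span_image]
  exact ⟨fun h w hw => h (Finsupp.mem_support_iff.2 hw),
    fun h w hw => h w (Finsupp.mem_support_iff.1 hw)⟩

theorem wordSpan_mono {P Q : List B → Prop} (h : ∀ w, P w → Q w) :
    wordSpan k P ≤ wordSpan k Q :=
  Submodule.span_mono (Set.image_mono h)

theorem eq_on_wordSpan {P : List B → Prop} {N : Type*} [AddCommGroup N] [Module k N]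
    {f g : FreeAlgebra k B →ₗ[k] N} (h : ∀ w, P w → f (word k w) = g (word k w))
    {x : FreeAlgebra k B} (hx : x ∈ wordSpan k P) : f x = g x :=
  LinearMap.eqOn_span (by rintro _ ⟨w, hw, rfl⟩; exact h w hw) hx

theorem map_mem_of_wordSpan {P : List B → Prop} {N : Type*} [AddCommGroup N] [Module k N]
    {f : FreeAlgebra k B →ₗ[k] N} {S : Submodule k N} (h : ∀ w, P w → f (word k w) ∈ S)
    {x : FreeAlgebra k B} (hx : x ∈ wordSpan k P) : f x ∈ S := by
  have : wordSpan k P ≤ S.comap f := by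
    rw [wordSpan, Submodule.span_le]
    rintro _ ⟨w, hw, rfl⟩
    exact h w hw
  exact this hx

theorem diag_mem_wordSpan {P : List B → Prop} (φ : List B → k) {x : FreeAlgebra k B}
    (hx : x ∈ wordSpan k P) : diag k φ x ∈ wordSpan k P :=
  map_mem_of_wordSpan (fun w hw => by
    rw [diag_word]; exact Submodule.smul_mem _ _ (word_mem_wordSpan hw)) hx

theorem diag_eq_smul {P : List B → Prop} {φ : List B → k} {c : k} (h : ∀ w, P w → φ w = c)
    {x : FreeAlgebra k B} (hx : x ∈ wordSpan k P) : diag k φ x = c • x :=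
  eq_on_wordSpan (f := diag k φ) (g := c • LinearMap.id) (fun w hw => by simp [h w hw]) hx

variable (k)

open Classical in
/-- The projection on the combinations of words with the property `P`. -/
def wordProj (P : List B → Prop) : FreeAlgebra k B →ₗ[k] FreeAlgebra k B :=
  diag k fun w => if P w then 1 else 0

variable {k}

theorem wordProj_word_of {P : List B → Prop} {w : List B} (h : P w) :
    wordProj k P (word k w) = word k w := by simp [wordProj, h]

theorem wordProj_word_of_not {P : List B → Prop} {w : List B} (h : ¬ P w) :
    wordProj k P (word k w) = 0 := by simp [wordProj, h]

theorem wordProj_mem (P : List B → Prop) (x : FreeAlgebra k B) :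
    wordProj k P x ∈ wordSpan k P := by
  classical
  refine mem_wordSpan.2 fun w hw => ?_
  by_contra h
  exact hw (by rw [wordProj, repr_diag, if_neg h, zero_mul])

theorem wordProj_eq_self {P : List B → Prop} {x : FreeAlgebra k B} (hx : x ∈ wordSpan k P) :
    wordProj k P x = x := by
  classical
  rw [wordProj, diag_eq_smul (c := 1) (fun w hw => if_pos hw) hx, one_smul]

theorem wordProj_eq_zero {P Q : List B → Prop} (h : ∀ w, Q w → ¬ P w) {x : FreeAlgebra k B}
    (hx : x ∈ wordSpan k Q) : wordProj k P x = 0 := by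
  classical
  rw [wordProj, diag_eq_smul (c := 0) (fun w hw => if_neg (h w hw)) hx, zero_smul]

/-! ### The cyclic operators on words -/

section Operators

variable (k)

/-- Apply to each word `w` of length `L` the operator `F L`. -/
def byLength (F : ℕ → FreeAlgebra k B →ₗ[k] FreeAlgebra k B) :
    FreeAlgebra k B →ₗ[k] FreeAlgebra k B :=
  (wordBasis k B).constr k fun w => F w.length (word k w)

variable {k}

@[simp] theorem byLength_word (F : ℕ → FreeAlgebra k B →ₗ[k] FreeAlgebra k B) (w : List B) :
    byLength k F (word k w) = F w.length (word k w) := by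
  rw [← wordBasis_apply, byLength, Basis.constr_basis, wordBasis_apply]

theorem byLength_of_mem (F : ℕ → FreeAlgebra k B →ₗ[k] FreeAlgebra k B) {L : ℕ}
    {x : FreeAlgebra k B} (hx : x ∈ wordSpan k (fun w : List B => w.length = L)) :
    byLength k F x = F L x :=
  eq_on_wordSpan (fun w hw => by rw [byLength_word, hw]) hx

variable (k) (p : B → ℕ)

/-- The total (suspended) degree of a word. -/
def wordDegree (w : List B) : ℕ := (w.map p).sum

@[simp] theorem wordDegree_nil : wordDegree p [] = 0 := rfl

@[simp] theorem wordDegree_cons (x : B) (w : List B) :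
    wordDegree p (x :: w) = p x + wordDegree p w := by simp [wordDegree]

@[simp] theorem wordDegree_append (u v : List B) :
    wordDegree p (u ++ v) = wordDegree p u + wordDegree p v := by simp [wordDegree]

/-- The cyclic rotation `u x ↦ (-1)^{|u| |x|} x u` of words. -/
def rot : FreeAlgebra k B →ₗ[k] FreeAlgebra k B :=
  (wordBasis k B).constr k fun w => match w.reverse with
    | [] => 1
    | x :: u => (-1 : k) ^ (wordDegree p u.reverse * p x) • word k (x :: u.reverse)

@[simp] theorem rot_nil : rot k p 1 = 1 := by
  rw [← word_nil, ← wordBasis_apply, rot, Basis.constr_basis]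
  simp

theorem rot_concat (u : List B) (x : B) :
    rot k p (word k (u ++ [x])) = (-1 : k) ^ (wordDegree p u * p x) • word k (x :: u) := by
  rw [← wordBasis_apply, rot, Basis.constr_basis]
  simp

/-- Each rotation carries one letter of `v` past all the others. Two letters of `v` cross twice, so
their signs cancel, and only the crossings of `v` with `u` remain. -/
theorem rot_pow_append (u v : List B) :
    (rot k p ^ v.length) (word k (u ++ v)) =
      (-1 : k) ^ (wordDegree p u * wordDegree p v) • word k (v ++ u) := by
  induction v using List.reverseRecOn generalizing u with
  | nil => simp
  | append_singleton v x ih =>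
    rw [List.length_append, List.length_singleton, pow_succ, Module.End.mul_apply,
      ← List.append_assoc, rot_concat, map_smul, ← List.cons_append, ih, smul_smul, ← pow_add]
    simp only [List.append_assoc, List.cons_append, List.nil_append, wordDegree_append,
      wordDegree_cons, wordDegree_nil]
    rw [neg_one_pow_congr]
    simp only [Nat.even_add, Nat.even_mul]
    tauto

theorem rot_mem_wordSpan {P : List B → Prop} (hP : ∀ u x, P (u ++ [x]) → P (x :: u))
    {x : FreeAlgebra k B} (hx : x ∈ wordSpan k P) : rot k p x ∈ wordSpan k P := by
  refine map_mem_of_wordSpan (fun w hw => ?_) hx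
  induction w using List.reverseRecOn with
  | nil => rw [word_nil, rot_nil, ← word_nil]; exact word_mem_wordSpan hw
  | append_singleton u x _ =>
    rw [rot_concat]
    exact Submodule.smul_mem _ _ (word_mem_wordSpan (hP u x hw))

theorem rot_pow_mem_wordSpan {P : List B → Prop} (hP : ∀ u x, P (u ++ [x]) → P (x :: u))
    {x : FreeAlgebra k B} (hx : x ∈ wordSpan k P) (i : ℕ) : (rot k p ^ i) x ∈ wordSpan k P := by
  induction i with
  | zero => exact hx
  | succ i ih => rw [pow_succ', Module.End.mul_apply]; exact rot_mem_wordSpan k p hP ih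

theorem rot_mem_length {L : ℕ} {x : FreeAlgebra k B}
    (hx : x ∈ wordSpan k (fun w : List B => w.length = L)) :
    rot k p x ∈ wordSpan k (fun w : List B => w.length = L) :=
  rot_mem_wordSpan k p (fun u x h => by simpa using h) hx

theorem rot_pow_mem_length {L : ℕ} {x : FreeAlgebra k B}
    (hx : x ∈ wordSpan k (fun w : List B => w.length = L)) (i : ℕ) :
    (rot k p ^ i) x ∈ wordSpan k (fun w : List B => w.length = L) :=
  rot_pow_mem_wordSpan k p (fun u x h => by simpa using h) hx i

theorem rot_pow_length_word (w : List B) : (rot k p ^ w.length) (word k w) = word k w := by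
  simpa using rot_pow_append k p [] w

theorem rot_pow_length {L : ℕ} {x : FreeAlgebra k B}
    (hx : x ∈ wordSpan k (fun w : List B => w.length = L)) : (rot k p ^ L) x = x :=
  eq_on_wordSpan (g := LinearMap.id) (fun w hw => by rw [← hw, rot_pow_length_word]; rfl) hx

theorem rot_diag {φ : List B → k} (hφ : ∀ u x, φ (x :: u) = φ (u ++ [x])) (x : FreeAlgebra k B) :
    rot k p (diag k φ x) = diag k φ (rot k p x) := by
  refine LinearMap.congr_fun (f := rot k p ∘ₗ diag k φ) (g := diag k φ ∘ₗ rot k p)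
    (word_ext k fun w => ?_) x
  induction w using List.reverseRecOn with
  | nil => rw [LinearMap.comp_apply, LinearMap.comp_apply, diag_word, map_smul, word_nil, rot_nil,
      ← word_nil, diag_word]
  | append_singleton u x _ =>
    simp only [LinearMap.comp_apply, diag_word, map_smul, rot_concat, hφ]
    rw [smul_comm]

theorem rot_pow_diag {φ : List B → k} (hφ : ∀ u x, φ (x :: u) = φ (u ++ [x]))
    (x : FreeAlgebra k B) (i : ℕ) :
    (rot k p ^ i) (diag k φ x) = diag k φ ((rot k p ^ i) x) := by
  induction i with
  | zero => rfl
  | succ i ih => rw [pow_succ', Module.End.mul_apply, Module.End.mul_apply, ih, rot_diag k p hφ]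

/-- The norm operator `1 + t + ⋯ + t^{L - 1}` on words of length `L`. -/
def cycNorm : FreeAlgebra k B →ₗ[k] FreeAlgebra k B :=
  byLength k fun L => ∑ i ∈ Finset.range L, rot k p ^ i

theorem cycNorm_of_mem {L : ℕ} {x : FreeAlgebra k B}
    (hx : x ∈ wordSpan k (fun w : List B => w.length = L)) :
    cycNorm k p x = ∑ i ∈ Finset.range L, (rot k p ^ i) x := by
  rw [cycNorm, byLength_of_mem _ hx, LinearMap.sum_apply]

theorem cycNorm_mem_length {L : ℕ} {x : FreeAlgebra k B}
    (hx : x ∈ wordSpan k (fun w : List B => w.length = L)) :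
    cycNorm k p x ∈ wordSpan k (fun w : List B => w.length = L) := by
  rw [cycNorm_of_mem k p hx]
  exact Submodule.sum_mem _ fun i _ => rot_pow_mem_length k p hx i

variable {k} in
/-- To check a linear identity it suffices to check it on the words of each length. -/
theorem linearMap_congr_length {N : Type*} [AddCommGroup N] [Module k N]
    {f g : FreeAlgebra k B →ₗ[k] N}
    (h : ∀ L, ∀ x ∈ wordSpan k (fun w : List B => w.length = L), f x = g x)
    (x : FreeAlgebra k B) : f x = g x :=
  LinearMap.congr_fun (word_ext k fun w => h w.length _ (word_mem_wordSpan rfl)) x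

/-- The difference telescopes to `t^L - 1`, which vanishes on words of length `L`: in suspended
degrees a full turn has no sign. -/
theorem rot_cycNorm (x : FreeAlgebra k B) : rot k p (cycNorm k p x) = cycNorm k p x := by
  refine linearMap_congr_length (f := rot k p ∘ₗ cycNorm k p) (g := cycNorm k p)
    (fun L x hx => ?_) x
  rw [LinearMap.comp_apply, cycNorm_of_mem k p hx, map_sum, ← sub_eq_zero,
    ← Finset.sum_sub_distrib]
  simp only [← Module.End.mul_apply, ← pow_succ']
  rw [Finset.sum_range_sub (fun i => (rot k p ^ i) x), rot_pow_length k p hx, pow_zero,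
    Module.End.one_apply, sub_self]

theorem cycNorm_rot (x : FreeAlgebra k B) : cycNorm k p (rot k p x) = cycNorm k p x := by
  refine linearMap_congr_length (f := cycNorm k p ∘ₗ rot k p) (g := cycNorm k p)
    (fun L x hx => ?_) x
  rw [LinearMap.comp_apply, cycNorm_of_mem k p (rot_mem_length k p hx), cycNorm_of_mem k p hx,
    ← sub_eq_zero, ← Finset.sum_sub_distrib]
  simp only [← Module.End.mul_apply, ← pow_succ]
  rw [Finset.sum_range_sub (fun i => (rot k p ^ i) x), rot_pow_length k p hx, pow_zero,
    Module.End.one_apply, sub_self]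

theorem cycNorm_rot_pow (x : FreeAlgebra k B) (i : ℕ) :
    cycNorm k p ((rot k p ^ i) x) = cycNorm k p x := by
  induction i with
  | zero => rfl
  | succ i ih => rw [pow_succ', Module.End.mul_apply, cycNorm_rot, ih]

theorem rot_pow_of_invariant {x : FreeAlgebra k B} (hx : rot k p x = x) (i : ℕ) :
    (rot k p ^ i) x = x := by
  induction i with
  | zero => rfl
  | succ i ih => rw [pow_succ', Module.End.mul_apply, ih, hx]

variable {k} in
theorem exists_eq_sum_length (x : FreeAlgebra k B) : ∃ M : ℕ,
    x = ∑ L ∈ Finset.range M, wordProj k (fun w : List B => w.length = L) x := by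
  classical
  refine ⟨((wordBasis k B).repr x).support.sup List.length + 1, ?_⟩
  refine (wordBasis k B).ext_elem fun w => ?_
  rw [map_sum, Finsupp.finsetSum_apply]
  simp only [wordProj, repr_diag, ite_mul, one_mul, zero_mul]
  rw [Finset.sum_ite_eq]
  simp only [Finset.mem_range]
  split_ifs with h
  · rfl
  · by_contra hw
    exact h (Nat.lt_succ_of_le (Finset.le_sup (Finsupp.mem_support_iff.2 hw)))

/-- To check a linear identity on invariants it suffices to check it on those of each length. -/
theorem eq_on_invariant_of_length {N : Type*} [AddCommGroup N] [Module k N]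
    {f g : FreeAlgebra k B →ₗ[k] N}
    (h : ∀ L, ∀ x ∈ wordSpan k (fun w : List B => w.length = L), rot k p x = x → f x = g x)
    {x : FreeAlgebra k B} (hx : rot k p x = x) : f x = g x := by
  obtain ⟨M, hM⟩ := exists_eq_sum_length x
  rw [hM, map_sum, map_sum]
  refine Finset.sum_congr rfl fun L _ => h L _ (wordProj_mem _ _) ?_
  rw [wordProj, rot_diag k p (fun u x => by simp), hx]

/-- `rot` moves the last letter to the front and `List.rotate` the first one to the end. So
`w.rotate i` is the word from which `w` arose, and its weight is the one to use. -/
theorem rot_pow_diag_eq (φ : List B → k) (i : ℕ) (x : FreeAlgebra k B) :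
    (rot k p ^ i) (diag k φ x) = diag k (fun w => φ (w.rotate i)) ((rot k p ^ i) x) := by
  induction i generalizing φ with
  | zero => simp
  | succ i ih =>
    have key : ∀ ψ : List B → k, ∀ y, rot k p (diag k ψ y) =
        diag k (fun w => ψ (w.rotate 1)) (rot k p y) := fun ψ y => by
      refine LinearMap.congr_fun (f := rot k p ∘ₗ diag k ψ)
        (g := diag k (fun w => ψ (w.rotate 1)) ∘ₗ rot k p) (word_ext k fun w => ?_) y
      induction w using List.reverseRecOn with
      | nil => rw [LinearMap.comp_apply, LinearMap.comp_apply, diag_word, map_smul, word_nil,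
          rot_nil, ← word_nil, diag_word, List.rotate_nil]
      | append_singleton u x _ =>
        simp only [LinearMap.comp_apply, diag_word, map_smul, rot_concat]
        rw [smul_comm]
        simp
    rw [pow_succ', Module.End.mul_apply, Module.End.mul_apply, ih, key]
    simp only [List.rotate_rotate, Nat.add_comm 1 i]

/-- The number of the rotations of a word that have the property `P`. -/
def rotationCount (P : List B → Prop) [DecidablePred P] (w : List B) : ℕ :=
  ∑ i ∈ Finset.range w.length, if P (w.rotate i) then 1 else 0

/-- On an invariant `x` the `i`-th rotation of the part with `P` is the part of the same `x` with `P
(w.rotate i)`; summing over `i` counts rotations. This is used with the trivial `P` (`N` multiplies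
by the length), with closing breaks (`N` multiplies by the number of breaks) and with the words that
read a given pointed cycle. -/
theorem cycNorm_wordProj_of_invariant (P : List B → Prop) [DecidablePred P] {x : FreeAlgebra k B}
    (hx : rot k p x = x) :
    cycNorm k p (wordProj k P x) = diag k (fun w => (rotationCount P w : k)) x := by
  refine eq_on_invariant_of_length k p (f := cycNorm k p ∘ₗ wordProj k P)
    (fun L x hL hx => ?_) hx
  rw [LinearMap.comp_apply, wordProj, cycNorm_of_mem k p (diag_mem_wordSpan _ hL)]
  simp only [rot_pow_diag_eq, rot_pow_of_invariant k p hx]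
  rw [← LinearMap.sum_apply]
  refine eq_on_wordSpan (fun w hw => ?_) hL
  rw [LinearMap.sum_apply, diag_word, rotationCount, Nat.cast_sum, Finset.sum_smul, hw]
  refine Finset.sum_congr rfl fun i _ => ?_
  rw [diag_word]
  congr 1
  split_ifs <;> simp

theorem cycNorm_of_invariant {x : FreeAlgebra k B} (hx : rot k p x = x) :
    cycNorm k p x = diag k (fun w => (w.length : k)) x := by
  have := cycNorm_wordProj_of_invariant k p (fun _ => True) hx
  rw [wordProj_eq_self (P := fun _ => True) (mem_wordSpan.2 fun _ _ => trivial)] at this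
  rw [this]
  congr 2
  funext w
  simp [rotationCount]

end Operators

end Words

/-! ### The bar differential on words -/

section Bar

set_option linter.unusedSectionVars false

variable {k : Type*} [Field k] {B : Type*} {R : Type*} [NonUnitalRing R] [Module k R]
  (β : Basis B k R) (p : B → ℕ)

/-- The inclusion of an algebra in the free algebra on a basis. -/
def emb : R →ₗ[k] FreeAlgebra k B := β.constr k (FreeAlgebra.ι k)

@[simp] theorem emb_basis (x : B) : emb β (β x) = FreeAlgebra.ι k x := by
  rw [emb, Basis.constr_basis]

/-- The product of the first two letters of a word, with a sign. -/
def mulFirst : FreeAlgebra k B →ₗ[k] FreeAlgebra k B :=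
  (wordBasis k B).constr k fun w => match w with
    | x :: y :: r => (-1 : k) ^ p x • (emb β (β x * β y) * word k r)
    | _ => 0

/-- The bar differential of a word. -/
def barWord : List B → FreeAlgebra k B
  | x :: y :: r => (-1 : k) ^ p x •
      (emb β (β x * β y) * word k r + FreeAlgebra.ι k x * barWord (y :: r))
  | _ => 0

/-- The bar differential: the signed sum of all the products of adjacent letters. -/
def bar : FreeAlgebra k B →ₗ[k] FreeAlgebra k B := (wordBasis k B).constr k (barWord β p)

/-- The Hochschild differential: the signed sum of all the products of cyclically adjacent
letters. -/
def hoch : FreeAlgebra k B →ₗ[k] FreeAlgebra k B := bar β p + mulFirst β p ∘ₗ rot k p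

theorem mulFirst_word_cons_cons (x y : B) (r : List B) :
    mulFirst β p (word k (x :: y :: r)) = (-1 : k) ^ p x • (emb β (β x * β y) * word k r) := by
  rw [← wordBasis_apply, mulFirst, Basis.constr_basis]

@[simp] theorem mulFirst_one : mulFirst β p 1 = 0 := by
  rw [← word_nil, ← wordBasis_apply, mulFirst, Basis.constr_basis]

@[simp] theorem mulFirst_letter (x : B) : mulFirst β p (FreeAlgebra.ι k x) = 0 := by
  rw [show FreeAlgebra.ι k x = word k [x] by simp, ← wordBasis_apply, mulFirst,
    Basis.constr_basis]

theorem bar_word (w : List B) : bar β p (word k w) = barWord β p w := by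
  rw [← wordBasis_apply, bar, Basis.constr_basis]

@[simp] theorem bar_one : bar β p 1 = 0 := by
  rw [← word_nil, bar_word, barWord]; simp

@[simp] theorem bar_letter (x : B) : bar β p (FreeAlgebra.ι k x) = 0 := by
  rw [show FreeAlgebra.ι k x = word k [x] by simp, bar_word, barWord]; simp

/-- The recursion that separates the product of the first two letters from all later ones; the
inductions below rest on it. -/
theorem bar_letter_mul (x : B) (u : FreeAlgebra k B) :
    bar β p (FreeAlgebra.ι k x * u) = mulFirst β p (FreeAlgebra.ι k x * u) +
      (-1 : k) ^ p x • (FreeAlgebra.ι k x * bar β p u) := by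
  refine LinearMap.congr_fun (f := bar β p ∘ₗ LinearMap.mulLeft k (FreeAlgebra.ι k x))
    (g := mulFirst β p ∘ₗ LinearMap.mulLeft k (FreeAlgebra.ι k x) +
      (-1 : k) ^ p x • (LinearMap.mulLeft k (FreeAlgebra.ι k x) ∘ₗ bar β p))
    (word_ext k fun w => ?_) u
  simp only [LinearMap.comp_apply, LinearMap.add_apply, LinearMap.smul_apply,
    LinearMap.mulLeft_apply]
  rcases w with - | ⟨y, r⟩
  · simp
  · rw [← word_cons, bar_word, bar_word, mulFirst_word_cons_cons, barWord, smul_add]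

variable {β} in
/-- A linear identity for the elements of the span of some letters can be checked on letters. -/
theorem eq_on_letters {N : Type*} [AddCommGroup N] [Module k N] (f g : R →ₗ[k] N) {S : Set B}
    (h : ∀ z ∈ S, f (β z) = g (β z)) {a : R} (ha : a ∈ Submodule.span k (β '' S)) : f a = g a :=
  LinearMap.eqOn_span (by rintro _ ⟨w, hw, rfl⟩; exact h w hw) ha

/-- After one product the first letter is only a linear combination of letters. The recursion
persists if they all have the same sign `ε`. -/
theorem bar_emb_mul {ε : k} {a : R}
    (ha : a ∈ Submodule.span k (β '' {z | (-1 : k) ^ p z = ε})) (u : FreeAlgebra k B) :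
    bar β p (emb β a * u) = mulFirst β p (emb β a * u) + ε • (emb β a * bar β p u) := by
  refine eq_on_letters (bar β p ∘ₗ LinearMap.mulRight k u ∘ₗ emb β)
    (mulFirst β p ∘ₗ LinearMap.mulRight k u ∘ₗ emb β +
      ε • (LinearMap.mulRight k (bar β p u) ∘ₗ emb β)) (fun z hz => ?_) ha
  simp only [LinearMap.comp_apply, LinearMap.add_apply, LinearMap.smul_apply,
    LinearMap.mulRight_apply, emb_basis, bar_letter_mul]
  rw [hz]

variable [IsScalarTower k R R] [SMulCommClass k R R]

theorem mulFirst_emb_mul {ε : k} {a : R}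
    (ha : a ∈ Submodule.span k (β '' {z | (-1 : k) ^ p z = ε})) (b : R) (v : FreeAlgebra k B) :
    mulFirst β p (emb β a * (emb β b * v)) = ε • (emb β (a * b) * v) := by
  refine eq_on_letters (mulFirst β p ∘ₗ LinearMap.mulRight k (emb β b * v) ∘ₗ emb β)
    (ε • (LinearMap.mulRight k v ∘ₗ emb β ∘ₗ LinearMap.mulRight k b)) (fun z hz => ?_) ha
  simp only [LinearMap.comp_apply, LinearMap.smul_apply, LinearMap.mulRight_apply, emb_basis]
  refine LinearMap.congr_fun
    (f := mulFirst β p ∘ₗ LinearMap.mulLeft k (FreeAlgebra.ι k z) ∘ₗ LinearMap.mulRight k v ∘ₗ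
      emb β)
    (g := ε • (LinearMap.mulRight k v ∘ₗ emb β ∘ₗ LinearMap.mulLeft k (β z)))
    (β.ext fun y => ?_) b
  simp only [LinearMap.comp_apply, LinearMap.smul_apply, LinearMap.mulRight_apply,
    LinearMap.mulLeft_apply, emb_basis]
  refine LinearMap.congr_fun
    (f := mulFirst β p ∘ₗ LinearMap.mulLeft k (FreeAlgebra.ι k z) ∘ₗ
      LinearMap.mulLeft k (FreeAlgebra.ι k y))
    (g := ε • (LinearMap.mulLeft k (emb β (β z * β y))))
    (word_ext k fun w => ?_) v
  simp only [LinearMap.comp_apply, LinearMap.smul_apply, LinearMap.mulLeft_apply]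
  rw [← word_cons, ← word_cons, mulFirst_word_cons_cons, hz]

theorem mulFirst_letter_mul (x : B) (b : R) (v : FreeAlgebra k B) :
    mulFirst β p (FreeAlgebra.ι k x * (emb β b * v)) =
      (-1 : k) ^ p x • (emb β (β x * b) * v) := by
  rw [← emb_basis β x]
  exact mulFirst_emb_mul β p (Submodule.subset_span ⟨x, rfl, rfl⟩) b v

theorem mulFirst_emb (a : R) : mulFirst β p (emb β a) = 0 :=
  LinearMap.congr_fun (f := mulFirst β p ∘ₗ emb β) (g := 0) (β.ext fun x => by simp) a

/-- The product has degree `-1` for the suspended degree `p`. -/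
def IsGradedMul : Prop :=
  ∀ x y, β x * β y ∈ Submodule.span k (β '' {z | p z + 1 = p x + p y})

variable {β p}

theorem IsGradedMul.sign (hβ : IsGradedMul β p) (x y : B) : β x * β y ∈
    Submodule.span k (β '' {z | (-1 : k) ^ p z = -((-1) ^ p x * (-1) ^ p y)}) := by
  refine Submodule.span_mono (Set.image_mono fun z hz => ?_) (hβ x y)
  have : (-1 : k) ^ (p z + 1) = (-1) ^ (p x + p y) := congrArg _ hz
  rw [pow_succ, pow_add] at this
  change (-1 : k) ^ p z = _
  rw [← this]; ring

/-- Associativity for the first three letters: a product has suspended degree one less than the sum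
of those of its factors, so `(xy)z` and `x(yz)` occur with opposite signs. -/
theorem IsGradedMul.mulFirst_assoc (hβ : IsGradedMul β p) (x y : B) (v : FreeAlgebra k B) :
    mulFirst β p (emb β (β x * β y) * v) +
      mulFirst β p (FreeAlgebra.ι k x * mulFirst β p (FreeAlgebra.ι k y * v)) = 0 := by
  refine LinearMap.congr_fun
    (f := mulFirst β p ∘ₗ LinearMap.mulLeft k (emb β (β x * β y)) +
      mulFirst β p ∘ₗ LinearMap.mulLeft k (FreeAlgebra.ι k x) ∘ₗ mulFirst β p ∘ₗ
        LinearMap.mulLeft k (FreeAlgebra.ι k y)) (g := 0) (word_ext k fun w => ?_) v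
  simp only [LinearMap.comp_apply, LinearMap.add_apply, LinearMap.mulLeft_apply,
    LinearMap.zero_apply]
  rcases w with - | ⟨z, r⟩
  · simp [mulFirst_emb]
  · rw [word_cons, ← emb_basis β z, mulFirst_emb_mul β p (hβ.sign x y), mulFirst_letter_mul,
      mul_smul_comm, map_smul, mulFirst_letter_mul, smul_smul, mul_assoc]
    rw [neg_smul, mul_comm, neg_add_cancel]

/-- In the induction on the first letter, products at disjoint places cancel by sign, and the
overlapping ones cancel by `IsGradedMul.mulFirst_assoc`. -/
theorem IsGradedMul.bar_bar (hβ : IsGradedMul β p) (x : FreeAlgebra k B) : bar β p (bar β p x) = 0 := by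
  refine LinearMap.congr_fun (f := bar β p ∘ₗ bar β p) (g := 0) (word_ext k fun w => ?_) x
  simp only [LinearMap.comp_apply, LinearMap.zero_apply]
  induction w with
  | nil => simp
  | cons x u ih =>
    rcases u with - | ⟨y, r⟩
    · simp
    · have hD : bar β p (word k (x :: y :: r)) = (-1 : k) ^ p x • (emb β (β x * β y) * word k r +
          FreeAlgebra.ι k x * bar β p (word k (y :: r))) := by
        rw [bar_word, bar_word, barWord]
      rw [hD, map_smul, map_add, bar_letter_mul, ih, mul_zero, smul_zero, add_zero,
        bar_emb_mul β p (hβ.sign x y)]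
      rw [word_cons, bar_letter_mul, mul_add, map_add, mul_smul_comm, map_smul, ← emb_basis β y,
        mulFirst_letter_mul, emb_basis]
      have := hβ.mulFirst_assoc x y (word k r)
      rw [eq_neg_of_add_eq_zero_right this]
      module

/-- Products at disjoint places anticommute and the two ways to multiply the first three letters
cancel, which leaves one copy of the iterated first product. -/
theorem IsGradedMul.bar_mulFirst (hβ : IsGradedMul β p) (x : FreeAlgebra k B) :
    bar β p (mulFirst β p x) + mulFirst β p (bar β p x) = mulFirst β p (mulFirst β p x) := by
  refine LinearMap.congr_fun (f := bar β p ∘ₗ mulFirst β p + mulFirst β p ∘ₗ bar β p)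
    (g := mulFirst β p ∘ₗ mulFirst β p) (word_ext k fun w => ?_) x
  simp only [LinearMap.comp_apply, LinearMap.add_apply]
  rcases w with - | ⟨x, - | ⟨y, r⟩⟩
  · simp
  · simp
  · have hD : bar β p (word k (x :: y :: r)) = (-1 : k) ^ p x • (emb β (β x * β y) * word k r +
        FreeAlgebra.ι k x * bar β p (word k (y :: r))) := by
      rw [bar_word, bar_word, barWord]
    rw [hD, mulFirst_word_cons_cons]
    simp only [map_smul, map_add]
    rw [bar_emb_mul β p (hβ.sign x y)]
    rw [word_cons, bar_letter_mul, mul_add, map_add, mul_smul_comm, map_smul, ← emb_basis β y,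
      mulFirst_letter_mul, emb_basis]
    have := hβ.mulFirst_assoc x y (word k r)
    rw [eq_neg_of_add_eq_zero_right this]
    module

/-- The product has degree `p x + p y - 1`; the exponent has `+ 1` instead, which has the same
parity and avoids subtraction in `ℕ`. -/
theorem IsGradedMul.rot_pow_emb (hβ : IsGradedMul β p) (x y : B) (r u : List B) :
    (rot k p ^ u.length) (emb β (β x * β y) * word k (r ++ u)) =
      (-1 : k) ^ (wordDegree p u * (p x + p y + 1 + wordDegree p r)) •
        (word k u * (emb β (β x * β y) * word k r)) := by
  refine eq_on_letters ((rot k p ^ u.length) ∘ₗ LinearMap.mulRight k (word k (r ++ u)) ∘ₗ emb β)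
    ((-1 : k) ^ (wordDegree p u * (p x + p y + 1 + wordDegree p r)) •
      (LinearMap.mulLeft k (word k u) ∘ₗ LinearMap.mulRight k (word k r) ∘ₗ emb β))
    (fun z hz => ?_) (hβ x y)
  simp only [LinearMap.comp_apply, LinearMap.smul_apply, LinearMap.mulRight_apply,
    LinearMap.mulLeft_apply, emb_basis]
  rw [← word_cons, ← word_cons, ← word_append, ← List.cons_append, rot_pow_append,
    wordDegree_cons]
  congr 1
  rw [← hz, neg_one_pow_congr]
  simp only [Nat.even_add, Nat.even_mul, Nat.not_even_one]
  tauto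

/-- Associativity across the end of the word: for first letters `y`, `z` and last letter `x`, one
term yields `(xy)z` and the other `x(yz)`, with opposite signs. -/
theorem IsGradedMul.mulFirst_rot (hβ : IsGradedMul β p) (x : FreeAlgebra k B) :
    mulFirst β p (mulFirst β p (rot k p x)) + mulFirst β p (rot k p (mulFirst β p x)) = 0 := by
  refine LinearMap.congr_fun (f := mulFirst β p ∘ₗ mulFirst β p ∘ₗ rot k p +
    mulFirst β p ∘ₗ rot k p ∘ₗ mulFirst β p) (g := 0) (word_ext k fun w => ?_) x
  simp only [LinearMap.comp_apply, LinearMap.add_apply, LinearMap.zero_apply]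
  rcases w with - | ⟨y, w⟩
  · simp
  induction w using List.reverseRecOn with
  | nil =>
    have := rot_concat k p [] y
    simp only [List.nil_append, wordDegree_nil, zero_mul, pow_zero, one_smul] at this
    rw [this]; simp
  | append_singleton w x _ =>
    rcases w with - | ⟨z, v⟩
    · have := rot_concat k p [y] x
      rw [List.nil_append, ← List.singleton_append, this, map_smul, List.singleton_append,
        mulFirst_word_cons_cons, mulFirst_word_cons_cons, word_nil, mul_one, mul_one, map_smul,
        map_smul, map_smul, mulFirst_emb]
      have h : mulFirst β p (rot k p (emb β (β y * β x))) = 0 := by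
        refine LinearMap.congr_fun (f := mulFirst β p ∘ₗ rot k p ∘ₗ emb β) (g := 0)
          (β.ext fun z => ?_) _
        have := rot_concat k p [] z
        simp only [List.nil_append, wordDegree_nil, zero_mul, pow_zero, one_smul] at this
        rw [LinearMap.comp_apply, LinearMap.comp_apply, emb_basis,
          show FreeAlgebra.ι k z = word k [z] by simp, this]
        simp
      rw [map_smul, h]; simp
    · have h1 := hβ.rot_pow_emb y z v [x]
      simp only [List.length_singleton, pow_one, wordDegree_cons, wordDegree_nil, add_zero] at h1
      rw [List.cons_append, mulFirst_word_cons_cons, map_smul, h1, ← List.cons_append,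
        ← List.cons_append, rot_concat]
      simp only [map_smul]
      rw [mulFirst_word_cons_cons, map_smul, word_cons, word_cons, word_nil, mul_one,
        ← emb_basis β z, mulFirst_emb_mul β p (hβ.sign x y), mulFirst_letter_mul]
      simp only [smul_smul, wordDegree_cons, mul_assoc, ← add_smul]
      convert zero_smul k _ using 2
      rw [show p x * (p y + p z + 1 + wordDegree p v) =
        (p y + (p z + wordDegree p v)) * p x + p x by ring, pow_add]
      ring

/-- The `i`-th product inside `v` is obtained by bringing its pair to the front with `v.length - i`
rotations, multiplying, and turning back past `u` and the first `i` letters of `v`. The induction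
hands the first letter of `v` over to `u`. -/
theorem IsGradedMul.bar_conj_aux (hβ : IsGradedMul β p) (u v : List B) :
    (-1 : k) ^ wordDegree p u • (word k u * bar β p (word k v)) =
      ∑ i ∈ Finset.range (v.length - 1), (rot k p ^ (u.length + i))
        (mulFirst β p ((rot k p ^ (v.length - i)) (word k (u ++ v)))) := by
  induction v generalizing u with
  | nil => simp
  | cons y v ih =>
    rcases v with - | ⟨z, r⟩
    · simp
    · have ih' := ih (u ++ [y])
      simp only [List.length_cons, List.length_append, List.length_nil, add_tsub_cancel_right,
        List.append_assoc, List.cons_append, List.nil_append, zero_add] at ih' ⊢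
      rw [Finset.sum_range_succ']
      have e : ∀ i ∈ Finset.range r.length, (rot k p ^ (u.length + (i + 1)))
          (mulFirst β p ((rot k p ^ (r.length + 1 + 1 - (i + 1))) (word k (u ++ y :: z :: r)))) =
          (rot k p ^ (u.length + 1 + i))
          (mulFirst β p ((rot k p ^ (r.length + 1 - i)) (word k (u ++ y :: z :: r)))) :=
        fun i _ => by
          rw [show u.length + (i + 1) = u.length + 1 + i by ring, Nat.add_sub_add_right]
      rw [Finset.sum_congr rfl e, ← ih']
      have h := rot_pow_append k p u (y :: z :: r)
      simp only [List.length_cons] at h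
      rw [add_zero, Nat.sub_zero, h, map_smul, List.cons_append, List.cons_append,
        mulFirst_word_cons_cons, map_smul, map_smul, hβ.rot_pow_emb, bar_word β p (y :: z :: r),
        bar_word, barWord]
      simp only [wordDegree_append, wordDegree_cons, wordDegree_nil, add_zero, word_append,
        word_cons, word_nil, mul_one, smul_smul, mul_add, smul_add, mul_smul_comm, mul_assoc]
      rw [add_comm, ← pow_add, ← pow_add, ← pow_add]
      congr 2
      rw [neg_one_pow_congr]
      simp only [Nat.even_add, Nat.even_mul]
      tauto

/-- The bar differential is the sum of the conjugates of the product of the first two letters. -/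
theorem IsGradedMul.bar_conj (hβ : IsGradedMul β p) {L : ℕ} {x : FreeAlgebra k B}
    (hx : x ∈ wordSpan k (fun w : List B => w.length = L)) :
    bar β p x = ∑ i ∈ Finset.range (L - 1),
      (rot k p ^ i) (mulFirst β p ((rot k p ^ (L - i)) x)) := by
  refine (eq_on_wordSpan (g := ∑ i ∈ Finset.range (L - 1),
      (rot k p ^ i) ∘ₗ mulFirst β p ∘ₗ (rot k p ^ (L - i))) (fun w hw => ?_) hx).trans (by
    rw [LinearMap.sum_apply]; rfl)
  have := hβ.bar_conj_aux [] w
  rw [LinearMap.sum_apply, ← hw]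
  simpa using this

/-- The relation `C x y z` records which letters `z` occur in the product `x y`. All the gradings
(degree, length, breaks, components) are transported through it. -/
theorem mulFirst_mem_wordSpan {C : B → B → B → Prop}
    (hC : ∀ x y, β x * β y ∈ Submodule.span k (β '' {z | C x y z})) {P Q : List B → Prop}
    (h : ∀ x y z r, C x y z → P (x :: y :: r) → Q (z :: r)) {x : FreeAlgebra k B}
    (hx : x ∈ wordSpan k P) : mulFirst β p x ∈ wordSpan k Q := by
  refine map_mem_of_wordSpan (fun w hw => ?_) hx
  rcases w with - | ⟨x, - | ⟨y, r⟩⟩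
  · simp
  · simp
  · rw [mulFirst_word_cons_cons]
    refine Submodule.smul_mem _ _ ?_
    have : Submodule.span k (β '' {z | C x y z}) ≤
        (wordSpan k Q).comap (LinearMap.mulRight k (word k r) ∘ₗ emb β) := by
      rw [Submodule.span_le]
      rintro _ ⟨z, hz, rfl⟩
      simp only [SetLike.mem_coe, Submodule.mem_comap, LinearMap.comp_apply, emb_basis,
        LinearMap.mulRight_apply]
      rw [← word_cons]
      exact word_mem_wordSpan (h x y z r hz hw)
    exact this (hC x y)

theorem mulFirst_mem_length {L : ℕ} {x : FreeAlgebra k B}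
    (hx : x ∈ wordSpan k (fun w : List B => w.length = L)) :
    mulFirst β p x ∈ wordSpan k (fun w : List B => w.length = L - 1) :=
  mulFirst_mem_wordSpan (C := fun _ _ _ => True)
    (fun x y => by simp [β.span_eq]) (fun x y z r _ h => by simp at h ⊢; omega) hx

/-- By `IsGradedMul.bar_conj` only the product of the first two letters has to be examined, provided
that the properties are stable under rotation. -/
theorem IsGradedMul.bar_mem_wordSpan (hβ : IsGradedMul β p) {C : B → B → B → Prop}
    (hC : ∀ x y, β x * β y ∈ Submodule.span k (β '' {z | C x y z})) {P Q : List B → Prop}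
    (h : ∀ x y z r, C x y z → P (x :: y :: r) → Q (z :: r))
    (hP : ∀ u x, P (u ++ [x]) → P (x :: u)) (hQ : ∀ u x, Q (u ++ [x]) → Q (x :: u))
    {x : FreeAlgebra k B} (hx : x ∈ wordSpan k P) : bar β p x ∈ wordSpan k Q := by
  refine map_mem_of_wordSpan (fun w hw => ?_) hx
  rw [hβ.bar_conj (word_mem_wordSpan rfl)]
  exact Submodule.sum_mem _ fun i _ => rot_pow_mem_wordSpan k p hQ
    (mulFirst_mem_wordSpan hC h (rot_pow_mem_wordSpan k p hP (word_mem_wordSpan hw) _)) _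

theorem mulFirst_diag {C : B → B → B → Prop}
    (hC : ∀ x y, β x * β y ∈ Submodule.span k (β '' {z | C x y z})) {φ : List B → k}
    (hφ : ∀ x y z r, C x y z → φ (z :: r) = φ (x :: y :: r)) (x : FreeAlgebra k B) :
    mulFirst β p (diag k φ x) = diag k φ (mulFirst β p x) := by
  refine LinearMap.congr_fun (f := mulFirst β p ∘ₗ diag k φ) (g := diag k φ ∘ₗ mulFirst β p)
    (word_ext k fun w => ?_) x
  rw [LinearMap.comp_apply, LinearMap.comp_apply, diag_word, map_smul]
  rw [diag_eq_smul (c := φ w) (P := fun v => φ v = φ w) (fun _ h => h)]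
  exact mulFirst_mem_wordSpan (P := fun v => v = w) hC
    (fun x y z r hz h => (hφ x y z r hz).trans (congrArg φ h)) (word_mem_wordSpan rfl)

theorem IsGradedMul.bar_diag (hβ : IsGradedMul β p) {C : B → B → B → Prop}
    (hC : ∀ x y, β x * β y ∈ Submodule.span k (β '' {z | C x y z})) {φ : List B → k}
    (hφ : ∀ x y z r, C x y z → φ (z :: r) = φ (x :: y :: r))
    (hφ' : ∀ u x, φ (x :: u) = φ (u ++ [x])) (x : FreeAlgebra k B) :
    bar β p (diag k φ x) = diag k φ (bar β p x) := by
  refine LinearMap.congr_fun (f := bar β p ∘ₗ diag k φ) (g := diag k φ ∘ₗ bar β p)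
    (word_ext k fun w => ?_) x
  have hw : word k w ∈ wordSpan k (fun v : List B => v.length = w.length) := word_mem_wordSpan rfl
  rw [LinearMap.comp_apply, LinearMap.comp_apply, hβ.bar_conj hw,
    hβ.bar_conj (diag_mem_wordSpan φ hw), map_sum]
  simp only [rot_pow_diag k p hφ', mulFirst_diag hC hφ]

/-- With `m` the product of the first two letters, `bar` is the sum of the `t^i m t^(L-i)`.
Conjugation by `t` shifts `i` by one, so only the two end terms survive. -/
theorem IsGradedMul.rot_bar (hβ : IsGradedMul β p) (x : FreeAlgebra k B) :
    rot k p (bar β p x) = bar β p (rot k p x) - mulFirst β p (rot k p x) +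
      mulFirst β p (rot k p (rot k p x)) := by
  refine linearMap_congr_length (f := rot k p ∘ₗ bar β p) (g := bar β p ∘ₗ rot k p -
    mulFirst β p ∘ₗ rot k p + mulFirst β p ∘ₗ rot k p ∘ₗ rot k p) (fun L x hx => ?_) x
  simp only [LinearMap.comp_apply, LinearMap.add_apply, LinearMap.sub_apply]
  rw [hβ.bar_conj hx, hβ.bar_conj (rot_mem_length k p hx), map_sum, ← sub_eq_zero]
  have e : ∀ i ∈ Finset.range (L - 1), rot k p ((rot k p ^ i) (mulFirst β p ((rot k p ^ (L - i)) x)))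
      = (rot k p ^ (i + 1)) (mulFirst β p ((rot k p ^ (L + 1 - (i + 1))) x)) := fun i _ => by
    rw [pow_succ', Module.End.mul_apply, Nat.add_sub_add_right]
  have e' : ∀ i ∈ Finset.range (L - 1),
      (rot k p ^ i) (mulFirst β p ((rot k p ^ (L - i)) (rot k p x))) =
        (rot k p ^ i) (mulFirst β p ((rot k p ^ (L + 1 - i)) x)) := fun i hi => by
    rw [Finset.mem_range] at hi
    rw [show L + 1 - i = (L - i) + 1 by omega, pow_succ, Module.End.mul_apply]
  rw [Finset.sum_congr rfl e, Finset.sum_congr rfl e']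
  have tel := Finset.sum_range_sub
    (fun i => (rot k p ^ i) (mulFirst β p ((rot k p ^ (L + 1 - i)) x))) (L - 1)
  rw [Finset.sum_sub_distrib, sub_eq_iff_eq_add] at tel
  rw [tel]
  have h0 : mulFirst β p ((rot k p ^ (L + 1 - 0)) x) = mulFirst β p (rot k p x) := by
    rw [Nat.sub_zero, pow_succ', Module.End.mul_apply, rot_pow_length k p hx]
  have h1 : (rot k p ^ (L - 1)) (mulFirst β p ((rot k p ^ (L + 1 - (L - 1))) x)) =
      mulFirst β p (rot k p (rot k p x)) := by
    rw [rot_pow_length k p (mulFirst_mem_length (rot_pow_mem_length k p hx _))]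
    -- For `L = 0` the truncated subtractions spoil the formula, but both sides vanish on the empty
    -- word.
    rcases L with - | L
    · have hm : ∀ y ∈ wordSpan k (fun w : List B => w.length = 0), mulFirst β p y = 0 := fun y hy =>
        eq_on_wordSpan (g := 0) (fun w hw => by
          rw [List.length_eq_zero_iff.1 hw]; simp) hy
      rw [hm _ (rot_pow_mem_length k p hx _),
        hm _ (rot_mem_length k p (rot_mem_length k p hx))]
    · rw [show L + 1 + 1 - (L + 1 - 1) = 2 by omega, pow_two, Module.End.mul_apply]
  rw [h0, h1, pow_zero, Module.End.one_apply]
  abel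

/-- On invariant words of length `L` the inner rotations in `IsGradedMul.bar_conj` are trivial, and
the outer ones form the norm on length `L - 1`. -/
theorem IsGradedMul.bar_cycNorm (hβ : IsGradedMul β p) (x : FreeAlgebra k B) :
    bar β p (cycNorm k p x) = cycNorm k p (mulFirst β p (cycNorm k p x)) := by
  refine linearMap_congr_length (f := bar β p ∘ₗ cycNorm k p)
    (g := cycNorm k p ∘ₗ mulFirst β p ∘ₗ cycNorm k p) (fun L x hx => ?_) x
  simp only [LinearMap.comp_apply]
  have hN := cycNorm_mem_length k p hx
  rw [hβ.bar_conj hN, cycNorm_of_mem k p (mulFirst_mem_length hN)]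
  simp only [rot_pow_of_invariant k p (rot_cycNorm k p x)]

/-- `N` absorbs the outer rotations of `bar`, leaving `N m t^j` for `j = L, …, 2`. The closing term
of `hoch` supplies `j = 1`, so the sum is `N m N`, which is `bar N`. -/
theorem IsGradedMul.cycNorm_hoch (hβ : IsGradedMul β p) (x : FreeAlgebra k B) :
    cycNorm k p (hoch β p x) = bar β p (cycNorm k p x) := by
  rw [hβ.bar_cycNorm]
  refine linearMap_congr_length (f := cycNorm k p ∘ₗ hoch β p)
    (g := cycNorm k p ∘ₗ mulFirst β p ∘ₗ cycNorm k p) (fun L x hx => ?_) x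
  simp only [LinearMap.comp_apply, hoch, LinearMap.add_apply, map_add]
  rw [hβ.bar_conj hx, cycNorm_of_mem k p hx, map_sum]
  simp only [cycNorm_rot_pow]
  rw [map_sum, map_sum]
  rcases L with - | L
  · have : word k ([] : List B) = 1 := rfl
    have hx1 : mulFirst β p (rot k p x) = 0 :=
      eq_on_wordSpan (f := mulFirst β p ∘ₗ rot k p) (g := 0) (fun w hw => by
        rw [List.length_eq_zero_iff.1 hw]; simp) hx
    simp [hx1]
  · have e : ∑ i ∈ Finset.range (L + 1), cycNorm k p (mulFirst β p ((rot k p ^ i) x)) =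
        ∑ i ∈ Finset.range (L + 1), cycNorm k p (mulFirst β p ((rot k p ^ (L + 1 - i)) x)) := by
      rw [Finset.sum_range_succ', ← Finset.sum_range_reflect, Finset.sum_range_succ'
        (fun i => cycNorm k p (mulFirst β p ((rot k p ^ (L + 1 - i)) x))),
        Nat.sub_zero, rot_pow_length k p hx, pow_zero, Module.End.one_apply]
      congr 1
      refine Finset.sum_congr rfl fun i hi => ?_
      rw [Finset.mem_range] at hi
      rw [show L - 1 - i + 1 = L + 1 - (i + 1) by omega]
    rw [e, Finset.sum_range_succ, Nat.add_sub_cancel, show L + 1 - L = 1 by omega, pow_one]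

theorem IsGradedMul.hoch_sub_rot (hβ : IsGradedMul β p) (x : FreeAlgebra k B) :
    hoch β p (x - rot k p x) = bar β p x - rot k p (bar β p x) := by
  rw [hβ.rot_bar]
  simp only [hoch, LinearMap.add_apply, LinearMap.comp_apply, map_sub]
  abel

/-- Once `t bar` is expanded, the remaining terms are `IsGradedMul.bar_mulFirst` and
`IsGradedMul.mulFirst_rot`, both at the rotated element. -/
theorem IsGradedMul.hoch_hoch (hβ : IsGradedMul β p) (x : FreeAlgebra k B) :
    hoch β p (hoch β p x) = 0 := by
  have h1 := hβ.bar_mulFirst (rot k p x)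
  have h2 := hβ.mulFirst_rot (rot k p x)
  simp only [hoch, LinearMap.add_apply, LinearMap.comp_apply, map_add, hβ.bar_bar, hβ.rot_bar,
    map_sub, zero_add]
  linear_combination (norm := abel) h1 + h2

end Bar

/-! ### Tensors of homogeneous elements -/

section KoszulRotate

variable {k : Type*} [CommRing k] {m : ℕ} {X : Fin (m + 1) → Type*}
  [∀ i, AddCommGroup (X i)] [∀ i, Module k (X i)]

/-- The rotation is defined as a sum over the parity of the last factor. For homogeneous factors one
summand is zero and the other gives the Koszul sign; `q` matters only modulo two. -/
theorem koszulRotate_tprod (ev od : ∀ i, X i →ₗ[k] X i) (x : ∀ i, X i) (q : Fin (m + 1) → ℕ)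
    (hev : ∀ i, ev i (x i) = if Even (q i) then x i else 0)
    (hod : ∀ i, od i (x i) = if Even (q i) then 0 else x i) :
    koszulRotate k ev od (PiTensorProduct.tprod k x) =
      (-1 : k) ^ ((∑ i : Fin m, q i.castSucc) * q (Fin.last m)) •
        PiTensorProduct.tprod k (fun i => x ((finRotate (m + 1)).symm i)) := by
  have key : PiTensorProduct.map (R := k) (fun i => if i = Fin.last m then ev i else LinearMap.id)
        (PiTensorProduct.tprod k x) +
      PiTensorProduct.map (R := k) (fun i => if i = Fin.last m then od i else ev i - od i)
        (PiTensorProduct.tprod k x) =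
      (-1 : k) ^ ((∑ i : Fin m, q i.castSucc) * q (Fin.last m)) • PiTensorProduct.tprod k x := by
    rw [PiTensorProduct.map_tprod, PiTensorProduct.map_tprod]
    by_cases h : Even (q (Fin.last m))
    · have e₁ : (fun i => (if i = Fin.last m then ev i else LinearMap.id) (x i)) = x := by
        funext i
        split_ifs with hi
        · subst hi; rw [hev, if_pos h]
        · rfl
      have e₂ : (if Fin.last m = Fin.last m then od (Fin.last m)
          else ev (Fin.last m) - od (Fin.last m)) (x (Fin.last m)) = 0 := by
        rw [if_pos rfl, hod, if_pos h]
      have e₃ := (PiTensorProduct.tprod k).map_coord_zero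
        (m := fun i => (if i = Fin.last m then od i else ev i - od i) (x i)) (Fin.last m) e₂
      rw [e₁, e₃, add_zero,
        (h.mul_left _).neg_one_pow, one_smul]
    · have e₁ : (fun i => (if i = Fin.last m then od i else ev i - od i) (x i)) =
          fun i => (if i = Fin.last m then (1 : k) else (-1) ^ q i) • x i := by
        funext i
        split_ifs with hi
        · subst hi; rw [hod, if_neg h, one_smul]
        · rw [LinearMap.sub_apply, hev, hod]
          by_cases hq : Even (q i)
          · simp [hq]
          · rw [if_neg hq, if_neg hq, (Nat.not_even_iff_odd.1 hq).neg_one_pow]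
            simp
      have e₂ : (if Fin.last m = Fin.last m then ev (Fin.last m) else LinearMap.id)
          (x (Fin.last m)) = 0 := by
        rw [if_pos rfl, hev, if_neg h]
      have e₃ := (PiTensorProduct.tprod k).map_coord_zero
        (m := fun i => (if i = Fin.last m then ev i else LinearMap.id) (x i)) (Fin.last m) e₂
      rw [e₁, e₃, zero_add,
        MultilinearMap.map_smul_univ]
      congr 1
      rw [Fin.prod_univ_castSucc, if_pos rfl, mul_one]
      rw [Finset.prod_congr rfl (g := fun i : Fin m => (-1 : k) ^ q i.castSucc)
        (fun i _ => by rw [if_neg (Fin.castSucc_lt_last i).ne]), Finset.prod_pow_eq_pow_sum]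
      rw [neg_one_pow_congr]
      simp [Nat.even_mul, h]
  rw [koszulRotate, LinearMap.comp_apply, LinearMap.add_apply, key, map_smul]
  congr 1
  exact PiTensorProduct.reindex_tprod _ _

end KoszulRotate

/-! ### Signs and rotated tuples as lists -/

section OfFn

theorem neg_one_pow_eq_neg {k : Type*} [Ring k] {a b : ℕ} (h : Even a ↔ ¬ Even b) :
    (-1 : k) ^ a = -(-1) ^ b := by
  rw [← neg_one_mul ((-1 : k) ^ b), ← pow_succ', neg_one_pow_congr]
  rw [Nat.even_add_one, h]

theorem finRotate_symm_zero (m : ℕ) : (finRotate (m + 1)).symm 0 = Fin.last m := by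
  rw [Equiv.symm_apply_eq, finRotate_last]

theorem finRotate_symm_succ {m : ℕ} (i : Fin m) :
    (finRotate (m + 1)).symm i.succ = i.castSucc := by
  rw [Equiv.symm_apply_eq]
  ext
  rw [coe_finRotate_of_ne_last (Fin.castSucc_lt_last i).ne]
  simp

theorem ofFn_comp_finRotate_symm {X : Type*} {m : ℕ} (w : Fin (m + 1) → X) :
    List.ofFn (fun i => w ((finRotate (m + 1)).symm i)) =
      w (Fin.last m) :: List.ofFn (fun i : Fin m => w i.castSucc) := by
  rw [List.ofFn_succ, finRotate_symm_zero]
  simp only [finRotate_symm_succ]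

theorem ofFn_eq_concat {X : Type*} {m : ℕ} (w : Fin (m + 1) → X) :
    List.ofFn w = List.ofFn (fun i : Fin m => w i.castSucc) ++ [w (Fin.last m)] := by
  rw [List.ofFn_succ', List.concat_eq_append]

end OfFn

/-! ### Tensors as words -/

section Tens

set_option linter.unusedSectionVars false

variable {k : Type*} [Field k] {B : Type*} {R : Type*} [NonUnitalRing R] [Module k R]
  (β : Basis B k R) (p : B → ℕ)

/-- The exponent of the sign `(-1)^{∑ (q - j) |a_j|}` of a word `a₀ ⋯ a_q`. -/
def twistExp : List B → ℕ
  | [] => 0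
  | x :: u => u.length * (p x + 1) + twistExp u

theorem twistExp_concat (u : List B) (x : B) :
    twistExp p (u ++ [x]) = twistExp p u + wordDegree p u + u.length := by
  induction u with
  | nil => simp [twistExp]
  | cons y u ih =>
    simp only [List.cons_append, twistExp, ih, wordDegree_cons, List.length_append,
      List.length_nil, List.length_cons]
    ring

/-- The tensor `a₁ ⊗ ⋯ ⊗ aₙ` as the product `a₁ ⋯ aₙ` in the free algebra. -/
def plainWord (n : ℕ) : (⨂[k]^n R) →ₗ[k] FreeAlgebra k B :=
  PiTensorProduct.lift ((MultilinearMap.mkPiAlgebraFin k n (FreeAlgebra k B)).compLinearMap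
    fun _ => emb β)

theorem plainWord_tprod {n : ℕ} (a : Fin n → R) :
    plainWord β n (PiTensorProduct.tprod k a) = (List.ofFn fun i => emb β (a i)).prod := by
  rw [plainWord, PiTensorProduct.lift.tprod]
  rfl

theorem plainWord_tprod_basis {n : ℕ} (w : Fin n → B) :
    plainWord β n (PiTensorProduct.tprod k fun i => β (w i)) = word k (List.ofFn w) := by
  rw [plainWord_tprod, word, List.map_ofFn]
  simp only [emb_basis]
  rfl

variable (k) in
/-- The sign operator `(-1)^{∑ (q - j) |a_j|}` on words. -/
def twist : FreeAlgebra k B →ₗ[k] FreeAlgebra k B := diag k fun w => (-1 : k) ^ twistExp p w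

/-- Tensors as words, with the signs of the suspension. -/
def tens (n : ℕ) : (⨂[k]^n R) →ₗ[k] FreeAlgebra k B := twist k p ∘ₗ plainWord β n

theorem tens_tprod_basis {n : ℕ} (w : Fin n → B) :
    tens β p n (PiTensorProduct.tprod k fun i => β (w i)) =
      (-1 : k) ^ twistExp p (List.ofFn w) • word k (List.ofFn w) := by
  rw [tens, LinearMap.comp_apply, plainWord_tprod_basis, twist, diag_word]

variable {β} in
/-- Linear maps of tensors are determined by their values on tensors of basis elements. -/
theorem tensor_ext {n : ℕ} {N : Type*} [AddCommGroup N] [Module k N]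
    {f g : (⨂[k]^n R) →ₗ[k] N} (h : ∀ w : Fin n → B, f (PiTensorProduct.tprod k fun i => β (w i)) =
      g (PiTensorProduct.tprod k fun i => β (w i))) : f = g :=
  (Basis.piTensorProduct fun _ : Fin n => β).ext fun w => by
    rw [Basis.piTensorProduct_apply]; exact h w

theorem tens_mem_length {n : ℕ} (x : ⨂[k]^n R) :
    tens β p n x ∈ wordSpan k (fun w : List B => w.length = n) := by
  have : (⊤ : Submodule k (⨂[k]^n R)) ≤
      (wordSpan k (fun w : List B => w.length = n)).comap (tens β p n) := by
    rw [← (Basis.piTensorProduct fun _ : Fin n => β).span_eq, Submodule.span_le]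
    rintro _ ⟨w, rfl⟩
    rw [Basis.piTensorProduct_apply]
    rw [SetLike.mem_coe, Submodule.mem_comap]
    rw [tens_tprod_basis]
    exact Submodule.smul_mem _ _ (word_mem_wordSpan (by simp))
  exact this trivial

/-- Words of length `n` as tensors: the inverse of `tens`. -/
def untens (n : ℕ) : FreeAlgebra k B →ₗ[k] ⨂[k]^n R :=
  (wordBasis k B).constr k fun w => if h : w.length = n then
    (-1 : k) ^ twistExp p w • PiTensorProduct.tprod k fun i => β (w.get (i.cast h.symm)) else 0

theorem untens_word (w : List B) (n : ℕ) (h : w.length = n) :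
    untens β p n (word k w) =
      (-1 : k) ^ twistExp p w • PiTensorProduct.tprod k fun i => β (w.get (i.cast h.symm)) := by
  rw [← wordBasis_apply, untens, Basis.constr_basis, dif_pos h]

theorem untens_tens (n : ℕ) (x : ⨂[k]^n R) : untens β p n (tens β p n x) = x := by
  refine LinearMap.congr_fun (f := untens β p n ∘ₗ tens β p n) (g := LinearMap.id)
    (tensor_ext (β := β) fun w => ?_) x
  rw [LinearMap.comp_apply, tens_tprod_basis, map_smul, untens_word β p _ _ (by simp), smul_smul,
    ← pow_add, Even.neg_one_pow ⟨_, rfl⟩, one_smul, LinearMap.id_apply]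
  congr 1
  funext i
  simp

theorem tens_untens {n : ℕ} {x : FreeAlgebra k B}
    (hx : x ∈ wordSpan k (fun w : List B => w.length = n)) : tens β p n (untens β p n x) = x := by
  refine eq_on_wordSpan (f := tens β p n ∘ₗ untens β p n) (g := LinearMap.id) (fun w hw => ?_) hx
  subst hw
  rw [LinearMap.comp_apply, untens_word β p _ _ rfl, map_smul]
  have h := tens_tprod_basis β p (k := k) w.get
  rw [List.ofFn_get] at h
  have e : (fun i : Fin w.length => β (w.get (i.cast rfl))) = fun i => β (w.get i) := rfl
  rw [e, h, smul_smul, ← pow_add, Even.neg_one_pow ⟨_, rfl⟩, one_smul, LinearMap.id_apply]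

theorem twist_letter_mul (x : B) {n : ℕ} {v : FreeAlgebra k B}
    (hv : v ∈ wordSpan k (fun w : List B => w.length = n)) :
    twist k p (FreeAlgebra.ι k x * v) =
      (-1 : k) ^ (n * (p x + 1)) • (FreeAlgebra.ι k x * twist k p v) := by
  refine eq_on_wordSpan (f := twist k p ∘ₗ LinearMap.mulLeft k (FreeAlgebra.ι k x))
    (g := (-1 : k) ^ (n * (p x + 1)) • (LinearMap.mulLeft k (FreeAlgebra.ι k x) ∘ₗ twist k p))
    (fun w hw => ?_) hv
  simp only [LinearMap.comp_apply, LinearMap.smul_apply, LinearMap.mulLeft_apply]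
  rw [← word_cons, twist, diag_word, diag_word, mul_smul_comm, smul_smul, ← pow_add, twistExp, hw,
    word_cons]

variable {β p} in
theorem IsGradedMul.twist_emb_mul (hβ : IsGradedMul β p) (x y : B) (r : List B) :
    twist k p (emb β (β x * β y) * word k r) =
      (-1 : k) ^ (r.length * (p x + p y) + twistExp p r) • (emb β (β x * β y) * word k r) := by
  refine eq_on_letters (twist k p ∘ₗ LinearMap.mulRight k (word k r) ∘ₗ emb β)
    ((-1 : k) ^ (r.length * (p x + p y) + twistExp p r) •
      (LinearMap.mulRight k (word k r) ∘ₗ emb β)) (fun z hz => ?_) (hβ x y)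
  simp only [LinearMap.comp_apply, LinearMap.smul_apply, LinearMap.mulRight_apply, emb_basis]
  rw [← word_cons, twist, diag_word, twistExp, ← show p z + 1 = p x + p y from hz]

variable [IsScalarTower k R R] [SMulCommClass k R R]

theorem face_tprod (n : ℕ) (l : Fin n) (a : Fin (n + 1) → R) :
    face k R n l (PiTensorProduct.tprod k a) =
      PiTensorProduct.tprod k (Fin.contractNth l.castSucc (· * ·) a) := by
  rw [face, PiTensorProduct.lift.tprod]
  rfl

theorem contractNth_zero_cons {X : Type*} (op : X → X → X) {n : ℕ} (a : Fin (n + 2) → X) :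
    Fin.contractNth (0 : Fin (n + 2)) op a =
      Fin.cons (op (a 0) (a 1)) (fun i => a i.succ.succ) := by
  funext i
  refine Fin.cases ?_ (fun i => ?_) i
  · simp [Fin.contractNth]
  · simp [Fin.contractNth]

theorem contractNth_succ_cons {X : Type*} (op : X → X → X) {n : ℕ} (l : Fin (n + 1))
    (a : Fin (n + 2) → X) : Fin.contractNth l.succ op a =
      Fin.cons (a 0) (Fin.contractNth l op (fun i => a i.succ)) := by
  funext i
  refine Fin.cases ?_ (fun i => ?_) i
  · simp [Fin.contractNth]
  · simp only [Fin.contractNth, Fin.cons_succ, Fin.val_succ]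
    split_ifs <;> first | rfl | omega

theorem plainWord_face_zero (n : ℕ) (a : Fin (n + 2) → R) :
    plainWord β (n + 1) (face k R (n + 1) 0 (PiTensorProduct.tprod k a)) =
      emb β (a 0 * a 1) * plainWord β n (PiTensorProduct.tprod k fun i => a i.succ.succ) := by
  rw [face_tprod, Fin.castSucc_zero, contractNth_zero_cons, plainWord_tprod, plainWord_tprod,
    List.ofFn_succ, List.prod_cons]
  simp

theorem plainWord_face_succ (n : ℕ) (l : Fin n) (a : Fin (n + 2) → R) :
    plainWord β (n + 1) (face k R (n + 1) l.succ (PiTensorProduct.tprod k a)) =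
      emb β (a 0) *
        plainWord β n (face k R n l (PiTensorProduct.tprod k fun i => a i.succ)) := by
  rw [face_tprod, face_tprod, ← Fin.succ_castSucc, contractNth_succ_cons, plainWord_tprod,
    plainWord_tprod, List.ofFn_succ, List.prod_cons]
  simp

/-- The recursion of `b'` on the first letter, the unsuspended counterpart of `bar_letter_mul`. -/
theorem plainWord_barB' (n : ℕ) (a : Fin (n + 2) → R) :
    plainWord β (n + 1) (barB' k R (n + 1) (PiTensorProduct.tprod k a)) =
      emb β (a 0 * a 1) * plainWord β n (PiTensorProduct.tprod k fun i => a i.succ.succ) -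
        emb β (a 0) * plainWord β n (barB' k R n (PiTensorProduct.tprod k fun i => a i.succ)) := by
  rw [barB', LinearMap.sum_apply, Fin.sum_univ_succ, map_add, map_sum]
  simp only [LinearMap.smul_apply, map_smul, plainWord_face_zero, plainWord_face_succ]
  rw [barB', LinearMap.sum_apply, map_sum, Finset.mul_sum, sub_eq_add_neg, ← Finset.sum_neg_distrib]
  congr 1
  · simp
  · refine Finset.sum_congr rfl fun l _ => ?_
    rw [LinearMap.smul_apply, map_smul, mul_smul_comm, Fin.val_succ, pow_succ]
    simp

theorem barB'_zero : barB' k R 0 = 0 := by simp [barB']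

variable {β p}

/-- The twist exchanges the position sign `(-1)^i` of a face for the Koszul sign of the suspended
letters that precede it. A global `-1` is left over. -/
theorem IsGradedMul.tens_barB' (hβ : IsGradedMul β p) (n : ℕ) (x : ⨂[k]^(n + 1) R) :
    tens β p n (barB' k R n x) = -bar β p (tens β p (n + 1) x) := by
  refine LinearMap.congr_fun (f := tens β p n ∘ₗ barB' k R n)
    (g := -(bar β p ∘ₗ tens β p (n + 1))) (tensor_ext (β := β) fun w => ?_) x
  rw [LinearMap.neg_apply, LinearMap.comp_apply, LinearMap.comp_apply]
  induction n with
  | zero =>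
    rw [barB'_zero, LinearMap.zero_apply, map_zero, tens_tprod_basis, map_smul, List.ofFn_succ,
      List.ofFn_zero, word_cons, word_nil, mul_one, bar_letter, smul_zero, neg_zero]
  | succ n ih =>
    have ih' := ih 0 (fun i => w i.succ)
    have hlen := tens_mem_length β p (barB' k R n (PiTensorProduct.tprod k fun i => β (w i.succ)))
    -- The twist is an involution that keeps lengths, so the untwisted words have the same length as
    -- the twisted ones.
    have hlen' : plainWord β n (barB' k R n (PiTensorProduct.tprod k fun i => β (w i.succ))) ∈
        wordSpan k (fun w : List B => w.length = n) := by
      have h2 : ∀ y, twist k p (twist k p y) = y := fun y => by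
        refine LinearMap.congr_fun (f := twist k p ∘ₗ twist k p) (g := LinearMap.id)
          (word_ext k fun w => ?_) y
        rw [LinearMap.comp_apply, twist, diag_word, map_smul, diag_word, smul_smul, ← pow_add,
          Even.neg_one_pow ⟨_, rfl⟩, one_smul, LinearMap.id_apply]
      rw [tens, LinearMap.comp_apply] at hlen
      rw [← h2 (plainWord β n _)]
      exact diag_mem_wordSpan _ hlen
    rw [tens, LinearMap.comp_apply, plainWord_barB', map_sub, plainWord_tprod_basis,
      hβ.twist_emb_mul, emb_basis, twist_letter_mul p _ hlen']
    rw [tens, LinearMap.comp_apply] at ih'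
    rw [ih', tens_tprod_basis, tens_tprod_basis, map_smul, map_smul, List.ofFn_succ (f := w),
      List.ofFn_succ (f := fun i => w i.succ), bar_word, bar_word, barWord]
    simp only [twistExp, List.length_ofFn, List.length_cons, smul_smul, smul_add, mul_neg, smul_neg,
      sub_neg_eq_add, mul_smul_comm, ← pow_add, neg_add]
    rw [← neg_smul, ← neg_smul]
    congr 2
    · apply neg_one_pow_eq_neg
      simp only [Nat.even_add, Nat.even_mul, Nat.not_even_one, Fin.succ_zero_eq_one]
      tauto
    · apply neg_one_pow_eq_neg
      generalize n * (p (w (Fin.succ 0)) + 1) + twistExp p (List.ofFn fun i => w i.succ.succ) = E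
      simp only [Nat.even_add, Nat.even_mul, Nat.not_even_one]
      tauto

theorem IsGradedMul.tens_face_zero (hβ : IsGradedMul β p) (n : ℕ) (x : ⨂[k]^(n + 2) R) :
    tens β p (n + 1) (face k R (n + 1) 0 x) = -mulFirst β p (tens β p (n + 2) x) := by
  refine LinearMap.congr_fun (f := tens β p (n + 1) ∘ₗ face k R (n + 1) 0)
    (g := -(mulFirst β p ∘ₗ tens β p (n + 2))) (tensor_ext (β := β) fun w => ?_) x
  rw [LinearMap.neg_apply, LinearMap.comp_apply, LinearMap.comp_apply, tens, LinearMap.comp_apply,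
    plainWord_face_zero, plainWord_tprod_basis, hβ.twist_emb_mul, tens_tprod_basis, map_smul,
    List.ofFn_succ (f := w), List.ofFn_succ (f := fun i => w i.succ), mulFirst_word_cons_cons]
  simp only [twistExp, List.length_ofFn, List.length_cons, smul_smul, ← pow_add]
  rw [← neg_smul]
  congr 1
  apply neg_one_pow_eq_neg
  simp only [Nat.even_add, Nat.even_mul, Nat.not_even_one, Fin.succ_zero_eq_one]
  tauto

variable (𝒜 : ℤ → Submodule k R) [DirectSum.Decomposition 𝒜]

theorem evenPart_of_mem {d : ℤ} {a : R} (ha : a ∈ 𝒜 d) :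
    evenPart k 𝒜 a = if Even d then a else 0 := by
  rw [evenPart, LinearMap.comp_apply, LinearEquiv.coe_coe, DirectSum.decomposeLinearEquiv_apply,
    DirectSum.decompose_of_mem 𝒜 ha]
  change DirectSum.toModule k ℤ R _ (DirectSum.lof k ℤ (fun i => 𝒜 i) d ⟨a, ha⟩) = _
  rw [DirectSum.toModule_lof]
  split_ifs <;> rfl

theorem oddPart_of_mem {d : ℤ} {a : R} (ha : a ∈ 𝒜 d) :
    oddPart k 𝒜 a = if Even d then 0 else a := by
  rw [oddPart, LinearMap.comp_apply, LinearEquiv.coe_coe, DirectSum.decomposeLinearEquiv_apply,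
    DirectSum.decompose_of_mem 𝒜 ha]
  change DirectSum.toModule k ℤ R _ (DirectSum.lof k ℤ (fun i => 𝒜 i) d ⟨a, ha⟩) = _
  rw [DirectSum.toModule_lof]
  split_ifs <;> rfl

variable {𝒜}

/-- Suspending `n + 1` letters accounts exactly for the factor `(-1)^n` in `t`, so that the rotation
has only its Koszul sign in suspended degrees. -/
theorem tens_cyclicT (h𝒜 : ∀ x, β x ∈ 𝒜 ((p x : ℤ) - 1)) (n : ℕ) (x : ⨂[k]^(n + 1) R) :
    tens β p (n + 1) (cyclicT k 𝒜 n x) = rot k p (tens β p (n + 1) x) := by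
  refine LinearMap.congr_fun (f := tens β p (n + 1) ∘ₗ cyclicT k 𝒜 n)
    (g := rot k p ∘ₗ tens β p (n + 1)) (tensor_ext (β := β) fun w => ?_) x
  -- The internal degree `p x - 1` may be `-1`; its parity is that of the natural number `p x + 1`.
  have hpar : ∀ x, Even ((p x : ℤ) - 1) ↔ Even (p x + 1) := fun x => by
    rw [Int.even_sub, Nat.even_add]
    simp
  rw [LinearMap.comp_apply, LinearMap.comp_apply, cyclicT, LinearMap.smul_apply, rotation,
    koszulRotate_tprod _ _ _ (fun i => p (w i) + 1)
      (fun i => by simp only [evenPart_of_mem 𝒜 (h𝒜 (w i)), hpar])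
      (fun i => by simp only [oddPart_of_mem 𝒜 (h𝒜 (w i)), hpar]), map_smul, map_smul,
    tens_tprod_basis β p (fun i => w ((finRotate (n + 1)).symm i)), tens_tprod_basis, map_smul,
    ofFn_comp_finRotate_symm, ofFn_eq_concat, rot_concat, smul_smul, smul_smul, smul_smul]
  congr 1
  rw [twistExp_concat, twistExp, Finset.sum_add_distrib]
  have hs : ∑ i : Fin n, p (w i.castSucc) = wordDegree p (List.ofFn fun i : Fin n => w i.castSucc) := by
    rw [wordDegree, List.map_ofFn, List.sum_ofFn]
    rfl
  rw [hs, ← pow_add, ← pow_add, ← pow_add, neg_one_pow_congr]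
  simp only [List.length_ofFn, Finset.sum_const, Finset.card_univ, Fintype.card_fin, smul_eq_mul,
    mul_one, Nat.even_add, Nat.even_mul, Nat.not_even_one]
  tauto

theorem tens_cyclicNorm (h𝒜 : ∀ x, β x ∈ 𝒜 ((p x : ℤ) - 1)) (n : ℕ) (x : ⨂[k]^(n + 1) R) :
    tens β p (n + 1) (cyclicNorm k 𝒜 n x) = cycNorm k p (tens β p (n + 1) x) := by
  have h : ∀ i, tens β p (n + 1) ((cyclicT k 𝒜 n ^ i) x) =
      (rot k p ^ i) (tens β p (n + 1) x) := fun i => by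
    induction i with
    | zero => rfl
    | succ i ih => rw [pow_succ', pow_succ', Module.End.mul_apply, Module.End.mul_apply,
        tens_cyclicT h𝒜, ih]
  rw [cycNorm_of_mem k p (tens_mem_length β p x), cyclicNorm, LinearMap.sum_apply, map_sum]
  simp only [h]

theorem IsGradedMul.tens_hochschildB (hβ : IsGradedMul β p)
    (h𝒜 : ∀ x, β x ∈ 𝒜 ((p x : ℤ) - 1)) (q : ℕ) (x : ⨂[k]^(q + 1 + 1) R) :
    tens β p (q + 1) (hochschildB k 𝒜 q x) = -hoch β p (tens β p (q + 1 + 1) x) := by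
  rw [hochschildB, LinearMap.add_apply, map_add, hβ.tens_barB', LinearMap.smul_apply, map_smul,
    LinearMap.comp_apply, hβ.tens_face_zero, ← map_neg, ← map_neg, hoch, LinearMap.add_apply,
    LinearMap.comp_apply, ← tens_cyclicT h𝒜, cyclicT, LinearMap.smul_apply]
  simp only [map_neg, map_smul, smul_neg]
  abel

end Tens

/-! ### The cyclic bicomplex on words -/

section Tot

set_option linter.unusedSectionVars false

variable {k : Type*} [Field k] {B : Type*} {R : Type*} [NonUnitalRing R] [Module k R]
  (β : Basis B k R) (p : B → ℕ)

variable (k) in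
/-- The horizontal differential of the cyclic bicomplex of words. -/
def wordHor : (ℕ →₀ FreeAlgebra k B) →ₗ[k] ℕ →₀ FreeAlgebra k B :=
  Finsupp.lsum k fun j => match j with
    | 0 => 0
    | j + 1 => Finsupp.lsingle j ∘ₗ (if Even j then LinearMap.id - rot k p else cycNorm k p)

/-- The vertical differential of the cyclic bicomplex of words. -/
def wordVert : (ℕ →₀ FreeAlgebra k B) →ₗ[k] ℕ →₀ FreeAlgebra k B :=
  Finsupp.lsum k fun j => Finsupp.lsingle j ∘ₗ (if Even j then -hoch β p else bar β p)

/-- The total differential of the cyclic bicomplex of words. -/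
def wordTot : (ℕ →₀ FreeAlgebra k B) →ₗ[k] ℕ →₀ FreeAlgebra k B := wordHor k p + wordVert β p

theorem wordTot_apply (x : ℕ →₀ FreeAlgebra k B) :
    wordTot β p x = wordHor k p x + wordVert β p x := rfl

@[simp] theorem wordHor_single_zero (x : FreeAlgebra k B) :
    wordHor k p (Finsupp.single 0 x) = 0 := by simp [wordHor]

@[simp] theorem wordHor_single_succ (j : ℕ) (x : FreeAlgebra k B) :
    wordHor k p (Finsupp.single (j + 1) x) =
      Finsupp.single j (if Even j then x - rot k p x else cycNorm k p x) := by
  simp only [wordHor, Finsupp.lsum_single, LinearMap.comp_apply, Finsupp.lsingle_apply]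
  split_ifs <;> rfl

@[simp] theorem wordVert_single (j : ℕ) (x : FreeAlgebra k B) :
    wordVert β p (Finsupp.single j x) =
      Finsupp.single j (if Even j then -hoch β p x else bar β p x) := by
  simp only [wordVert, Finsupp.lsum_single, LinearMap.comp_apply, Finsupp.lsingle_apply]
  split_ifs <;> rfl

variable [IsScalarTower k R R] [SMulCommClass k R R]

-- The columns are complexes, the rows are complexes because `N` and `1 - t` annihilate each other,
-- and the squares anticommute by `IsGradedMul.hoch_sub_rot` and `IsGradedMul.cycNorm_hoch`.
variable {β p} in
theorem IsGradedMul.wordTot_wordTot (hβ : IsGradedMul β p) (x : ℕ →₀ FreeAlgebra k B) :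
    wordTot β p (wordTot β p x) = 0 := by
  have hNr : ∀ y : FreeAlgebra k B, cycNorm k p (y - rot k p y) = 0 := fun y => by
    rw [map_sub, cycNorm_rot, sub_self]
  refine LinearMap.congr_fun
    (f := wordTot β p ∘ₗ wordTot β p) (g := 0)
    (Finsupp.lhom_ext fun j y => ?_) x
  simp only [LinearMap.comp_apply, wordTot_apply, LinearMap.zero_apply]
  have hvv : wordVert β p (wordVert β p (Finsupp.single j y)) = 0 := by
    rw [wordVert_single, wordVert_single]
    split_ifs
    · simp [hβ.hoch_hoch]
    · simp [hβ.bar_bar]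
  rcases j with - | j
  · rw [wordHor_single_zero, zero_add, hvv, wordVert_single, wordHor_single_zero, zero_add]
  · rw [map_add, map_add, hvv, wordHor_single_succ, wordVert_single, wordVert_single,
      wordHor_single_succ, add_zero]
    have hmid : (Finsupp.single j (if Even j then if Even (j + 1) then -hoch β p y else bar β p y -
          rot k p (if Even (j + 1) then -hoch β p y else bar β p y) else
          cycNorm k p (if Even (j + 1) then -hoch β p y else bar β p y)) : ℕ →₀ FreeAlgebra k B) =
        Finsupp.single j (if Even j then bar β p y - rot k p (bar β p y) else
          -cycNorm k p (hoch β p y)) := by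
      by_cases h : Even j <;> simp [h, Nat.even_add_one]
    have hmid' : (if Even j then -hoch β p (if Even j then y - rot k p y else cycNorm k p y)
          else bar β p (if Even j then y - rot k p y else cycNorm k p y)) =
        -(if Even j then bar β p y - rot k p (bar β p y) else -cycNorm k p (hoch β p y)) := by
      by_cases h : Even j
      · simp [h, ← hβ.hoch_sub_rot]
      · simp [h, hβ.cycNorm_hoch]
    have hhh : wordHor k p (Finsupp.single j (if Even j then y - rot k p y else cycNorm k p y)) =
        0 := by
      rcases j with - | j
      · simp
      · rw [wordHor_single_succ]
        by_cases h : Even j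
        · simp [h, Nat.even_add_one, rot_cycNorm]
        · simp only [Nat.even_add_one, h, not_false_eq_true, if_true, if_false]
          rw [hNr, Finsupp.single_zero]
    rw [hhh, hmid', zero_add, Finsupp.single_neg]
    by_cases h : Even j <;> simp [h, Nat.even_add_one]

/-- The words of total degree `n + 1`, invariant under the rotation. -/
def invariants (p : B → ℕ) (n : ℤ) : Submodule k (FreeAlgebra k B) :=
  wordSpan k (fun w => w ≠ [] ∧ (wordDegree p w : ℤ) = n + 1) ⊓
    LinearMap.ker (rot k p - LinearMap.id)

theorem mem_invariants {n : ℤ} {x : FreeAlgebra k B} : x ∈ invariants p n ↔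
    x ∈ wordSpan k (fun w => w ≠ [] ∧ (wordDegree p w : ℤ) = n + 1) ∧ rot k p x = x := by
  rw [invariants, Submodule.mem_inf, LinearMap.mem_ker, LinearMap.sub_apply, sub_eq_zero]
  rfl

variable (k) in
/-- The part of total degree `n` of the cyclic bicomplex of words. -/
def wordTotDegree (n : ℤ) : Submodule k (ℕ →₀ FreeAlgebra k B) :=
  ⨅ j : ℕ, (wordSpan k (fun w : List B => w ≠ [] ∧ (wordDegree p w : ℤ) + j = n + 1)).comap
    (Finsupp.lapply j)

theorem mem_wordTotDegree {n : ℤ} {x : ℕ →₀ FreeAlgebra k B} : x ∈ wordTotDegree k p n ↔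
    ∀ j : ℕ, x j ∈ wordSpan k (fun w : List B => w ≠ [] ∧ (wordDegree p w : ℤ) + j = n + 1) := by
  simp [wordTotDegree]

theorem single_mem_wordTotDegree {n : ℤ} {j : ℕ} {x : FreeAlgebra k B}
    (hx : x ∈ wordSpan k (fun w : List B => w ≠ [] ∧ (wordDegree p w : ℤ) + j = n + 1)) :
    Finsupp.single j x ∈ wordTotDegree k p n := by
  rw [mem_wordTotDegree]
  intro i
  rw [Finsupp.single_apply]
  split_ifs with h
  · subst h; exact hx
  · exact Submodule.zero_mem _

theorem map_mem_wordTotDegree {n : ℤ} {N : Type*} [AddCommGroup N] [Module k N]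
    {f : (ℕ →₀ FreeAlgebra k B) →ₗ[k] N} {S : Submodule k N}
    (h : ∀ (j : ℕ) w, w ≠ [] → (wordDegree p w : ℤ) + j = n + 1 → f (Finsupp.single j (word k w)) ∈ S)
    {x : ℕ →₀ FreeAlgebra k B} (hx : x ∈ wordTotDegree k p n) : f x ∈ S := by
  rw [← x.sum_single, Finsupp.sum, map_sum]
  refine Submodule.sum_mem _ fun j _ => ?_
  exact map_mem_of_wordSpan (f := f ∘ₗ Finsupp.lsingle j) (fun w hw => h j w hw.1 hw.2)
    ((mem_wordTotDegree p).1 hx j)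

theorem cycNorm_mem_wordSpan {P : List B → Prop} (hP : ∀ u x, P (u ++ [x]) → P (x :: u))
    {x : FreeAlgebra k B} (hx : x ∈ wordSpan k P) : cycNorm k p x ∈ wordSpan k P := by
  refine map_mem_of_wordSpan (fun w hw => ?_) hx
  rw [cycNorm_of_mem k p (word_mem_wordSpan rfl)]
  exact Submodule.sum_mem _ fun i _ => rot_pow_mem_wordSpan k p hP (word_mem_wordSpan hw) i

theorem degree_rotate {Q : ℕ → Prop} (u : List B) (x : B)
    (h : u ++ [x] ≠ [] ∧ Q (wordDegree p (u ++ [x]))) :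
    x :: u ≠ [] ∧ Q (wordDegree p (x :: u)) :=
  ⟨by simp, by simpa [add_comm] using h.2⟩

variable {β p}

theorem degree_mul {d : ℤ} {x y z : B} {r : List B} (hz : p z + 1 = p x + p y)
    (h : (wordDegree p (x :: y :: r) : ℤ) = d + 1) : (wordDegree p (z :: r) : ℤ) = d := by
  simp only [wordDegree_cons, Nat.cast_add] at h ⊢
  have hz' : ((p z : ℤ) + 1) = p x + p y := by exact_mod_cast hz
  linarith

theorem IsGradedMul.bar_mem_degree (hβ : IsGradedMul β p) {d : ℤ} {x : FreeAlgebra k B}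
    (hx : x ∈ wordSpan k (fun w : List B => w ≠ [] ∧ (wordDegree p w : ℤ) = d + 1)) :
    bar β p x ∈ wordSpan k (fun w : List B => w ≠ [] ∧ (wordDegree p w : ℤ) = d) := by
  refine hβ.bar_mem_wordSpan (C := fun x y z => p z + 1 = p x + p y)
    (P := fun w => w ≠ [] ∧ (wordDegree p w : ℤ) = d + 1) hβ
    (fun x y z r hz h => ⟨by simp, degree_mul hz h.2⟩)
    (fun u x => degree_rotate p (Q := fun n => (n : ℤ) = d + 1) u x)
    (fun u x => degree_rotate p (Q := fun n => (n : ℤ) = d) u x) hx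

theorem IsGradedMul.hoch_mem_degree (hβ : IsGradedMul β p) {d : ℤ} {x : FreeAlgebra k B}
    (hx : x ∈ wordSpan k (fun w : List B => w ≠ [] ∧ (wordDegree p w : ℤ) = d + 1)) :
    hoch β p x ∈ wordSpan k (fun w : List B => w ≠ [] ∧ (wordDegree p w : ℤ) = d) := by
  rw [hoch, LinearMap.add_apply, LinearMap.comp_apply]
  exact Submodule.add_mem _ (hβ.bar_mem_degree hx) (mulFirst_mem_wordSpan
    (C := fun x y z => p z + 1 = p x + p y)
    (P := fun w => w ≠ [] ∧ (wordDegree p w : ℤ) = d + 1) hβ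
    (fun x y z r hz h => ⟨by simp, degree_mul hz h.2⟩) (rot_mem_wordSpan k p
    (fun u x => degree_rotate p (Q := fun n => (n : ℤ) = d + 1) u x) hx))

theorem IsGradedMul.wordTot_mem (hβ : IsGradedMul β p) {n : ℤ} {x : ℕ →₀ FreeAlgebra k B}
    (hx : x ∈ wordTotDegree k p (n + 1)) :
    wordTot β p x ∈ wordTotDegree k p n := by
  refine map_mem_wordTotDegree p (fun j w hw hd => ?_) hx
  rw [wordTot_apply, wordVert_single]
  have hw' : word k w ∈ wordSpan k
      (fun w : List B => w ≠ [] ∧ (wordDegree p w : ℤ) = (n + 1 - j) + 1) :=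
    word_mem_wordSpan ⟨hw, by linarith⟩
  refine Submodule.add_mem _ ?_ (single_mem_wordTotDegree p ?_)
  · rcases j with - | j
    · simp
    · rw [wordHor_single_succ]
      have hw' : word k w ∈ wordSpan k
          (fun w : List B => w ≠ [] ∧ (wordDegree p w : ℤ) + j = n + 1) :=
        word_mem_wordSpan ⟨hw, by push_cast at hd; linarith⟩
      have hr : ∀ (u : List B) (x : B), (u ++ [x] ≠ [] ∧ (wordDegree p (u ++ [x]) : ℤ) + j = n + 1)
          → (x :: u ≠ [] ∧ (wordDegree p (x :: u) : ℤ) + j = n + 1) := fun u x =>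
        degree_rotate p (Q := fun i => (i : ℤ) + j = n + 1) u x
      refine single_mem_wordTotDegree p ?_
      split_ifs
      · exact Submodule.sub_mem _ hw' (rot_mem_wordSpan k p hr hw')
      · exact cycNorm_mem_wordSpan p hr hw'
  · have e : ∀ w : List B, (w ≠ [] ∧ (wordDegree p w : ℤ) = n + 1 - j) →
        (w ≠ [] ∧ (wordDegree p w : ℤ) + j = n + 1) := fun w h => ⟨h.1, by linarith [h.2]⟩
    split_ifs
    · exact Submodule.neg_mem _ (wordSpan_mono e (hβ.hoch_mem_degree hw'))
    · exact wordSpan_mono e (hβ.bar_mem_degree hw')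

/-! ### The cyclic bicomplex of tensors and that of words -/

variable (β p) in
/-- The cyclic bicomplex of tensors, in terms of words. -/
def totToWord : CyclicTot k R →ₗ[k] ℕ →₀ FreeAlgebra k B :=
  DirectSum.toModule k (ℕ × ℕ) _ fun pq => Finsupp.lsingle pq.1 ∘ₗ tens β p (pq.2 + 1)

theorem totToWord_lof (pq : ℕ × ℕ) (x : ⨂[k]^(pq.2 + 1) R) :
    totToWord β p (DirectSum.lof k (ℕ × ℕ) (fun pq => ⨂[k]^(pq.2 + 1) R) pq x) =
      Finsupp.single pq.1 (tens β p (pq.2 + 1) x) := by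
  rw [totToWord, DirectSum.toModule_lof]
  rfl

variable {𝒜 : ℤ → Submodule k R} [DirectSum.Decomposition 𝒜]

theorem IsGradedMul.totToWord_cyclicD (hβ : IsGradedMul β p)
    (h𝒜 : ∀ x, β x ∈ 𝒜 ((p x : ℤ) - 1)) (x : CyclicTot k R) :
    totToWord β p (cyclicD k 𝒜 x) = wordTot β p (totToWord β p x) := by
  refine LinearMap.congr_fun (f := totToWord β p ∘ₗ cyclicD k 𝒜)
    (g := wordTot β p ∘ₗ totToWord β p)
    (DirectSum.linearMap_ext k fun ⟨i, q⟩ => LinearMap.ext fun y => ?_) x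
  simp only [LinearMap.comp_apply, wordTot_apply]
  rw [cyclicD, DirectSum.toModule_lof, LinearMap.add_apply, map_add, totToWord_lof]
  congr 1
  · rcases i with - | i
    · rw [cyclicHor]; simp
    · rw [cyclicHor, LinearMap.comp_apply, wordHor_single_succ]
      have := totToWord_lof (β := β) (p := p) (i, q)
        ((if Even i then LinearMap.id - cyclicT k 𝒜 q else cyclicNorm k 𝒜 q) y)
      refine this.trans ?_
      congr 1
      split_ifs
      · rw [LinearMap.sub_apply, map_sub, tens_cyclicT h𝒜]; rfl
      · rw [tens_cyclicNorm h𝒜]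
  · rcases q with - | q
    · rw [cyclicVert, wordVert_single, LinearMap.zero_apply, map_zero]
      have hz : ∀ f : FreeAlgebra k B →ₗ[k] FreeAlgebra k B, (∀ x, f (word k [x]) = 0) →
          f (tens β p (0 + 1) y) = 0 := fun f hf =>
        eq_on_wordSpan (g := 0) (fun w hw => by
          obtain ⟨x, rfl⟩ := List.length_eq_one_iff.1 hw
          exact hf x) (tens_mem_length β p y)
      have h1 : bar β p (tens β p (0 + 1) y) = 0 := hz _ fun x => by simp
      have h2 : hoch β p (tens β p (0 + 1) y) = 0 := hz _ fun x => by
        have := rot_concat k p [] x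
        simp only [List.nil_append, wordDegree_nil, zero_mul, pow_zero, one_smul] at this
        rw [hoch, LinearMap.add_apply, LinearMap.comp_apply, this]
        simp
      simp [h1, h2]
    · rw [cyclicVert, LinearMap.comp_apply, wordVert_single]
      have := totToWord_lof (β := β) (p := p) (i, q)
        ((if Even i then hochschildB k 𝒜 q else -barB' k R (q + 1)) y)
      refine this.trans ?_
      congr 1
      split_ifs
      · exact hβ.tens_hochschildB h𝒜 q y
      · rw [LinearMap.neg_apply, map_neg, hβ.tens_barB', neg_neg]

/-- The entry `(i, q)` of the bicomplex can be recovered from column `i` as its words of length `q +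
1`. Injectivity and the comparison of degrees follow from this. -/
theorem wordProj_totToWord (x : CyclicTot k R) (i q : ℕ) :
    wordProj k (fun w : List B => w.length = q + 1) (totToWord β p x i) =
      tens β p (q + 1) (x (i, q)) := by
  classical
  refine LinearMap.congr_fun (f := wordProj k (fun w : List B => w.length = q + 1) ∘ₗ
      Finsupp.lapply i ∘ₗ totToWord β p)
    (g := tens β p (q + 1) ∘ₗ DirectSum.component k (ℕ × ℕ) (fun pq => ⨂[k]^(pq.2 + 1) R) (i, q))
    (DirectSum.linearMap_ext k fun ⟨i', q'⟩ => LinearMap.ext fun y => ?_) x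
  simp only [LinearMap.comp_apply, totToWord_lof, Finsupp.lapply_apply]
  by_cases h : (i', q') = (i, q)
  · cases h
    rw [Finsupp.single_eq_same, DirectSum.component.lof_self,
      wordProj_eq_self (tens_mem_length β p y)]
  · rw [DirectSum.component.of, dif_neg h, map_zero, Finsupp.single_apply]
    split_ifs with hi
    · refine wordProj_eq_zero (fun w hw hw' => h ?_) (tens_mem_length β p y)
      rw [Prod.mk.injEq]
      exact ⟨hi, by simp only at hw hw'; omega⟩
    · rw [map_zero]

theorem totToWord_injective : Function.Injective (totToWord β p) := by
  rw [← LinearMap.ker_eq_bot, LinearMap.ker_eq_bot']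
  intro x hx
  refine DFinsupp.ext fun ⟨i, q⟩ => ?_
  change x (i, q) = 0
  rw [← untens_tens β p _ (x (i, q)), ← wordProj_totToWord, hx]
  simp

/-- Projecting the basis expansion of `a` to degree `d` keeps the letters of degree `d` and kills
the others. -/
theorem mem_span_letters (h𝒜 : ∀ x, β x ∈ 𝒜 ((p x : ℤ) - 1)) {d : ℤ} {a : R} (ha : a ∈ 𝒜 d) :
    a ∈ Submodule.span k (β '' {x | (p x : ℤ) - 1 = d}) := by
  let π : R →ₗ[k] R := (𝒜 d).subtype ∘ₗ DirectSum.component k ℤ (fun d => 𝒜 d) d ∘ₗ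
    (DirectSum.decomposeLinearEquiv 𝒜).toLinearMap
  have hπ : ∀ a, π a = DirectSum.decompose 𝒜 a d := fun a => rfl
  have h : (⊤ : Submodule k R) ≤
      (Submodule.span k (β '' {x | (p x : ℤ) - 1 = d})).comap π := by
    rw [← β.span_eq, Submodule.span_le]
    rintro _ ⟨x, rfl⟩
    rw [SetLike.mem_coe, Submodule.mem_comap, hπ]
    by_cases hx : (p x : ℤ) - 1 = d
    · rw [DirectSum.decompose_of_mem_same 𝒜 (hx ▸ h𝒜 x)]
      exact Submodule.subset_span ⟨x, hx, rfl⟩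
    · rw [DirectSum.decompose_of_mem_ne 𝒜 (h𝒜 x) hx]
      exact Submodule.zero_mem _
  have := h (x := a) trivial
  rwa [Submodule.mem_comap, hπ, DirectSum.decompose_of_mem_same 𝒜 ha] at this

theorem mul_mem_wordSpan {P Q S : List B → Prop} (h : ∀ u v, P u → Q v → S (u ++ v))
    {x y : FreeAlgebra k B} (hx : x ∈ wordSpan k P) (hy : y ∈ wordSpan k Q) :
    x * y ∈ wordSpan k S := by
  refine map_mem_of_wordSpan (f := LinearMap.mulRight k y) (fun u hu => ?_) hx
  refine map_mem_of_wordSpan (f := LinearMap.mulLeft k (word k u)) (fun v hv => ?_) hy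
  rw [LinearMap.mulLeft_apply, ← word_append]
  exact word_mem_wordSpan (h u v hu hv)

theorem emb_mem_wordSpan {S : Set B} {P : List B → Prop} (h : ∀ x ∈ S, P [x]) {a : R}
    (ha : a ∈ Submodule.span k (β '' S)) : emb β a ∈ wordSpan k P := by
  have : Submodule.span k (β '' S) ≤ (wordSpan k P).comap (emb β) := by
    rw [Submodule.span_le]
    rintro _ ⟨x, hx, rfl⟩
    rw [SetLike.mem_coe, Submodule.mem_comap, emb_basis]
    have := word_mem_wordSpan (k := k) (h x hx)
    simpa using this
  exact this ha

theorem tens_mem_degree (h𝒜 : ∀ x, β x ∈ 𝒜 ((p x : ℤ) - 1)) {n : ℕ} {d : ℤ} {x : ⨂[k]^n R}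
    (hx : x ∈ tensorDegree k 𝒜 n d) : tens β p n x ∈
      wordSpan k (fun w : List B => w.length = n ∧ (wordDegree p w : ℤ) = d + n) := by
  have h : ∀ (n : ℕ) (a : Fin n → R) (d : Fin n → ℤ), (∀ i, a i ∈ 𝒜 (d i)) →
      (List.ofFn fun i => emb β (a i)).prod ∈
        wordSpan k (fun w : List B => w.length = n ∧ (wordDegree p w : ℤ) = ∑ i, d i + n) := by
    intro n
    induction n with
    | zero =>
      intro a d _
      rw [List.ofFn_zero, List.prod_nil, ← word_nil]
      exact word_mem_wordSpan (by simp)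
    | succ n ih =>
      intro a d ha
      rw [List.ofFn_succ, List.prod_cons]
      refine mul_mem_wordSpan (P := fun w => w.length = 1 ∧ (wordDegree p w : ℤ) = d 0 + 1)
        (fun u v hu hv => ⟨by rw [List.length_append, hu.1, hv.1, add_comm], ?_⟩)
        (emb_mem_wordSpan (fun x hx => ?_) (mem_span_letters h𝒜 (ha 0)))
        (ih _ (fun i => d i.succ) fun i => ha i.succ)
      · have : (p x : ℤ) - 1 = d 0 := hx
        refine ⟨rfl, ?_⟩
        rw [wordDegree_cons, wordDegree_nil]
        push_cast; linarith
      · rw [wordDegree_append, Nat.cast_add, hu.2, hv.2, Fin.sum_univ_succ]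
        push_cast; ring
  have : tensorDegree k 𝒜 n d ≤ (wordSpan k (fun w : List B => w.length = n ∧
      (wordDegree p w : ℤ) = d + n)).comap (tens β p n) := by
    rw [tensorDegree, Submodule.span_le]
    rintro _ ⟨a, d', ha, rfl, rfl⟩
    rw [SetLike.mem_coe, Submodule.mem_comap, tens, LinearMap.comp_apply, plainWord_tprod]
    exact diag_mem_wordSpan _ (h n a d' ha)
  exact this hx

theorem untens_mem_degree (h𝒜 : ∀ x, β x ∈ 𝒜 ((p x : ℤ) - 1)) {n : ℕ} {d : ℤ}
    {x : FreeAlgebra k B} (hx : x ∈ wordSpan k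
      (fun w : List B => w.length = n ∧ (wordDegree p w : ℤ) = d + n)) :
    untens β p n x ∈ tensorDegree k 𝒜 n d := by
  refine map_mem_of_wordSpan (fun w hw => ?_) hx
  obtain ⟨rfl, hw⟩ := hw
  rw [untens_word β p w _ rfl]
  refine Submodule.smul_mem _ _ (Submodule.subset_span
    ⟨_, fun i => (p (w.get i) : ℤ) - 1, fun i => h𝒜 _, ?_, rfl⟩)
  rw [Finset.sum_sub_distrib, Finset.sum_const, Finset.card_univ, Fintype.card_fin]
  have : ((wordDegree p w : ℕ) : ℤ) = ∑ i, (p (w.get i) : ℤ) := by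
    rw [wordDegree, ← Nat.cast_sum, ← List.sum_ofFn]
    congr 2
    conv_lhs => rw [← List.ofFn_get w, List.map_ofFn]
    rfl
  rw [← this, hw]
  simp

theorem totToWord_mem_iff (h𝒜 : ∀ x, β x ∈ 𝒜 ((p x : ℤ) - 1)) {n : ℤ} {x : CyclicTot k R} :
    totToWord β p x ∈ wordTotDegree k p n ↔ x ∈ cyclicDegree k 𝒜 n := by
  classical
  constructor
  · intro hx
    rw [← DirectSum.sum_support_of x]
    refine Submodule.sum_mem _ fun ⟨i, q⟩ _ => ?_
    refine Submodule.mem_iSup_of_mem (i, q) ⟨x (i, q), ?_, rfl⟩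
    rw [← untens_tens β p _ (x (i, q)), ← wordProj_totToWord]
    refine untens_mem_degree h𝒜 (mem_wordSpan.2 fun w hw => ?_)
    rw [wordProj, repr_diag] at hw
    have h := mem_wordSpan.1 ((mem_wordTotDegree p).1 hx i) w (right_ne_zero_of_mul hw)
    have hl : w.length = q + 1 := by
      by_contra hl
      exact hw (by rw [if_neg hl, zero_mul])
    refine ⟨hl, ?_⟩
    push_cast
    linarith [h.2]
  · intro hx
    have : cyclicDegree k 𝒜 n ≤ (wordTotDegree k p n).comap (totToWord β p) := by
      refine iSup_le fun ⟨i, q⟩ => ?_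
      rintro _ ⟨y, hy, rfl⟩
      rw [Submodule.mem_comap, totToWord_lof]
      refine single_mem_wordTotDegree p (wordSpan_mono (fun w hw => ⟨?_, ?_⟩)
        (tens_mem_degree h𝒜 hy))
      · rintro rfl
        simp at hw
      · have := hw.2
        push_cast at this
        linarith
    exact this hx

theorem exists_totToWord_eq {n : ℤ} {y : ℕ →₀ FreeAlgebra k B} (hy : y ∈ wordTotDegree k p n) :
    ∃ x : CyclicTot k R, totToWord β p x = y := by
  suffices y ∈ LinearMap.range (totToWord β p) from this
  refine map_mem_wordTotDegree p (f := LinearMap.id) (fun j w hw _ => ?_) hy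
  have hl : w.length = (w.length - 1) + 1 := by
    have := List.length_pos_iff.2 hw
    omega
  refine ⟨DirectSum.lof k (ℕ × ℕ) (fun pq => ⨂[k]^(pq.2 + 1) R) (j, w.length - 1)
    (untens β p _ (word k w)), ?_⟩
  rw [totToWord_lof, tens_untens _ _ (word_mem_wordSpan hl)]
  rfl

/-- The passage to words is injective and misses only the empty word, which `wordTotDegree`
excludes. So it is bijective in each degree and its kernel is trivially acyclic. -/
theorem IsGradedMul.nonempty_cyclicHomology_equiv_word (hβ : IsGradedMul β p)
    (h𝒜 : ∀ x, β x ∈ 𝒜 ((p x : ℤ) - 1)) (n : ℤ) :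
    Nonempty (cyclicHomology k 𝒜 n ≃ₗ[k]
      gradedHomology (wordTot β p) (wordTotDegree k p) n) := by
  refine nonempty_homology_equiv_of_surjective (totToWord β p) 1 one_ne_zero
    (fun m x _ => by rw [hβ.totToWord_cyclicD h𝒜, one_smul])
    (fun m x hx => (totToWord_mem_iff h𝒜).2 hx)
    (fun m y hy => ?_) (fun m x hx => ?_) (fun x => ?_) (fun m x _ _ hx => ?_)
  · obtain ⟨x, rfl⟩ := exists_totToWord_eq (β := β) hy
    exact ⟨x, (totToWord_mem_iff h𝒜).1 hy, rfl⟩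
  · rw [← totToWord_mem_iff (β := β) h𝒜, hβ.totToWord_cyclicD h𝒜]
    exact hβ.wordTot_mem ((totToWord_mem_iff h𝒜).2 hx)
  · refine totToWord_injective (β := β) (p := p) ?_
    rw [hβ.totToWord_cyclicD h𝒜, hβ.totToWord_cyclicD h𝒜, hβ.wordTot_wordTot, map_zero]
  · obtain rfl : x = 0 := totToWord_injective (β := β) (p := p) (by rw [hx, map_zero])
    exact ⟨0, Submodule.zero_mem _, map_zero _, map_zero _⟩

end Tot

/-! ### Cyclic homology and invariant words -/

section Contraction

set_option linter.unusedSectionVars false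

variable {k : Type*} [Field k] {B : Type*} {R : Type*} [NonUnitalRing R] [Module k R]
  {β : Basis B k R} {p : B → ℕ}

variable (k) in
/-- Division of each word by its length. -/
def lengthInv : FreeAlgebra k B →ₗ[k] FreeAlgebra k B := diag k fun w => (w.length : k)⁻¹

variable (k p) in
/-- The contraction `L⁻¹ ∑_{i < L} ∑_{j < i} t^j` of the rows, on words of length `L`. -/
def rowContraction : FreeAlgebra k B →ₗ[k] FreeAlgebra k B :=
  lengthInv k ∘ₗ byLength k fun L => ∑ i ∈ Finset.range L, ∑ j ∈ Finset.range i, rot k p ^ j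

theorem lengthInv_of_mem {L : ℕ} {x : FreeAlgebra k B}
    (hx : x ∈ wordSpan k (fun w : List B => w.length = L)) : lengthInv k x = (L : k)⁻¹ • x :=
  diag_eq_smul (fun w hw => by rw [hw]) hx

theorem rowContraction_of_mem {L : ℕ} {x : FreeAlgebra k B}
    (hx : x ∈ wordSpan k (fun w : List B => w.length = L)) : rowContraction k p x =
      (L : k)⁻¹ • ∑ i ∈ Finset.range L, ∑ j ∈ Finset.range i, (rot k p ^ j) x := by
  have h : byLength k (fun L => ∑ i ∈ Finset.range L, ∑ j ∈ Finset.range i, rot k p ^ j) x =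
      ∑ i ∈ Finset.range L, ∑ j ∈ Finset.range i, (rot k p ^ j) x := by
    rw [byLength_of_mem _ hx]
    simp only [LinearMap.sum_apply]
  rw [rowContraction, LinearMap.comp_apply, h, lengthInv_of_mem]
  exact Submodule.sum_mem _ fun i _ => Submodule.sum_mem _ fun j _ => rot_pow_mem_length k p hx j

theorem rowContraction_mem_wordSpan {P : List B → Prop} (hP : ∀ u x, P (u ++ [x]) → P (x :: u))
    {x : FreeAlgebra k B} (hx : x ∈ wordSpan k P) : rowContraction k p x ∈ wordSpan k P := by
  refine map_mem_of_wordSpan (fun w hw => ?_) hx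
  rw [rowContraction_of_mem (word_mem_wordSpan rfl)]
  exact Submodule.smul_mem _ _ (Submodule.sum_mem _ fun i _ => Submodule.sum_mem _ fun j _ =>
    rot_pow_mem_wordSpan k p hP (word_mem_wordSpan hw) j)

theorem cycNorm_lengthInv (x : FreeAlgebra k B) :
    cycNorm k p (lengthInv k x) = lengthInv k (cycNorm k p x) := by
  refine linearMap_congr_length (f := cycNorm k p ∘ₗ lengthInv k)
    (g := lengthInv k ∘ₗ cycNorm k p) (fun L x hx => ?_) x
  rw [LinearMap.comp_apply, LinearMap.comp_apply, lengthInv_of_mem hx,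
    lengthInv_of_mem (cycNorm_mem_length k p hx), map_smul]

/-- The inner sums telescope to `1 - t^i`, and summing over `i < L` gives `L - N`. Division by `L`
needs nonempty words and characteristic zero. -/
theorem rowContraction_sub_rot [CharZero k] {x : FreeAlgebra k B}
    (hx : x ∈ wordSpan k (fun w : List B => w ≠ [])) :
    rowContraction k p (x - rot k p x) = x - lengthInv k (cycNorm k p x) := by
  suffices h : (rowContraction k p ∘ₗ (LinearMap.id - rot k p)) x =
      (LinearMap.id - lengthInv k ∘ₗ cycNorm k p : FreeAlgebra k B →ₗ[k] FreeAlgebra k B) x by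
    simpa only [LinearMap.comp_apply, LinearMap.sub_apply, LinearMap.id_apply] using h
  refine eq_on_wordSpan (f := rowContraction k p ∘ₗ (LinearMap.id - rot k p))
    (g := LinearMap.id - lengthInv k ∘ₗ cycNorm k p) (fun w hw => ?_) hx
  have hL : word k w ∈ wordSpan k (fun v : List B => v.length = w.length) := word_mem_wordSpan rfl
  have hL0 : (w.length : k) ≠ 0 := by simpa using hw
  simp only [LinearMap.comp_apply, LinearMap.sub_apply, LinearMap.id_apply]
  rw [rowContraction_of_mem (Submodule.sub_mem _ hL (rot_mem_length k p hL)),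
    lengthInv_of_mem (cycNorm_mem_length k p hL), cycNorm_of_mem k p hL]
  have tel : ∀ i, ∑ j ∈ Finset.range i, (rot k p ^ j) (word k w - rot k p (word k w)) =
      word k w - (rot k p ^ i) (word k w) := fun i => by
    have := Finset.sum_range_sub' (fun j => (rot k p ^ j) (word k w)) i
    rw [pow_zero, Module.End.one_apply] at this
    rw [← this]
    refine Finset.sum_congr rfl fun j _ => ?_
    rw [map_sub, pow_succ, Module.End.mul_apply]
  simp only [tel, Finset.sum_sub_distrib, Finset.sum_const, Finset.card_range, smul_sub]
  rw [← Nat.cast_smul_eq_nsmul k, smul_smul, inv_mul_cancel₀ hL0, one_smul]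

theorem rot_rowContraction (x : FreeAlgebra k B) :
    rot k p (rowContraction k p x) = rowContraction k p (rot k p x) := by
  refine linearMap_congr_length (f := rot k p ∘ₗ rowContraction k p)
    (g := rowContraction k p ∘ₗ rot k p) (fun L x hx => ?_) x
  rw [LinearMap.comp_apply, LinearMap.comp_apply, rowContraction_of_mem hx,
    rowContraction_of_mem (rot_mem_length k p hx), map_smul]
  simp only [map_sum, ← Module.End.mul_apply, ← pow_succ, ← pow_succ']

variable (k p) in
/-- The contraction of the rows of the cyclic bicomplex of words. -/
def wordContraction : (ℕ →₀ FreeAlgebra k B) →ₗ[k] ℕ →₀ FreeAlgebra k B :=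
  Finsupp.lsum k fun j => Finsupp.lsingle (j + 1) ∘ₗ
    (if Even j then rowContraction k p else lengthInv k)

@[simp] theorem wordContraction_single (j : ℕ) (x : FreeAlgebra k B) :
    wordContraction k p (Finsupp.single j x) =
      Finsupp.single (j + 1) (if Even j then rowContraction k p x else lengthInv k x) := by
  simp only [wordContraction, Finsupp.lsum_single, LinearMap.comp_apply, Finsupp.lsingle_apply]
  split_ifs <;> rfl

theorem eq_of_single {N : Type*} [AddCommGroup N] [Module k N] {P : ℕ → List B → Prop}
    {f g : (ℕ →₀ FreeAlgebra k B) →ₗ[k] N}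
    (h : ∀ j, ∀ y ∈ wordSpan k (P j), f (Finsupp.single j y) = g (Finsupp.single j y))
    {x : ℕ →₀ FreeAlgebra k B} (hx : ∀ j, x j ∈ wordSpan k (P j)) : f x = g x := by
  rw [← x.sum_single, Finsupp.sum, map_sum, map_sum]
  exact Finset.sum_congr rfl fun j _ => h j _ (hx j)

/-- The rows are contractible except in column `0`, where the projection `L⁻¹ N` on the invariants
is left. -/
theorem wordHor_contraction [CharZero k] {x : ℕ →₀ FreeAlgebra k B}
    (hx : ∀ j, x j ∈ wordSpan k (fun w : List B => w ≠ [])) :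
    wordHor k p (wordContraction k p x) + wordContraction k p (wordHor k p x) =
      x - Finsupp.single 0 (lengthInv k (cycNorm k p (x 0))) := by
  refine eq_of_single (P := fun _ w => w ≠ [])
    (f := wordHor k p ∘ₗ wordContraction k p + wordContraction k p ∘ₗ wordHor k p)
    (g := LinearMap.id - Finsupp.lsingle 0 ∘ₗ lengthInv k ∘ₗ cycNorm k p ∘ₗ Finsupp.lapply 0)
    (fun j y hy => ?_) hx
  simp only [LinearMap.add_apply, LinearMap.comp_apply, LinearMap.sub_apply, LinearMap.id_apply,
    Finsupp.lapply_apply, Finsupp.lsingle_apply, wordContraction_single, wordHor_single_succ]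
  rcases j with - | j
  · simp only [Even.zero, if_true, wordHor_single_zero, map_zero, add_zero, Finsupp.single_eq_same]
    rw [← Finsupp.single_sub, rot_rowContraction, ← map_sub, rowContraction_sub_rot hy]
  · rw [wordHor_single_succ, wordContraction_single, Finsupp.single_eq_of_ne (Nat.succ_ne_zero j).symm]
    by_cases h : Even j
    · simp only [h, Nat.even_add_one, not_true_eq_false, if_true, if_false, map_zero,
        Finsupp.single_zero, sub_zero]
      rw [← Finsupp.single_add, rowContraction_sub_rot hy, cycNorm_lengthInv, add_sub_cancel]
    · simp only [h, Nat.even_add_one, not_false_eq_true, if_true, if_false, map_zero,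
        Finsupp.single_zero, sub_zero]
      rw [← Finsupp.single_add, rot_rowContraction, ← map_sub, rowContraction_sub_rot hy,
        sub_add_cancel]

variable [IsScalarTower k R R] [SMulCommClass k R R]

theorem wordContraction_mem {n : ℤ} {x : ℕ →₀ FreeAlgebra k B} (hx : x ∈ wordTotDegree k p n) :
    wordContraction k p x ∈ wordTotDegree k p (n + 1) := by
  refine map_mem_wordTotDegree p (fun j w hw hd => ?_) hx
  rw [wordContraction_single]
  have hw' : word k w ∈ wordSpan k
      (fun w : List B => w ≠ [] ∧ (wordDegree p w : ℤ) + (j + 1 : ℕ) = n + 1 + 1) :=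
    word_mem_wordSpan ⟨hw, by push_cast; linarith⟩
  refine single_mem_wordTotDegree p ?_
  split_ifs
  · exact rowContraction_mem_wordSpan (fun u x =>
      degree_rotate p (Q := fun i => (i : ℤ) + (j + 1 : ℕ) = n + 1 + 1) u x) hw'
  · exact diag_mem_wordSpan _ hw'

theorem IsGradedMul.hoch_mem_length_le (hβ : IsGradedMul β p) {L : ℕ} {x : FreeAlgebra k B}
    (hx : x ∈ wordSpan k (fun w : List B => w.length ≤ L)) :
    hoch β p x ∈ wordSpan k (fun w : List B => w.length ≤ L - 1) := by
  rw [hoch, LinearMap.add_apply, LinearMap.comp_apply]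
  refine Submodule.add_mem _ (hβ.bar_mem_wordSpan (C := fun _ _ _ => True)
    (P := fun w => w.length ≤ L) (fun x y => by simp [β.span_eq])
    (fun x y z r _ h => by simp at h ⊢; omega) (by simp) (by simp) hx)
    (mulFirst_mem_wordSpan (C := fun _ _ _ => True) (P := fun w => w.length ≤ L)
      (fun x y => by simp [β.span_eq]) (fun x y z r _ h => by simp at h ⊢; omega)
      (rot_mem_wordSpan k p (by simp) hx))

theorem IsGradedMul.bar_mem_length_le (hβ : IsGradedMul β p) {L : ℕ} {x : FreeAlgebra k B}
    (hx : x ∈ wordSpan k (fun w : List B => w.length ≤ L)) :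
    bar β p x ∈ wordSpan k (fun w : List B => w.length ≤ L - 1) :=
  hβ.bar_mem_wordSpan (C := fun _ _ _ => True)
    (P := fun w => w.length ≤ L) (fun x y => by simp [β.span_eq])
    (fun x y z r _ h => by simp at h ⊢; omega) (by simp) (by simp) hx

theorem apply_mem_of_single {P Q : List B → Prop}
    {f : (ℕ →₀ FreeAlgebra k B) →ₗ[k] ℕ →₀ FreeAlgebra k B}
    (h : ∀ i j, ∀ y ∈ wordSpan k P, f (Finsupp.single j y) i ∈ wordSpan k Q)
    {x : ℕ →₀ FreeAlgebra k B} (hx : ∀ j, x j ∈ wordSpan k P) (i : ℕ) :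
    f x i ∈ wordSpan k Q := by
  rw [← x.sum_single, Finsupp.sum, map_sum, Finsupp.finsetSum_apply]
  exact Submodule.sum_mem _ fun j _ => h i j _ (hx j)

theorem IsGradedMul.wordVert_mem_length (hβ : IsGradedMul β p) {L : ℕ} {x : ℕ →₀ FreeAlgebra k B}
    (hx : ∀ j, x j ∈ wordSpan k (fun w : List B => w.length ≤ L)) (i : ℕ) :
    wordVert β p x i ∈ wordSpan k (fun w : List B => w.length ≤ L - 1) := by
  refine apply_mem_of_single (fun i j y hy => ?_) hx i
  rw [wordVert_single, Finsupp.single_apply]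
  split_ifs
  · exact Submodule.neg_mem _ (hβ.hoch_mem_length_le hy)
  · exact hβ.bar_mem_length_le hy
  · exact Submodule.zero_mem _

theorem wordContraction_mem_length {L : ℕ} {x : ℕ →₀ FreeAlgebra k B}
    (hx : ∀ j, x j ∈ wordSpan k (fun w : List B => w.length ≤ L)) (i : ℕ) :
    wordContraction k p x i ∈ wordSpan k (fun w : List B => w.length ≤ L) := by
  refine apply_mem_of_single (fun i j y hy => ?_) hx i
  rw [wordContraction_single, Finsupp.single_apply]
  split_ifs
  · exact rowContraction_mem_wordSpan (by simp) hy
  · exact diag_mem_wordSpan _ hy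
  · exact Submodule.zero_mem _

theorem wordContraction_zero (x : ℕ →₀ FreeAlgebra k B) : wordContraction k p x 0 = 0 := by
  refine LinearMap.congr_fun (f := Finsupp.lapply 0 ∘ₗ wordContraction k p) (g := 0)
    (Finsupp.lhom_ext fun j y => ?_) x
  rw [LinearMap.comp_apply, wordContraction_single, Finsupp.lapply_apply,
    Finsupp.single_eq_of_ne (Nat.succ_ne_zero j).symm, LinearMap.zero_apply]

theorem wordVert_apply (x : ℕ →₀ FreeAlgebra k B) (j : ℕ) :
    wordVert β p x j = if Even j then -hoch β p (x j) else bar β p (x j) := by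
  refine LinearMap.congr_fun (f := Finsupp.lapply j ∘ₗ wordVert β p)
    (g := (if Even j then -hoch β p else bar β p) ∘ₗ Finsupp.lapply j)
    (Finsupp.lhom_ext fun i y => ?_) x |>.trans ?_
  · simp only [LinearMap.comp_apply, wordVert_single, Finsupp.lapply_apply, Finsupp.single_apply]
    split_ifs with h1 h2 h2 <;> simp_all
  · rw [LinearMap.comp_apply, Finsupp.lapply_apply]
    split_ifs <;> rfl

/-- Let `h` be the contraction of the rows. For a cycle `x` with `N x₀ = 0`, the error `D (h x) - x`
equals `∂ h x + h ∂ x` with `∂` the vertical differential, so it consists of shorter words and the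
induction on the length bound corrects it. As `h` never reaches column `0`, the condition on `N` is
preserved. -/
theorem IsGradedMul.exists_wordTot_eq [CharZero k] (hβ : IsGradedMul β p) (L : ℕ) (n : ℤ)
    (x : ℕ →₀ FreeAlgebra k B) (hx : x ∈ wordTotDegree k p n)
    (hL : ∀ j, x j ∈ wordSpan k (fun w : List B => w.length ≤ L))
    (hD : wordTot β p x = 0) (hN : cycNorm k p (x 0) = 0) :
    ∃ y ∈ wordTotDegree k p (n + 1), cycNorm k p (y 0) = 0 ∧ wordTot β p y = x := by
  induction L generalizing x with
  | zero =>
    have : x = 0 := by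
      refine Finsupp.ext fun j => ?_
      refine (wordBasis k B).ext_elem fun w => ?_
      by_contra hw
      rw [Finsupp.zero_apply, map_zero, Finsupp.zero_apply] at hw
      have h1 := mem_wordSpan.1 ((mem_wordTotDegree p).1 hx j) w hw
      have h2 := mem_wordSpan.1 (hL j) w hw
      exact h1.1 (List.length_eq_zero_iff.1 (by simpa using h2))
    subst this
    exact ⟨0, Submodule.zero_mem _, by simp, by simp⟩
  | succ L ih =>
    have hne : ∀ j, x j ∈ wordSpan k (fun w : List B => w ≠ []) := fun j =>
      wordSpan_mono (fun w h => h.1) ((mem_wordTotDegree p).1 hx j)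
    have hh := wordHor_contraction (p := p) hne
    rw [hN, map_zero, Finsupp.single_zero, sub_zero] at hh
    rw [wordTot_apply] at hD
    have hν : wordTot β p (wordContraction k p x) - x =
        wordVert β p (wordContraction k p x) + wordContraction k p (wordVert β p x) := by
      rw [eq_neg_of_add_eq_zero_right hD, map_neg, wordTot_apply, eq_sub_of_add_eq hh]
      abel
    obtain ⟨y, hy, hy0, hyx⟩ := ih (wordTot β p (wordContraction k p x) - x)
      (Submodule.sub_mem _ (hβ.wordTot_mem (wordContraction_mem hx)) hx)
      (fun j => by
        rw [hν, Finsupp.add_apply]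
        exact Submodule.add_mem _ (hβ.wordVert_mem_length (wordContraction_mem_length hL) j)
          (wordContraction_mem_length (hβ.wordVert_mem_length hL) j))
      (by rw [map_sub, hβ.wordTot_wordTot, wordTot_apply, hD, sub_zero])
      (by rw [hν, Finsupp.add_apply, wordContraction_zero, wordVert_apply, wordContraction_zero]
          simp)
    refine ⟨wordContraction k p x - y, Submodule.sub_mem _ (wordContraction_mem hx) hy, ?_, ?_⟩
    · rw [Finsupp.sub_apply, map_sub, hy0, wordContraction_zero, map_zero, sub_zero]
    · rw [map_sub, hyx, sub_sub_cancel]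

theorem exists_length_le (x : ℕ →₀ FreeAlgebra k B) :
    ∃ L, ∀ j, x j ∈ wordSpan k (fun w : List B => w.length ≤ L) := by
  have h : ∀ y : FreeAlgebra k B, ∃ L, y ∈ wordSpan k (fun w : List B => w.length ≤ L) := fun y =>
    ⟨((wordBasis k B).repr y).support.sup List.length, mem_wordSpan.2 fun w hw =>
      Finset.le_sup (f := List.length) (Finsupp.mem_support_iff.2 hw)⟩
  choose L hL using fun j => h (x j)
  refine ⟨x.support.sup L, fun j => ?_⟩
  by_cases hj : j ∈ x.support
  · exact wordSpan_mono (fun w hw => hw.trans (Finset.le_sup hj)) (hL j)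
  · rw [Finsupp.notMem_support_iff.1 hj]
    exact Submodule.zero_mem _

/-- `N` kills what `1 - t` brings in from column `1`, and it turns `hoch` on column `0` into `bar`.
-/
theorem IsGradedMul.cycNorm_wordTot_zero (hβ : IsGradedMul β p) (x : ℕ →₀ FreeAlgebra k B) :
    cycNorm k p (wordTot β p x 0) = -bar β p (cycNorm k p (x 0)) := by
  refine LinearMap.congr_fun (f := cycNorm k p ∘ₗ Finsupp.lapply 0 ∘ₗ wordTot β p)
    (g := -(bar β p ∘ₗ cycNorm k p ∘ₗ Finsupp.lapply 0)) (Finsupp.lhom_ext fun j y => ?_) x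
  simp only [LinearMap.comp_apply, LinearMap.neg_apply, Finsupp.lapply_apply, wordTot_apply,
    wordVert_single, map_add]
  rcases j with - | - | j
  · simp [hβ.cycNorm_hoch]
  · simp [cycNorm_rot]
  · simp

theorem cycNorm_mem_invariants {n : ℤ} {x : FreeAlgebra k B}
    (hx : x ∈ wordSpan k (fun w : List B => w ≠ [] ∧ (wordDegree p w : ℤ) = n + 1)) :
    cycNorm k p x ∈ invariants (k := k) p n :=
  (mem_invariants p).2 ⟨cycNorm_mem_wordSpan p
    (fun u x => degree_rotate p (Q := fun i => (i : ℤ) = n + 1) u x) hx, rot_cycNorm k p x⟩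

/-- On invariants `N` multiplies each word by its length, which is invertible. -/
theorem exists_cycNorm_eq [CharZero k] {n : ℤ} {x : FreeAlgebra k B}
    (hx : x ∈ invariants (k := k) p n) : cycNorm k p (lengthInv k x) = x := by
  obtain ⟨hx, ht⟩ := (mem_invariants p).1 hx
  rw [cycNorm_lengthInv, cycNorm_of_invariant k p ht, lengthInv, diag_diag]
  rw [diag_eq_smul (c := 1) (fun w hw => inv_mul_cancel₀ (by simpa using hw.1)) hx, one_smul]

/-- The map is `N` on column `0`. It commutes with the differentials up to the constant `-1`, is
onto the invariants, and has acyclic kernel by `IsGradedMul.exists_wordTot_eq`. -/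
theorem IsGradedMul.nonempty_word_equiv_invariants [CharZero k] (hβ : IsGradedMul β p) (n : ℤ) :
    Nonempty (gradedHomology (wordTot β p) (wordTotDegree k p) n ≃ₗ[k]
      gradedHomology (bar β p) (invariants p) n) := by
  refine nonempty_homology_equiv_of_surjective (cycNorm k p ∘ₗ Finsupp.lapply 0) (-1) (by simp)
    (fun m x _ => ?_) (fun m x hx => ?_) (fun m y hy => ?_) (fun m x hx => hβ.wordTot_mem hx)
    hβ.wordTot_wordTot (fun m x hx hD hN => ?_)
  · simp only [LinearMap.comp_apply, Finsupp.lapply_apply]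
    rw [hβ.cycNorm_wordTot_zero]
    simp
  · refine cycNorm_mem_invariants (wordSpan_mono (fun w hw => ⟨hw.1, ?_⟩)
      ((mem_wordTotDegree p).1 hx 0))
    simpa using hw.2
  · refine ⟨Finsupp.single 0 (lengthInv k y), single_mem_wordTotDegree p
      (diag_mem_wordSpan _ (wordSpan_mono (fun w hw => ⟨hw.1, by simpa using hw.2⟩)
        ((mem_invariants p).1 hy).1)), ?_⟩
    rw [LinearMap.comp_apply, Finsupp.lapply_apply, Finsupp.single_eq_same, exists_cycNorm_eq hy]
  · obtain ⟨L, hL⟩ := exists_length_le x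
    exact hβ.exists_wordTot_eq L m x hx hL hD hN

/-- The cyclic homology of a graded algebra in characteristic zero is that of the complex of
invariant words. -/
theorem IsGradedMul.nonempty_cyclicHomology_equiv_invariants [CharZero k] (hβ : IsGradedMul β p)
    {𝒜 : ℤ → Submodule k R} [DirectSum.Decomposition 𝒜]
    (h𝒜 : ∀ x, β x ∈ 𝒜 ((p x : ℤ) - 1)) (n : ℤ) :
    Nonempty (cyclicHomology k 𝒜 n ≃ₗ[k] gradedHomology (bar β p) (invariants p) n) := by
  obtain ⟨e⟩ := hβ.nonempty_cyclicHomology_equiv_word h𝒜 n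
  obtain ⟨e'⟩ := hβ.nonempty_word_equiv_invariants n
  exact ⟨e.trans e'⟩

end Contraction

/-! ### Words in the letters of a quiver -/

section Letters

variable {V E : Type*} {ιA : V → Type*} {ιM : E → Type*}

variable (ιA ιM) in
/-- The letters of a quiver: basis vectors of the algebras of the vertices and of the modules of the
edges. -/
abbrev Letter : Type _ := (Σ v, ιA v) ⊕ (Σ e, ιM e)

/-- The weight of a letter: `1` for a vertex letter and `0` for an edge letter. -/
def letterWeight : Letter ιA ιM → ℕ
  | .inl _ => 1
  | .inr _ => 0

/-- The source of a letter. -/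
def letterSrc (s : E → V) : Letter ιA ιM → V
  | .inl x => x.1
  | .inr x => s x.1

/-- The target of a letter. -/
def letterTgt (t : E → V) : Letter ιA ιM → V
  | .inl x => x.1
  | .inr x => t x.1

/-- The edge of an edge letter, as a list. -/
def letterEdges : Letter ιA ιM → List E
  | .inl _ => []
  | .inr x => [x.1]

/-- The sequence of edges of a word. -/
def edges (w : List (Letter ιA ιM)) : List E := w.flatMap letterEdges

@[simp] theorem edges_nil : edges ([] : List (Letter ιA ιM)) = [] := rfl

@[simp] theorem edges_cons (x : Letter ιA ιM) (w : List (Letter ιA ιM)) :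
    edges (x :: w) = letterEdges x ++ edges w := rfl

@[simp] theorem edges_append (u w : List (Letter ιA ιM)) : edges (u ++ w) = edges u ++ edges w :=
  List.flatMap_append

variable (s t : E → V)

/-- The letter `z` can occur in the product of the letters `x` and `y`. -/
def Composes (x y z : Letter ιA ιM) : Prop :=
  letterWeight z + 1 = letterWeight x + letterWeight y ∧ letterTgt t x = letterSrc s y ∧
    letterSrc s z = letterSrc s x ∧ letterTgt t z = letterTgt t y ∧
    letterEdges z = letterEdges x ++ letterEdges y

open Classical in
/-- `0` if the target `v` of a letter is the source `v'` of the next one, and `1` otherwise. -/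
def breakAt (v v' : V) : ℕ := if v = v' then 0 else 1

theorem breakAt_eq_zero {v v' : V} : breakAt v v' = 0 ↔ v = v' := by simp [breakAt]

/-- The number of adjacent letters of a word that do not compose. -/
def breaks : List (Letter ιA ιM) → ℕ
  | x :: y :: r => breakAt (letterTgt t x) (letterSrc s y) + breaks (y :: r)
  | _ => 0

/-- The number of cyclically adjacent letters of a word that do not compose. -/
def cycBreaks : List (Letter ιA ιM) → ℕ
  | [] => 0
  | x :: u => breaks s t (x :: (u ++ [x]))

variable {s t}

theorem breaks_append_cons (u v : List (Letter ιA ιM)) (x : Letter ιA ιM) :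
    breaks s t (u ++ x :: v) = breaks s t (u ++ [x]) + breaks s t (x :: v) := by
  induction u with
  | nil => simp [breaks]
  | cons y u ih =>
    rcases u with - | ⟨z, u⟩
    · simp [breaks]
    · simp only [List.cons_append, breaks] at ih ⊢
      omega

theorem breaks_concat (u : List (Letter ιA ιM)) {x y : Letter ιA ιM}
    (h : letterSrc s x = letterSrc s y) : breaks s t (u ++ [x]) = breaks s t (u ++ [y]) := by
  induction u with
  | nil => rfl
  | cons z u ih =>
    rcases u with - | ⟨z', u⟩
    · simp [breaks, h]
    · simp only [List.cons_append, breaks] at ih ⊢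
      omega

theorem breaks_cons {x y : Letter ιA ιM} (h : letterTgt t x = letterTgt t y)
    (u : List (Letter ιA ιM)) : breaks s t (x :: u) = breaks s t (y :: u) := by
  cases u <;> simp [breaks, h]

theorem cycBreaks_rotate (u : List (Letter ιA ιM)) (x : Letter ιA ιM) :
    cycBreaks s t (x :: u) = cycBreaks s t (u ++ [x]) := by
  rcases u with - | ⟨y, r⟩
  · rfl
  · have h1 := breaks_append_cons (s := s) (t := t) (y :: r) [y] x
    have h2 : breaks s t (x :: y :: (r ++ [x])) =
      breakAt (letterTgt t x) (letterSrc s y) + breaks s t (y :: (r ++ [x])) := by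
      simp [breaks]
    simp only [cycBreaks, List.cons_append, List.append_assoc, List.nil_append] at h1 ⊢
    rw [h2, h1]
    simp [breaks, add_comm]

/-- The multiplied pair composes and so contributes no break, and the product keeps the outer source
and target. -/
theorem Composes.cycBreaks_eq {x y z : Letter ιA ιM} (h : Composes s t x y z)
    (r : List (Letter ιA ιM)) : cycBreaks s t (z :: r) = cycBreaks s t (x :: y :: r) := by
  obtain ⟨-, h1, h2, h3, -⟩ := h
  rw [cycBreaks, cycBreaks, ← List.cons_append, breaks_concat _ h2,
    List.cons_append, breaks_cons h3, List.cons_append, breaks, breakAt_eq_zero.2 h1, zero_add]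

theorem Composes.edges_eq {x y z : Letter ιA ιM} (h : Composes s t x y z)
    (r : List (Letter ιA ιM)) : edges (z :: r) = edges (x :: y :: r) := by
  simp [h.2.2.2.2]

variable (s t) in
/-- The last letter of the word does not compose with the first one. -/
def IsClosingBreak (w : List (Letter ιA ιM)) : Prop :=
  ∃ x y, w.head? = some x ∧ w.getLast? = some y ∧ letterTgt t y ≠ letterSrc s x

open Classical in
theorem ite_isClosingBreak (x y : Letter ιA ιM) {w : List (Letter ιA ιM)}
    (hx : w.head? = some x) (hy : w.getLast? = some y) :
    (if IsClosingBreak s t w then 1 else 0) = breakAt (letterTgt t y) (letterSrc s x) := by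
  have : IsClosingBreak s t w ↔ letterTgt t y ≠ letterSrc s x := by
    rw [IsClosingBreak, hx, hy]
    exact ⟨fun ⟨_, _, h1, h2, h⟩ => by rwa [Option.some_inj.1 h1, Option.some_inj.1 h2],
      fun h => ⟨_, _, rfl, rfl, h⟩⟩
  rw [breakAt]
  by_cases h : letterTgt t y = letterSrc s x
  · rw [if_pos h, if_neg (fun h' => this.1 h' h)]
  · rw [if_neg h, if_pos (this.2 h)]

-- The rotation that begins at a given letter of `v` ends with the letter before it, so its closing
-- break is a break of the original word between these two.
open Classical in
theorem rotationCount_aux (u v : List (Letter ιA ιM)) (x : Letter ιA ιM) :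
    ∑ i ∈ Finset.range v.length,
      (if IsClosingBreak s t ((u ++ x :: v).rotate (u.length + 1 + i)) then 1 else 0) =
      breaks s t (x :: v) := by
  induction v generalizing u x with
  | nil => simp [breaks]
  | cons y v ih =>
    rw [List.length_cons, Finset.sum_range_succ', breaks, ← ih (u ++ [x]) y, add_comm]
    congr 1
    · have : (u ++ x :: y :: v).rotate (u.length + 1 + 0) = y :: v ++ (u ++ [x]) := by
        have := List.rotate_append_length_eq (u ++ [x]) (y :: v)
        simpa using this
      rw [this]
      exact ite_isClosingBreak y x rfl (by rw [← List.append_assoc]; exact List.getLast?_concat)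
    · refine Finset.sum_congr rfl fun i _ => ?_
      congr 3
      · simp
      · simp; omega

-- Each cyclically adjacent pair is the seam of exactly one rotation.
open Classical in
theorem rotationCount_isClosingBreak (w : List (Letter ιA ιM)) :
    rotationCount (IsClosingBreak s t) w = cycBreaks s t w := by
  rcases w with - | ⟨x, u⟩
  · rfl
  · have h := rotationCount_aux (s := s) (t := t) [] u x
    rw [rotationCount, List.length_cons, Finset.sum_range_succ', cycBreaks]
    simp only [List.nil_append, List.length_nil, zero_add] at h
    simp only [add_comm _ 1, List.rotate_zero]
    rw [h, add_comm]
    induction u using List.reverseRecOn with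
    | nil => rw [ite_isClosingBreak x x rfl rfl]; simp [breaks]
    | append_singleton u y _ =>
      have := breaks_append_cons (s := s) (t := t) (x :: u) [x] y
      simp only [List.cons_append, List.append_assoc, List.nil_append] at this ⊢
      rw [this, ite_isClosingBreak x y rfl (by rw [← List.cons_append]; exact List.getLast?_concat)]
      simp [breaks, add_comm]

/-- A word without cyclic breaks and without edges stays at one vertex. -/
theorem src_eq_of_breaks_eq_zero {x : Letter ιA ιM} {u : List (Letter ιA ιM)}
    (h : breaks s t (x :: u) = 0) (he : edges (x :: u) = []) :
    ∀ y ∈ x :: u, letterEdges y = [] ∧ letterSrc s y = letterSrc s x := by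
  induction u generalizing x with
  | nil => simpa using he
  | cons z u ih =>
    simp only [edges_cons, List.append_eq_nil_iff] at he
    rw [breaks, Nat.add_eq_zero_iff] at h
    have hx : letterTgt t x = letterSrc s x := by
      rcases x with x | x
      · rfl
      · simp [letterEdges] at he
    have hz : letterSrc s z = letterSrc s x := by
      rw [← breakAt_eq_zero.1 h.1, hx]
    intro y hy
    rcases List.mem_cons.1 hy with rfl | hy
    · exact ⟨he.1, rfl⟩
    · have := ih h.2 (by simp [he.2]) y hy
      exact ⟨this.1, this.2.trans hz⟩

/-- The edges of a word without breaks form a path, from the source of its first letter to that of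
its last one. -/
theorem isChain_edges {w : List (Letter ιA ιM)} {z : Letter ιA ιM}
    (h : breaks s t (w ++ [z]) = 0) :
    (edges w).IsChain (fun e e' => t e = s e') ∧
      (∀ e ∈ (edges w).getLast?, t e = letterSrc s z) ∧
      (∀ x ∈ w.head?, letterSrc s x = ((edges w).head?.map s).getD (letterSrc s z)) := by
  induction w with
  | nil => simp
  | cons x w ih =>
    have hw : breaks s t (w ++ [z]) = 0 ∧ ∀ y ∈ (w ++ [z]).head?, letterTgt t x = letterSrc s y := by
      obtain ⟨y, r, hy⟩ : ∃ y r, w ++ [z] = y :: r := by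
        cases w <;> simp
      rw [List.cons_append, hy, breaks, Nat.add_eq_zero_iff] at h
      rw [hy]
      exact ⟨h.2, fun y' hy' => by
        obtain rfl : y = y' := by simpa using hy'
        exact breakAt_eq_zero.1 h.1⟩
    obtain ⟨h1, h2, h3⟩ := ih hw.1
    -- Vertex letters do not move along the path, so the target of `x` is the source of the next
    -- edge, or the source of the closing letter `z` if no edge follows.
    have key : letterTgt t x = ((edges w).head?.map s).getD (letterSrc s z) := by
      rcases w with - | ⟨y, w⟩
      · simpa using hw.2
      · rw [← h3 y rfl]
        exact hw.2 y rfl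
    rcases x with x | ⟨e, i⟩
    · simp only [edges_cons, letterEdges, List.nil_append]
      exact ⟨h1, h2, fun y hy => by
        obtain rfl : Sum.inl x = y := by simpa using hy
        exact key⟩
    · simp only [edges_cons, letterEdges, List.cons_append, List.nil_append]
      simp only [letterTgt] at key
      refine ⟨List.isChain_cons.2 ⟨fun e' he' => ?_, h1⟩, ?_, by simp [letterSrc]⟩
      · rw [Option.mem_def] at he'
        simpa [he'] using key
      · rcases hE : edges w with - | ⟨e', r⟩
        · simpa [hE] using key
        · rw [hE] at h2
          simpa using h2

/-- Rotation of pointed cycles and of the lists of their edges. -/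
theorem cycleSetoid_iff {m : ℕ} (c c' : {c : Fin (m + 1) → E // IsPointedCycle s t c}) :
    (cycleSetoid s t m).r c c' ↔ List.ofFn c.1 ~r List.ofFn c'.1 := by
  have key : ∀ r : ℕ, (∀ i, c'.1 i = c.1 (i + Fin.ofNat (m + 1) r)) ↔
      (List.ofFn c.1).rotate r = List.ofFn c'.1 := by
    intro r
    constructor
    · intro h
      refine List.ext_getElem (by simp) fun i h1 h2 => ?_
      rw [List.getElem_rotate, List.getElem_ofFn, List.getElem_ofFn, h]
      refine congrArg c.1 (Fin.ext ?_)
      simp [Fin.val_add]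
    · intro h i
      have h' : ((List.ofFn c.1).rotate r)[(i : ℕ)]? = (List.ofFn c'.1)[(i : ℕ)]? := by rw [h]
      rw [List.getElem?_rotate (by simpa using i.2)] at h'
      have h1 : ((i : ℕ) + r) % (List.ofFn c.1).length < (m + 1) := by
        simpa using Nat.mod_lt _ (Nat.succ_pos m)
      rw [List.getElem?_ofFn, List.getElem?_ofFn, dif_pos h1, dif_pos i.2, Option.some_inj] at h'
      rw [← h']
      refine congrArg c.1 (Fin.ext ?_)
      simp [Fin.val_add]
  constructor
  · rintro ⟨r, h⟩
    exact ⟨r, (key r).1 (by simpa using h)⟩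
  · rintro ⟨r, h⟩
    exact ⟨Fin.ofNat (m + 1) r, (key r).2 h⟩

/-- The list of edges of a representative of a cycle. -/
def cycleEdges (ℓ : Cyc s t) : List E := List.ofFn ℓ.2.out.1

theorem cycleEdges_injective {ℓ ℓ' : Cyc s t} (h : cycleEdges ℓ ~r cycleEdges ℓ') : ℓ = ℓ' := by
  obtain ⟨m, q⟩ := ℓ
  obtain ⟨m', q'⟩ := ℓ'
  have hm : m = m' := by simpa [cycleEdges] using h.perm.length_eq
  subst hm
  rw [← q.out_eq, ← q'.out_eq]
  exact congrArg _ (Quotient.sound ((cycleSetoid_iff _ _).2 h))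

/-- Closing the word by its own first letter makes `isChain_edges` say that the path of edges
returns to its start. -/
theorem exists_cycleEdges {w : List (Letter ιA ιM)} (h : cycBreaks s t w = 0)
    (he : edges w ≠ []) : ∃ ℓ : Cyc s t, edges w ~r cycleEdges ℓ := by
  rcases w with - | ⟨x, u⟩
  · simp at he
  obtain ⟨h1, h2, h3⟩ := isChain_edges (w := x :: u) (z := x) h
  obtain ⟨m, hm⟩ : ∃ m, (edges (x :: u)).length = m + 1 :=
    ⟨_, (Nat.succ_pred_eq_of_pos (List.length_pos_iff.2 he)).symm⟩
  generalize edges (x :: u) = l at *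
  let c : Fin (m + 1) → E := fun i => l[i]
  have hc : List.ofFn c = l := List.ext_getElem (by simp [hm]) fun i _ _ => by
    rw [List.getElem_ofFn]; rfl
  have hpc : IsPointedCycle s t c := by
    intro i
    induction i using Fin.lastCases with
    | last =>
      have e1 : l.getLast? = some (c (Fin.last m)) := by
        rw [List.getLast?_eq_getElem?, hm]
        simp [c, hm]
      have e2 : l.head? = some (c 0) := by
        rw [List.head?_eq_getElem?]
        simp [c, hm]
      have h4 := h3 x rfl
      rw [e2] at h4
      rw [h2 _ e1, h4, Fin.last_add_one]
      simp
    | cast i =>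
      have := List.isChain_iff_getElem.1 h1 i (by omega)
      simpa [c, Fin.coeSucc_eq_succ] using this
  refine ⟨⟨m, ⟦⟨c, hpc⟩⟧⟩, ?_⟩
  rw [← hc]
  exact (cycleSetoid_iff ⟨c, hpc⟩ _).1 (Quotient.exact (Quotient.out_eq _).symm)

end Letters

/-! ### A basis of the algebra of a quiver -/

section Basis

set_option linter.unusedSectionVars false

variable {k V E : Type*} [Field k] (s t : E → V) (A : V → Type*) (M : E → Type*)
  [∀ v, Ring (A v)] [∀ e, AddCommGroup (M e)] [∀ v, Algebra k (A v)] [∀ e, Module k (M e)]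

open Classical in
variable (k) in
/-- The inclusion of the algebra of a vertex. -/
def vertexIncl (v : V) : A v →ₗ[k] QuiverAlgebra s t A M :=
  LinearMap.inl k (Π₀ v, A v) (Π₀ e, M e) ∘ₗ DFinsupp.lsingle v

open Classical in
variable (k) in
/-- The inclusion of the module of an edge. -/
def edgeIncl (e : E) : M e →ₗ[k] QuiverAlgebra s t A M :=
  LinearMap.inr k (Π₀ v, A v) (Π₀ e, M e) ∘ₗ DFinsupp.lsingle e

variable {ιA : V → Type*} {ιM : E → Type*} (bA : ∀ v, Basis (ιA v) k (A v))
  (bM : ∀ e, Basis (ιM e) k (M e))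

/-- The basis of the algebra of a quiver given by bases of its parts. -/
def quiverBasis : Basis (Letter ιA ιM) k (QuiverAlgebra s t A M) :=
  ((DFinsupp.basis bA).prod (DFinsupp.basis bM) :
    Basis (Letter ιA ιM) k ((Π₀ v, A v) × (Π₀ e, M e)))

variable {s t A M}

theorem dfinsuppBasis_apply {ι : Type*} {η : ι → Type*} {N : ι → Type*} [∀ i, AddCommGroup (N i)]
    [∀ i, Module k (N i)] [DecidableEq ι] (b : ∀ i, Basis (η i) k (N i)) (i : ι) (j : η i) :
    DFinsupp.basis b ⟨i, j⟩ = DFinsupp.single i (b i j) := by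
  classical
  rw [Basis.apply_eq_iff]
  refine Finsupp.ext fun ⟨i', j'⟩ => ?_
  change (b i').repr (DFinsupp.single i (b i j) i') j' = _
  by_cases h : i' = i
  · subst h
    rw [DFinsupp.single_eq_same, Basis.repr_self, Finsupp.single_apply, Finsupp.single_apply]
    simp
  · rw [DFinsupp.single_eq_of_ne h, map_zero, Finsupp.single_eq_of_ne (by simp [h])]
    rfl

theorem quiverBasis_inl (v : V) (i : ιA v) :
    quiverBasis s t A M bA bM (.inl ⟨v, i⟩) = vertexIncl k s t A M v (bA v i) := by
  classical
  refine Prod.ext ((Basis.prod_apply_inl_fst _ _ _).trans ?_) (Basis.prod_apply_inl_snd _ _ _)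
  rw [dfinsuppBasis_apply]
  rfl

theorem quiverBasis_inr (e : E) (i : ιM e) :
    quiverBasis s t A M bA bM (.inr ⟨e, i⟩) = edgeIncl k s t A M e (bM e i) := by
  classical
  refine Prod.ext (Basis.prod_apply_inr_fst _ _ _) ((Basis.prod_apply_inr_snd _ _ _).trans ?_)
  rw [dfinsuppBasis_apply]
  rfl

theorem vertexIncl_mem (v : V) (a : A v) : vertexIncl k s t A M v a ∈
    Submodule.span k (quiverBasis s t A M bA bM '' {z | ∃ i, z = .inl ⟨v, i⟩}) := by
  rw [← (bA v).linearCombination_repr a, Finsupp.linearCombination_apply, Finsupp.sum, map_sum]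
  refine Submodule.sum_mem _ fun i _ => ?_
  rw [map_smul, ← quiverBasis_inl bA bM]
  exact Submodule.smul_mem _ _ (Submodule.subset_span ⟨_, ⟨i, rfl⟩, rfl⟩)

theorem edgeIncl_mem (e : E) (m : M e) : edgeIncl k s t A M e m ∈
    Submodule.span k (quiverBasis s t A M bA bM '' {z | ∃ i, z = .inr ⟨e, i⟩}) := by
  rw [← (bM e).linearCombination_repr m, Finsupp.linearCombination_apply, Finsupp.sum, map_sum]
  refine Submodule.sum_mem _ fun i _ => ?_
  rw [map_smul, ← quiverBasis_inr bA bM]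
  exact Submodule.smul_mem _ _ (Submodule.subset_span ⟨_, ⟨i, rfl⟩, rfl⟩)

theorem quiverBasis_mem_grading (x : Letter ιA ιM) :
    quiverBasis s t A M bA bM x ∈ quiverGrading k s t A M ((letterWeight x : ℤ) - 1) := by
  rcases x with ⟨v, i⟩ | ⟨e, i⟩
  · rw [quiverBasis_inl]
    exact ⟨fun h => (h (by simp [letterWeight])).elim, fun _ => rfl⟩
  · rw [quiverBasis_inr]
    exact ⟨fun _ => rfl, fun h => (h (by simp [letterWeight])).elim⟩

@[simp] theorem vertexIncl_fst_same (v : V) (a : A v) : (vertexIncl k s t A M v a).1 v = a := by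
  classical exact DFinsupp.single_eq_same

theorem vertexIncl_fst_of_ne {v w : V} (h : w ≠ v) (a : A v) :
    (vertexIncl k s t A M v a).1 w = 0 := by
  classical exact DFinsupp.single_eq_of_ne h

@[simp] theorem vertexIncl_snd (v : V) (a : A v) (e : E) :
    (vertexIncl k s t A M v a).2 e = 0 := rfl

@[simp] theorem edgeIncl_snd_same (e : E) (m : M e) : (edgeIncl k s t A M e m).2 e = m := by
  classical exact DFinsupp.single_eq_same

theorem edgeIncl_snd_of_ne {e e' : E} (h : e' ≠ e) (m : M e) :
    (edgeIncl k s t A M e m).2 e' = 0 := by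
  classical exact DFinsupp.single_eq_of_ne h

@[simp] theorem edgeIncl_fst (e : E) (m : M e) (v : V) : (edgeIncl k s t A M e m).1 v = 0 := rfl

variable [∀ e, Module (A (s e)) (M e)] [∀ e, Module (A (t e))ᵐᵒᵖ (M e)]

theorem vertexIncl_mul_vertexIncl (v : V) (a b : A v) :
    vertexIncl k s t A M v a * vertexIncl k s t A M v b = vertexIncl k s t A M v (a * b) := by
  ext w
  · by_cases h : w = v
    · subst h; simp
    · simp [vertexIncl_fst_of_ne h]
  · simp

theorem vertexIncl_mul_vertexIncl_of_ne {v v' : V} (h : v ≠ v') (a : A v) (b : A v') :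
    vertexIncl k s t A M v a * vertexIncl k s t A M v' b = 0 := by
  ext w
  · by_cases h' : w = v
    · subst h'; simp [vertexIncl_fst_of_ne h]
    · simp [vertexIncl_fst_of_ne h']
  · simp

theorem vertexIncl_mul_edgeIncl (e : E) (a : A (s e)) (m : M e) :
    vertexIncl k s t A M (s e) a * edgeIncl k s t A M e m = edgeIncl k s t A M e (a • m) := by
  ext w
  · simp
  · by_cases h : w = e
    · subst h; simp
    · simp [edgeIncl_snd_of_ne h]

theorem vertexIncl_mul_edgeIncl_of_ne {v : V} {e : E} (h : v ≠ s e) (a : A v) (m : M e) :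
    vertexIncl k s t A M v a * edgeIncl k s t A M e m = 0 := by
  ext w
  · simp
  · by_cases h' : w = e
    · subst h'; simp [vertexIncl_fst_of_ne h.symm]
    · simp [edgeIncl_snd_of_ne h']

theorem edgeIncl_mul_vertexIncl (e : E) (a : A (t e)) (m : M e) :
    edgeIncl k s t A M e m * vertexIncl k s t A M (t e) a =
      edgeIncl k s t A M e (MulOpposite.op a • m) := by
  ext w
  · simp
  · by_cases h : w = e
    · subst h; simp
    · simp [edgeIncl_snd_of_ne h]

theorem edgeIncl_mul_vertexIncl_of_ne {v : V} {e : E} (h : t e ≠ v) (a : A v) (m : M e) :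
    edgeIncl k s t A M e m * vertexIncl k s t A M v a = 0 := by
  ext w
  · simp
  · by_cases h' : w = e
    · subst h'; simp [vertexIncl_fst_of_ne h]
    · simp [edgeIncl_snd_of_ne h']

theorem edgeIncl_mul_edgeIncl (e e' : E) (m : M e) (m' : M e') :
    edgeIncl k s t A M e m * edgeIncl k s t A M e' m' = 0 := by
  ext w <;> simp

variable [∀ e, SMulCommClass (A (s e)) (A (t e))ᵐᵒᵖ (M e)]

/-- A product of letters either vanishes or is a combination of letters with the expected weight,
endpoints and edges. This one fact makes degree, breaks and edge sequences compatible with the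
differential. -/
theorem quiverBasis_mul_mem (x y : Letter ιA ιM) :
    quiverBasis s t A M bA bM x * quiverBasis s t A M bA bM y ∈
      Submodule.span k (quiverBasis s t A M bA bM '' {z | Composes s t x y z}) := by
  rcases x with ⟨v, i⟩ | ⟨e, i⟩ <;> rcases y with ⟨v', i'⟩ | ⟨e', i'⟩
  · rw [quiverBasis_inl, quiverBasis_inl]
    by_cases h : v = v'
    · subst h
      rw [vertexIncl_mul_vertexIncl]
      refine Submodule.span_mono (Set.image_mono ?_) (vertexIncl_mem bA bM v _)
      rintro _ ⟨j, rfl⟩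
      exact ⟨rfl, rfl, rfl, rfl, rfl⟩
    · rw [vertexIncl_mul_vertexIncl_of_ne h]
      exact Submodule.zero_mem _
  · rw [quiverBasis_inl, quiverBasis_inr]
    by_cases h : v = s e'
    · subst h
      rw [vertexIncl_mul_edgeIncl]
      refine Submodule.span_mono (Set.image_mono ?_) (edgeIncl_mem bA bM e' _)
      rintro _ ⟨j, rfl⟩
      exact ⟨rfl, rfl, rfl, rfl, rfl⟩
    · rw [vertexIncl_mul_edgeIncl_of_ne h]
      exact Submodule.zero_mem _
  · rw [quiverBasis_inr, quiverBasis_inl]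
    by_cases h : t e = v'
    · subst h
      rw [edgeIncl_mul_vertexIncl]
      refine Submodule.span_mono (Set.image_mono ?_) (edgeIncl_mem bA bM e _)
      rintro _ ⟨j, rfl⟩
      exact ⟨rfl, rfl, rfl, rfl, rfl⟩
    · rw [edgeIncl_mul_vertexIncl_of_ne h]
      exact Submodule.zero_mem _
  · rw [quiverBasis_inr, quiverBasis_inr, edgeIncl_mul_edgeIncl]
    exact Submodule.zero_mem _

theorem isGradedMul_quiverBasis : IsGradedMul (quiverBasis s t A M bA bM) letterWeight :=
  fun x y => Submodule.span_mono (Set.image_mono fun _ h => h.1) (quiverBasis_mul_mem bA bM x y)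

end Basis

/-! ### The part with breaks is acyclic -/

section Breaks

set_option linter.unusedSectionVars false

variable {k V E : Type*} [Field k] {s t : E → V} {A : V → Type*} {M : E → Type*}
  [∀ v, Ring (A v)] [∀ e, AddCommGroup (M e)] [∀ v, Algebra k (A v)] [∀ e, Module k (M e)]
  [∀ e, Module (A (s e)) (M e)] [∀ e, Module (A (t e))ᵐᵒᵖ (M e)]
  [∀ e, IsScalarTower k (A (s e)) (M e)] [∀ e, IsScalarTower k (A (t e))ᵐᵒᵖ (M e)]
  [∀ e, SMulCommClass (A (s e)) (A (t e))ᵐᵒᵖ (M e)]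
  {ιA : V → Type*} {ιM : E → Type*} (bA : ∀ v, Basis (ιA v) k (A v))
  (bM : ∀ e, Basis (ιM e) k (M e))

local notation "ℬ" => quiverBasis s t A M bA bM
local notation "𝒟" => bar (quiverBasis s t A M bA bM) letterWeight

theorem unit_mul (x : Letter ιA ιM) :
    vertexIncl k s t A M (letterSrc s x) 1 * ℬ x = ℬ x := by
  rcases x with ⟨v, i⟩ | ⟨e, i⟩
  · rw [quiverBasis_inl]
    change vertexIncl k s t A M v 1 * _ = _
    rw [vertexIncl_mul_vertexIncl, one_mul]
  · rw [quiverBasis_inr]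
    change vertexIncl k s t A M (s e) 1 * _ = _
    rw [vertexIncl_mul_edgeIncl, one_smul]

theorem mul_unit (x : Letter ιA ιM) :
    ℬ x * vertexIncl k s t A M (letterTgt t x) 1 = ℬ x := by
  rcases x with ⟨v, i⟩ | ⟨e, i⟩
  · rw [quiverBasis_inl]
    change _ * vertexIncl k s t A M v 1 = _
    rw [vertexIncl_mul_vertexIncl, mul_one]
  · rw [quiverBasis_inr]
    change _ * vertexIncl k s t A M (t e) 1 = _
    rw [edgeIncl_mul_vertexIncl, MulOpposite.op_one, one_smul]

theorem mul_unit_of_ne {x : Letter ιA ιM} {v : V} (h : letterTgt t x ≠ v) :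
    ℬ x * vertexIncl k s t A M v 1 = 0 := by
  rcases x with ⟨v', i⟩ | ⟨e, i⟩
  · rw [quiverBasis_inl]
    exact vertexIncl_mul_vertexIncl_of_ne h _ _
  · rw [quiverBasis_inr]
    exact edgeIncl_mul_vertexIncl_of_ne (e := e) h _ _

/-- `x₁ ⋯ xₙ ↦ 1 x₁ ⋯ xₙ`, where `1` is the unit of the algebra at the source of `x₁`. -/
def unitCons : FreeAlgebra k (Letter ιA ιM) →ₗ[k] FreeAlgebra k (Letter ιA ιM) :=
  (wordBasis k _).constr k fun w => match w with
    | [] => 0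
    | x :: u => emb ℬ (vertexIncl k s t A M (letterSrc s x) 1) * word k (x :: u)

local notation "𝓊" => unitCons (s := s) (t := t) bA bM

theorem unitCons_word_cons (x : Letter ιA ιM) (u : List (Letter ιA ιM)) :
    𝓊 (word k (x :: u)) =
      emb ℬ (vertexIncl k s t A M (letterSrc s x) 1) * word k (x :: u) := by
  rw [← wordBasis_apply, unitCons, Basis.constr_basis, wordBasis_apply]

theorem unitCons_of_src {v : V} {x : FreeAlgebra k (Letter ιA ιM)}
    (hx : x ∈ wordSpan k (fun w : List (Letter ιA ιM) => ∃ y u, w = y :: u ∧ letterSrc s y = v)) :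
    𝓊 x = emb ℬ (vertexIncl k s t A M v 1) * x :=
  eq_on_wordSpan (f := 𝓊)
    (g := LinearMap.mulLeft k (emb ℬ (vertexIncl k s t A M v 1))) (fun w hw => by
      obtain ⟨y, u, rfl, rfl⟩ := hw
      exact unitCons_word_cons bA bM y u) hx

theorem vertexIncl_mem_sign (v : V) (a : A v) : vertexIncl k s t A M v a ∈
    Submodule.span k (ℬ '' {z | (-1 : k) ^ letterWeight z = -1}) := by
  refine Submodule.span_mono (Set.image_mono ?_) (vertexIncl_mem bA bM v a)
  rintro _ ⟨i, rfl⟩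
  simp [letterWeight]

theorem rot_vertexIncl (v : V) (a : A v) (u : List (Letter ιA ιM)) (y : Letter ιA ιM) :
    rot k letterWeight (emb ℬ (vertexIncl k s t A M v a) * word k (u ++ [y])) =
      (-1 : k) ^ ((1 + wordDegree letterWeight u) * letterWeight y) •
        (FreeAlgebra.ι k y * (emb ℬ (vertexIncl k s t A M v a) * word k u)) := by
  refine eq_on_letters (β := ℬ) (rot k letterWeight ∘ₗ LinearMap.mulRight k (word k (u ++ [y])) ∘ₗ emb ℬ)
    ((-1 : k) ^ ((1 + wordDegree letterWeight u) * letterWeight y) •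
      (LinearMap.mulLeft k (FreeAlgebra.ι k y) ∘ₗ LinearMap.mulRight k (word k u) ∘ₗ emb ℬ))
    (fun z hz => ?_) (vertexIncl_mem bA bM v a)
  obtain ⟨i, rfl⟩ := hz
  simp only [LinearMap.comp_apply, LinearMap.smul_apply, LinearMap.mulRight_apply,
    LinearMap.mulLeft_apply, emb_basis]
  rw [← word_cons, ← word_cons, ← word_cons, ← List.cons_append, rot_concat]
  simp [letterWeight]

/-- The differential keeps the source of the first letter, so the same unit may be put in front of a
word and of its boundary. -/
theorem bar_word_cons_mem (x : Letter ιA ιM) (u : List (Letter ιA ιM)) :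
    𝒟 (word k (x :: u)) ∈ wordSpan k (fun w : List (Letter ιA ιM) =>
      ∃ y u, w = y :: u ∧ letterSrc s y = letterSrc s x) := by
  have h1 : mulFirst ℬ letterWeight (word k (x :: u)) ∈ wordSpan k (fun w : List (Letter ιA ιM) =>
      ∃ y u, w = y :: u ∧ letterSrc s y = letterSrc s x) :=
    mulFirst_mem_wordSpan (β := ℬ) (p := letterWeight) (C := Composes s t) (quiverBasis_mul_mem bA bM)
      (P := fun w => w = x :: u)
      (Q := fun w : List (Letter ιA ιM) => ∃ y u, w = y :: u ∧ letterSrc s y = letterSrc s x)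
      (fun x' y z r (h : Composes s t x' y z) (hw : x' :: y :: r = x :: u) =>
        ⟨z, r, rfl, h.2.2.1.trans (by rw [(List.cons.inj hw).1])⟩)
      (word_mem_wordSpan rfl)
  have h2 : ∀ y : FreeAlgebra k (Letter ιA ιM), FreeAlgebra.ι k x * y ∈
      wordSpan k (fun w : List (Letter ιA ιM) => ∃ y u, w = y :: u ∧ letterSrc s y = letterSrc s x) :=
    fun y => by
      have hy : y ∈ wordSpan k (fun _ : List (Letter ιA ιM) => True) :=
        mem_wordSpan.2 fun _ _ => trivial
      refine map_mem_of_wordSpan (f := LinearMap.mulLeft k (FreeAlgebra.ι k x)) (fun w _ => ?_) hy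
      rw [LinearMap.mulLeft_apply, ← word_cons]
      exact word_mem_wordSpan ⟨x, w, rfl, rfl⟩
  rw [word_cons, bar_letter_mul, ← word_cons]
  exact Submodule.add_mem _ h1 (Submodule.smul_mem _ _ (h2 _))

/-- The unit has weight one. Multiplying it into the first letter returns the word with sign `-1`,
and the differential of the rest also acquires `-1` when it passes the unit. -/
theorem bar_unitCons {x : FreeAlgebra k (Letter ιA ιM)}
    (hx : x ∈ wordSpan k (fun w : List (Letter ιA ιM) => w ≠ [])) :
    𝒟 (𝓊 x) = - x - 𝓊 (𝒟 x) := by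
  have key : ∀ w : List (Letter ιA ιM), w ≠ [] → (𝒟 ∘ₗ 𝓊) (word k w) =
      (-LinearMap.id - 𝓊 ∘ₗ 𝒟 :
        FreeAlgebra k (Letter ιA ιM) →ₗ[k] FreeAlgebra k (Letter ιA ιM)) (word k w) := by
    intro w hw
    obtain ⟨x, u, rfl⟩ := List.exists_cons_of_ne_nil hw
    have h1 : 𝒟 (emb ℬ (vertexIncl k s t A M (letterSrc s x) 1) * word k (x :: u)) =
        mulFirst ℬ letterWeight
          (emb ℬ (vertexIncl k s t A M (letterSrc s x) 1) * word k (x :: u)) +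
        (-1 : k) • (emb ℬ (vertexIncl k s t A M (letterSrc s x) 1) * 𝒟 (word k (x :: u))) :=
      bar_emb_mul ℬ letterWeight (ε := (-1 : k)) (vertexIncl_mem_sign bA bM _ _) _
    have h2 : mulFirst ℬ letterWeight
          (emb ℬ (vertexIncl k s t A M (letterSrc s x) 1) * word k (x :: u)) =
        (-1 : k) • word k (x :: u) := by
      rw [word_cons, ← emb_basis ℬ x, mulFirst_emb_mul ℬ letterWeight (ε := (-1 : k))
        (vertexIncl_mem_sign bA bM _ _), unit_mul]
    rw [LinearMap.comp_apply, LinearMap.sub_apply, LinearMap.neg_apply, LinearMap.comp_apply,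
      LinearMap.id_apply, unitCons_word_cons, unitCons_of_src bA bM (bar_word_cons_mem bA bM x u),
      h1, h2, neg_one_smul, neg_one_smul, sub_eq_add_neg]
  exact eq_on_wordSpan key hx

-- The rotation puts the last letter before the unit. Their product is that letter if it ends at the
-- source of the first letter, and zero otherwise, so the words with a closing break drop out.
open Classical in
theorem mulFirst_rot_unitCons {x : FreeAlgebra k (Letter ιA ιM)}
    (hx : x ∈ wordSpan k (fun w : List (Letter ιA ιM) => w ≠ [])) :
    mulFirst ℬ letterWeight (rot k letterWeight (𝓊 x)) =
      rot k letterWeight (x - wordProj k (IsClosingBreak s t) x) := by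
  have key : ∀ w : List (Letter ιA ιM), w ≠ [] →
      (mulFirst ℬ letterWeight ∘ₗ rot k letterWeight ∘ₗ 𝓊) (word k w) =
      (rot k letterWeight ∘ₗ (LinearMap.id - wordProj k (IsClosingBreak s t) :
        FreeAlgebra k (Letter ιA ιM) →ₗ[k] FreeAlgebra k (Letter ιA ιM))) (word k w) := by
    intro w hw
    obtain ⟨x, r, hx⟩ := List.exists_cons_of_ne_nil hw
    obtain ⟨u, y, hy⟩ := (List.eq_nil_or_concat w).resolve_left hw
    rw [List.concat_eq_append] at hy
    have hbr : IsClosingBreak s t w ↔ letterTgt t y ≠ letterSrc s x := by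
      have := ite_isClosingBreak (s := s) (t := t) (w := w) x y (by rw [hx]; rfl)
        (by rw [hy]; exact List.getLast?_concat)
      rw [ne_eq, ← breakAt_eq_zero, ← this]
      simp
    simp only [LinearMap.comp_apply, LinearMap.sub_apply, LinearMap.id_apply]
    have h1 : 𝓊 (word k w) = emb ℬ (vertexIncl k s t A M (letterSrc s x) 1) * word k w := by
      rw [hx, unitCons_word_cons]
    have hs : (-1 : k) ^ ((1 + wordDegree letterWeight u) * letterWeight y) *
        (-1) ^ letterWeight y = (-1) ^ (wordDegree letterWeight u * letterWeight y) := by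
      rw [add_mul, one_mul, pow_add, mul_right_comm, ← pow_add, (Even.add_self _).neg_one_pow,
        one_mul]
    rw [h1]
    by_cases h : letterTgt t y = letterSrc s x
    · rw [wordProj_word_of_not (fun h' => hbr.1 h' h), sub_zero, hy, rot_vertexIncl, map_smul,
        mulFirst_letter_mul, rot_concat, smul_smul, hs, ← h, mul_unit, emb_basis, word_cons]
    · rw [wordProj_word_of (hbr.2 h), sub_self, map_zero, hy, rot_vertexIncl, map_smul,
        mulFirst_letter_mul, mul_unit_of_ne bA bM h, map_zero, zero_mul, smul_zero, smul_zero]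
  exact eq_on_wordSpan key hx

/-- The homotopy that contracts the invariant words with breaks. -/
theorem bar_cycNorm_unitCons {x : FreeAlgebra k (Letter ιA ιM)}
    (hx : x ∈ wordSpan k (fun w : List (Letter ιA ιM) => w ≠ [])) (ht : rot k letterWeight x = x)
    (hD : 𝒟 x = 0) :
    𝒟 (cycNorm k letterWeight (𝓊 x)) =
      - diag k (fun w => (cycBreaks s t w : k)) x := by
  classical
  -- With `P` the projection on closing breaks, `bar N u x = N hoch u x = N (-x + t (x - P x)) = -N
  -- P x`, and `N P` multiplies by the number of breaks.
  rw [← (isGradedMul_quiverBasis bA bM).cycNorm_hoch, hoch, LinearMap.add_apply,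
    LinearMap.comp_apply, bar_unitCons bA bM hx, mulFirst_rot_unitCons bA bM hx, hD, map_zero,
    sub_zero, map_add, cycNorm_rot, map_sub, map_neg, cycNorm_wordProj_of_invariant k _ _ ht]
  simp only [rotationCount_isClosingBreak]
  abel

end Breaks

/-! ### The components of the complex of invariant words -/

section Components

variable {V E : Type*} {ιA : V → Type*} {ιM : E → Type*} {s t : E → V}

variable (s) in
/-- The nonempty words in the letters of the vertex `v`. -/
def IsVertexWord (v : V) (w : List (Letter ιA ιM)) : Prop :=
  w ≠ [] ∧ ∀ x ∈ w, letterEdges x = [] ∧ letterSrc s x = v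

/-- The words without breaks along the cycle `ℓ`. -/
def IsCycleWord (ℓ : Cyc s t) (w : List (Letter ιA ιM)) : Prop :=
  cycBreaks s t w = 0 ∧ edges w ~r cycleEdges ℓ

/-- The words of a component: those at a vertex or those along a cycle. -/
def IsComponentWord (i : V ⊕ Cyc s t) (w : List (Letter ιA ιM)) : Prop :=
  Sum.elim (fun v => IsVertexWord s v w) (fun ℓ => IsCycleWord ℓ w) i

theorem cycleEdges_ne_nil (ℓ : Cyc s t) : cycleEdges ℓ ≠ [] := by
  rw [cycleEdges, ne_eq, ← List.length_eq_zero_iff, List.length_ofFn]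
  omega

theorem letterTgt_eq_letterSrc {x : Letter ιA ιM} (h : letterEdges x = []) :
    letterTgt t x = letterSrc s x := by
  rcases x with x | x
  · rfl
  · simp [letterEdges] at h

theorem IsVertexWord.edges_eq_nil {v : V} {w : List (Letter ιA ιM)}
    (h : IsVertexWord s v w) : edges w = [] :=
  List.flatMap_eq_nil_iff.2 fun x hx => (h.2 x hx).1

theorem IsComponentWord.unique {i j : V ⊕ Cyc s t} {w : List (Letter ιA ιM)}
    (hi : IsComponentWord i w) (hj : IsComponentWord j w) : i = j := by
  have key : ∀ {v : V} {ℓ : Cyc s t}, IsVertexWord s v w → ¬ IsCycleWord ℓ w := fun hv hl =>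
    cycleEdges_ne_nil _ (List.isRotated_nil_iff'.1 (hv.edges_eq_nil ▸ hl.2)).symm
  rcases i with v | ℓ <;> rcases j with v' | ℓ'
  · obtain ⟨x, u, rfl⟩ := List.exists_cons_of_ne_nil hi.1
    rw [← (hi.2 x (by simp)).2, ← (hj.2 x (by simp)).2]
  · exact (key hi hj).elim
  · exact (key hj hi).elim
  · exact congrArg _ (cycleEdges_injective (hi.2.symm.trans hj.2))

theorem exists_isComponentWord {w : List (Letter ιA ιM)} (hw : w ≠ []) (h : cycBreaks s t w = 0) :
    ∃ i : V ⊕ Cyc s t, IsComponentWord i w := by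
  by_cases he : edges w = []
  · obtain ⟨x, u, rfl⟩ := List.exists_cons_of_ne_nil hw
    have h' : breaks s t (x :: u ++ [x]) = 0 := h
    refine ⟨.inl (letterSrc s x), hw, fun y hy =>
      src_eq_of_breaks_eq_zero (t := t) h' (by simp only [edges_cons, List.append_eq_nil_iff] at he ⊢; simp [he]) y ?_⟩
    exact List.mem_append_left _ hy
  · obtain ⟨ℓ, hℓ⟩ := exists_cycleEdges h he
    exact ⟨.inr ℓ, h, hℓ⟩

theorem isComponentWord_rotate (i : V ⊕ Cyc s t) (u : List (Letter ιA ιM)) (x : Letter ιA ιM) :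
    IsComponentWord i (x :: u) ↔ IsComponentWord i (u ++ [x]) := by
  rcases i with v | ℓ
  · simp only [IsComponentWord, Sum.elim_inl, IsVertexWord, List.mem_cons, List.mem_append,
      List.not_mem_nil, or_false]
    simp [or_comm]
  · have h : edges (x :: u) ~r edges (u ++ [x]) := by
      simpa using List.isRotated_append (l := letterEdges x) (l' := edges u)
    simp only [IsComponentWord, Sum.elim_inr, IsCycleWord, cycBreaks_rotate]
    exact and_congr_right fun _ => ⟨h.symm.trans, h.trans⟩

/-- An equivalence is needed, not just an implication, for the projection on a component to commute
with the differential. The converse for a vertex uses that the two factors compose. -/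
theorem Composes.isComponentWord (i : V ⊕ Cyc s t) {x y z : Letter ιA ιM}
    (h : Composes s t x y z) (r : List (Letter ιA ιM)) :
    IsComponentWord i (z :: r) ↔ IsComponentWord i (x :: y :: r) := by
  rcases i with v | ℓ
  · have hz : (letterEdges z = [] ∧ letterSrc s z = v) ↔
        (letterEdges x = [] ∧ letterSrc s x = v) ∧ (letterEdges y = [] ∧ letterSrc s y = v) := by
      rw [h.2.2.2.2, h.2.2.1, List.append_eq_nil_iff]
      constructor
      · rintro ⟨⟨h1, h2⟩, h3⟩
        exact ⟨⟨h1, h3⟩, h2, by rw [← h.2.1, letterTgt_eq_letterSrc (s := s) h1, h3]⟩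
      · rintro ⟨⟨h1, h2⟩, h3, -⟩
        exact ⟨⟨h1, h3⟩, h2⟩
    simp only [IsComponentWord, Sum.elim_inl, IsVertexWord, List.forall_mem_cons, ne_eq,
      reduceCtorEq, not_false_eq_true, true_and]
    rw [hz, and_assoc]
  · simp only [IsComponentWord, Sum.elim_inr, IsCycleWord, h.cycBreaks_eq, h.edges_eq]

end Components

/-! ### Splitting the invariant words, with the breaks removed -/

section Splitting

set_option linter.unusedSectionVars false

variable {k V E : Type*} [Field k] {s t : E → V} {A : V → Type*} {M : E → Type*}
  [∀ v, Ring (A v)] [∀ e, AddCommGroup (M e)] [∀ v, Algebra k (A v)] [∀ e, Module k (M e)]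
  [∀ e, Module (A (s e)) (M e)] [∀ e, Module (A (t e))ᵐᵒᵖ (M e)]
  [∀ e, IsScalarTower k (A (s e)) (M e)] [∀ e, IsScalarTower k (A (t e))ᵐᵒᵖ (M e)]
  [∀ e, SMulCommClass (A (s e)) (A (t e))ᵐᵒᵖ (M e)]
  {ιA : V → Type*} {ιM : E → Type*} (bA : ∀ v, Basis (ιA v) k (A v))
  (bM : ∀ e, Basis (ιM e) k (M e))

local notation "ℬ" => quiverBasis s t A M bA bM
local notation "𝒟" => bar (quiverBasis s t A M bA bM) letterWeight
local notation "𝓊" => unitCons (s := s) (t := t) bA bM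

variable (k ιA ιM) in
/-- The invariant words of a component. -/
def componentInvariants (i : V ⊕ Cyc s t) (n : ℤ) : Submodule k (FreeAlgebra k (Letter ιA ιM)) :=
  invariants letterWeight n ⊓ wordSpan k (IsComponentWord i)

theorem unitCons_mem_degree {n : ℤ} {x : FreeAlgebra k (Letter ιA ιM)}
    (hx : x ∈ wordSpan k (fun w : List (Letter ιA ιM) =>
      w ≠ [] ∧ (wordDegree letterWeight w : ℤ) = n + 1)) :
    𝓊 x ∈ wordSpan k (fun w : List (Letter ιA ιM) =>
      w ≠ [] ∧ (wordDegree letterWeight w : ℤ) = n + 1 + 1) := by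
  refine map_mem_of_wordSpan (fun w hw => ?_) hx
  obtain ⟨x, u, rfl⟩ := List.exists_cons_of_ne_nil hw.1
  rw [unitCons_word_cons]
  have h := vertexIncl_mem bA bM (s := s) (t := t) (letterSrc s x) 1
  refine Submodule.span_induction (p := fun a _ => emb ℬ a * word k (x :: u) ∈
      wordSpan k (fun w : List (Letter ιA ιM) =>
        w ≠ [] ∧ (wordDegree letterWeight w : ℤ) = n + 1 + 1)) ?_ ?_ ?_ ?_ h
  · rintro _ ⟨_, ⟨i, rfl⟩, rfl⟩
    rw [emb_basis, ← word_cons]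
    refine word_mem_wordSpan ⟨by simp, ?_⟩
    rw [wordDegree_cons, letterWeight, ← hw.2]
    push_cast
    ring
  · rw [map_zero, zero_mul]; exact Submodule.zero_mem _
  · intro a b _ _ ha hb
    rw [map_add, add_mul]; exact Submodule.add_mem _ ha hb
  · intro c a _ ha
    rw [map_smul, smul_mul_assoc]; exact Submodule.smul_mem _ _ ha

/-- Dividing by the number of breaks commutes with the rotation and the differential. So the divided
cycle is again an invariant cycle, and the homotopy applied to it gives a primitive, up to sign. -/
theorem exists_bar_eq_of_breaks [CharZero k] {n : ℤ} {x : FreeAlgebra k (Letter ιA ιM)}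
    (hx : x ∈ invariants letterWeight n) (hD : 𝒟 x = 0)
    (hb : x ∈ wordSpan k (fun w => cycBreaks s t w ≠ 0)) :
    ∃ y ∈ invariants (k := k) letterWeight (n + 1), 𝒟 y = x := by
  obtain ⟨hd, ht⟩ := (mem_invariants _).1 hx
  let φ : List (Letter ιA ιM) → k := fun w => (cycBreaks s t w : k)⁻¹
  have hφ : ∀ u x, φ (x :: u) = φ (u ++ [x]) := fun u x => by simp only [φ, cycBreaks_rotate]
  have hd' : diag k φ x ∈ wordSpan k (fun w : List (Letter ιA ιM) =>
      w ≠ [] ∧ (wordDegree letterWeight w : ℤ) = n + 1) := diag_mem_wordSpan φ hd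
  have ht' : rot k letterWeight (diag k φ x) = diag k φ x := by
    rw [rot_diag k letterWeight hφ, ht]
  have hD' : 𝒟 (diag k φ x) = 0 := by
    rw [(isGradedMul_quiverBasis bA bM).bar_diag (C := Composes s t) (quiverBasis_mul_mem bA bM)
      (fun x y z r h => by simp only [φ, h.cycBreaks_eq]) hφ, hD, map_zero]
  refine ⟨-cycNorm k letterWeight (𝓊 (diag k φ x)), Submodule.neg_mem _
    (cycNorm_mem_invariants (unitCons_mem_degree bA bM hd')), ?_⟩
  rw [map_neg, bar_cycNorm_unitCons bA bM (wordSpan_mono (fun w h => h.1) hd') ht' hD', neg_neg,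
    diag_diag, diag_eq_smul (P := fun w => cycBreaks s t w ≠ 0) (c := 1) (fun w hw => ?_) hb,
    one_smul]
  exact mul_inv_cancel₀ (by exact_mod_cast hw)

/-- Finitely many words occur, and each belongs to at most one component. -/
theorem finite_wordProj_ne_zero (x : FreeAlgebra k (Letter ιA ιM)) :
    {i : V ⊕ Cyc s t | wordProj k (IsComponentWord i) x ≠ 0}.Finite := by
  refine Set.Finite.subset (Set.Finite.biUnion ((wordBasis k _).repr x).support.finite_toSet
    (t := fun w => {i : V ⊕ Cyc s t | IsComponentWord i w}) fun w _ =>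
      Set.Subsingleton.finite fun i hi j hj => hi.unique hj) fun i hi => ?_
  have h : (wordBasis k _).repr (wordProj k (IsComponentWord i) x) ≠ 0 := fun h =>
    hi ((LinearEquiv.map_eq_zero_iff _).1 h)
  obtain ⟨w, hw⟩ := Finsupp.ne_iff.1 h
  rw [wordProj, repr_diag, Finsupp.zero_apply] at hw
  simp only [Set.mem_iUnion, Finset.mem_coe, Finsupp.mem_support_iff]
  refine ⟨w, right_ne_zero_of_mul hw, ?_⟩
  by_contra h'
  exact left_ne_zero_of_mul hw (if_neg h')

open Classical in
theorem rot_wordProj_component (i : V ⊕ Cyc s t) (x : FreeAlgebra k (Letter ιA ιM)) :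
    rot k letterWeight (wordProj k (IsComponentWord i) x) =
      wordProj k (IsComponentWord i) (rot k letterWeight x) := by
  rw [wordProj, rot_diag k letterWeight]
  exact fun u x => if_congr (isComponentWord_rotate i u x) rfl rfl

open Classical in
theorem bar_wordProj_component (i : V ⊕ Cyc s t) (x : FreeAlgebra k (Letter ιA ιM)) :
    𝒟 (wordProj k (IsComponentWord i) x) = wordProj k (IsComponentWord i) (𝒟 x) := by
  rw [wordProj, (isGradedMul_quiverBasis bA bM).bar_diag (C := Composes s t)
    (quiverBasis_mul_mem bA bM)]
  · exact fun x y z r h => if_congr (h.isComponentWord i r) rfl rfl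
  · exact fun u x => if_congr (isComponentWord_rotate i u x) rfl rfl

/-- The homology of the invariant words is the sum of those of the components. -/
theorem nonempty_invariants_equiv_components [CharZero k] (n : ℤ) :
    Nonempty (gradedHomology 𝒟 (invariants letterWeight) n ≃ₗ[k]
      ⨁ i : V ⊕ Cyc s t, gradedHomology 𝒟 (componentInvariants k ιA ιM i) n) := by
  refine nonempty_homology_equiv_directSum (invariants letterWeight)
    (componentInvariants k ιA ιM) (fun i => wordProj k (IsComponentWord i))
    (fun i m => inf_le_left) (fun i m x hx => ⟨?_, wordProj_mem _ _⟩)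
    (fun i x => (bar_wordProj_component bA bM i x).symm)
    (fun i m x hx => wordProj_eq_self hx.2)
    (fun i j m hij x hx => wordProj_eq_zero (fun w hi hj => hij (hi.unique hj)) hx.2)
    finite_wordProj_ne_zero (fun x hx hD hP => exists_bar_eq_of_breaks bA bM hx hD ?_)
  · obtain ⟨hd, ht⟩ := (mem_invariants _).1 hx
    refine (mem_invariants _).2 ⟨diag_mem_wordSpan _ hd, ?_⟩
    rw [rot_wordProj_component, ht]
  -- A word without breaks lies in some component. If all the projections vanish, only words with
  -- breaks are left.
  · refine mem_wordSpan.2 fun w hw hb => ?_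
    obtain ⟨i, hi⟩ := exists_isComponentWord (s := s) (t := t)
      (mem_wordSpan.1 ((mem_invariants _).1 hx).1 w hw).1 hb
    have h := congrArg (fun y => (wordBasis k _).repr y w) (hP i)
    simp only [wordProj, repr_diag, map_zero, Finsupp.zero_apply] at h
    rw [if_pos hi, one_mul] at h
    exact hw h

end Splitting

/-! ### The components of the vertices -/

section VertexComponents

set_option linter.unusedSectionVars false

variable {k V E : Type*} [Field k] {s t : E → V} {A : V → Type*} {M : E → Type*}
  [∀ v, Ring (A v)] [∀ e, AddCommGroup (M e)] [∀ v, Algebra k (A v)] [∀ e, Module k (M e)]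
  [∀ e, Module (A (s e)) (M e)] [∀ e, Module (A (t e))ᵐᵒᵖ (M e)]
  [∀ e, IsScalarTower k (A (s e)) (M e)] [∀ e, IsScalarTower k (A (t e))ᵐᵒᵖ (M e)]
  [∀ e, SMulCommClass (A (s e)) (A (t e))ᵐᵒᵖ (M e)]
  {ιA : V → Type*} {ιM : E → Type*} (bA : ∀ v, Basis (ιA v) k (A v))
  (bM : ∀ e, Basis (ιM e) k (M e))

local notation "ℬ" => quiverBasis s t A M bA bM
local notation "𝒟" => bar (quiverBasis s t A M bA bM) letterWeight

variable (ιA ιM) in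
/-- The letter of a basis vector of the algebra of a vertex. -/
def vertexLetter (v : V) (i : ιA v) : Letter ιA ιM := .inl ⟨v, i⟩

theorem vertexLetter_injective (v : V) : Function.Injective (vertexLetter ιA ιM v) :=
  Sum.inl_injective.comp sigma_mk_injective

variable (k ιA ιM) in
/-- The inclusion of the words of a vertex. -/
def vertexWords (v : V) : FreeAlgebra k (ιA v) →ₗ[k] FreeAlgebra k (Letter ιA ιM) :=
  (FreeAlgebra.lift k fun i => FreeAlgebra.ι k (vertexLetter ιA ιM v i)).toLinearMap

local notation "Φ" => vertexWords k ιA ιM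

theorem vertexWords_mul (v : V) (x y : FreeAlgebra k (ιA v)) : Φ v (x * y) = Φ v x * Φ v y :=
  map_mul (FreeAlgebra.lift k fun i => FreeAlgebra.ι k (vertexLetter ιA ιM v i)) x y

theorem vertexWords_ι (v : V) (i : ιA v) :
    Φ v (FreeAlgebra.ι k i) = FreeAlgebra.ι k (vertexLetter ιA ιM v i) :=
  FreeAlgebra.lift_ι_apply _ _

theorem vertexWords_word (v : V) (w : List (ιA v)) :
    Φ v (word k w) = word k (w.map (vertexLetter ιA ιM v)) := by
  induction w with
  | nil => exact map_one (FreeAlgebra.lift k fun i => FreeAlgebra.ι k (vertexLetter ιA ιM v i))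
  | cons x w ih => rw [word_cons, vertexWords_mul, vertexWords_ι, ih, List.map_cons, word_cons]

theorem repr_vertexWords (v : V) (x : FreeAlgebra k (ιA v)) (w : List (ιA v)) :
    (wordBasis k _).repr (Φ v x) (w.map (vertexLetter ιA ιM v)) = (wordBasis k _).repr x w := by
  classical
  have : (wordBasis k _).coord (w.map (vertexLetter ιA ιM v)) ∘ₗ Φ v =
      (wordBasis k _).coord w := by
    refine word_ext k fun u => ?_
    rw [LinearMap.comp_apply, vertexWords_word, ← wordBasis_apply, ← wordBasis_apply,
      Basis.coord_apply, Basis.coord_apply, Basis.repr_self, Basis.repr_self,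
      Finsupp.single_apply, Finsupp.single_apply]
    simp only [(List.map_injective_iff.2 (vertexLetter_injective v)).eq_iff]
  exact LinearMap.congr_fun this x

theorem vertexWords_injective (v : V) : Function.Injective (Φ v) := fun x y h => by
  refine (wordBasis k _).ext_elem fun w => ?_
  rw [← repr_vertexWords, h, repr_vertexWords]

theorem vertexWords_emb (v : V) (a : A v) :
    Φ v (emb (bA v) a) = emb ℬ (vertexIncl k s t A M v a) := by
  refine LinearMap.congr_fun (f := Φ v ∘ₗ emb (bA v)) (g := emb ℬ ∘ₗ vertexIncl k s t A M v)
    ((bA v).ext fun i => ?_) a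
  rw [LinearMap.comp_apply, LinearMap.comp_apply, emb_basis, vertexWords_ι,
    ← quiverBasis_inl bA bM, emb_basis]
  rfl

theorem vertexWords_mulFirst (v : V) (w : List (ιA v)) :
    Φ v (mulFirst (bA v) (fun _ => 1) (word k w)) =
      mulFirst ℬ letterWeight (Φ v (word k w)) := by
  rcases w with - | ⟨x, - | ⟨y, r⟩⟩
  · rw [vertexWords_word]; simp
  · rw [vertexWords_word]; simp
  · rw [vertexWords_word, List.map_cons, List.map_cons, mulFirst_word_cons_cons,
      mulFirst_word_cons_cons, map_smul, vertexWords_mul, vertexWords_word,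
      vertexWords_emb (s := s) (t := t) bA bM]
    rw [vertexLetter, vertexLetter, quiverBasis_inl, quiverBasis_inl, vertexIncl_mul_vertexIncl]
    rfl

theorem vertexWords_bar_word (v : V) (w : List (ιA v)) :
    Φ v (bar (bA v) (fun _ => 1) (word k w)) =
      bar (quiverBasis s t A M bA bM) letterWeight (Φ v (word k w)) := by
  induction w with
  | nil => rw [vertexWords_word]; simp
  | cons x w ih =>
    have h := vertexWords_mulFirst bA bM (s := s) (t := t) v (x :: w)
    rw [vertexWords_word, List.map_cons, word_cons] at h
    rw [word_cons, bar_letter_mul, map_add, h, map_smul, vertexWords_mul, ih, vertexWords_mul,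
      vertexWords_ι, vertexWords_word, word_cons, bar_letter_mul]
    rfl

theorem vertexWords_bar (v : V) (x : FreeAlgebra k (ιA v)) :
    Φ v (bar (bA v) (fun _ => 1) x) = 𝒟 (Φ v x) :=
  LinearMap.congr_fun (f := Φ v ∘ₗ bar (bA v) (fun _ => 1)) (g := 𝒟 ∘ₗ Φ v)
    (word_ext k fun w => vertexWords_bar_word bA bM v w) x

theorem wordDegree_map_vertexLetter (v : V) (w : List (ιA v)) :
    wordDegree letterWeight (w.map (vertexLetter ιA ιM v)) = wordDegree (fun _ => 1) w := by
  induction w with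
  | nil => rfl
  | cons x w ih => rw [List.map_cons, wordDegree_cons, wordDegree_cons, ih]; rfl

theorem vertexWords_rot (v : V) (x : FreeAlgebra k (ιA v)) :
    Φ v (rot k (fun _ => 1) x) = rot k letterWeight (Φ v x) := by
  refine LinearMap.congr_fun (f := Φ v ∘ₗ rot k (fun _ => 1)) (g := rot k letterWeight ∘ₗ Φ v)
    (word_ext k fun w => ?_) x
  rw [LinearMap.comp_apply, LinearMap.comp_apply, vertexWords_word]
  induction w using List.reverseRecOn with
  | nil => simpa using vertexWords_word (k := k) (ιM := ιM) v []
  | append_singleton u x _ =>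
    rw [rot_concat, List.map_append, List.map_singleton, rot_concat, map_smul, vertexWords_word,
      wordDegree_map_vertexLetter]
    rfl

theorem isVertexWord_map (v : V) {w : List (ιA v)} (hw : w ≠ []) :
    IsVertexWord s v (w.map (vertexLetter ιA ιM v)) := by
  refine ⟨by simpa using hw, fun x hx => ?_⟩
  obtain ⟨i, -, rfl⟩ := List.mem_map.1 hx
  exact ⟨rfl, rfl⟩

theorem IsVertexWord.exists_map {v : V} {w : List (Letter ιA ιM)} (h : IsVertexWord s v w) :
    ∃ u : List (ιA v), u.map (vertexLetter ιA ιM v) = w := by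
  have h' : ∀ x ∈ w, x ∈ Set.range (vertexLetter ιA ιM v) := fun x hx => by
    obtain ⟨h1, h2⟩ := h.2 x hx
    rcases x with ⟨v', i⟩ | ⟨e, i⟩
    · obtain rfl : v' = v := h2
      exact ⟨i, rfl⟩
    · simp [letterEdges] at h1
  exact (Set.range_list_map (vertexLetter ιA ιM v)).ge h'

theorem exists_vertexWords_eq {v : V} {y : FreeAlgebra k (Letter ιA ιM)}
    (hy : y ∈ wordSpan k (IsVertexWord s v)) : ∃ x, Φ v x = y := by
  refine map_mem_of_wordSpan (f := LinearMap.id) (S := LinearMap.range (Φ v)) (fun w hw => ?_) hy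
  obtain ⟨u, rfl⟩ := hw.exists_map
  exact ⟨word k u, vertexWords_word v u⟩

theorem isGradedMul_vertex (v : V) : IsGradedMul (bA v) (fun _ => 1) := fun x y => by
  simp [(bA v).span_eq]

/-- On an invariant element the two correction terms of `IsGradedMul.rot_bar` cancel. -/
theorem IsGradedMul.bar_mem_invariants {B R : Type*} [NonUnitalRing R] [Module k R]
    [IsScalarTower k R R] [SMulCommClass k R R] {β : Basis B k R} {p : B → ℕ}
    (hβ : IsGradedMul β p) {n : ℤ} {x : FreeAlgebra k B} (hx : x ∈ invariants p (n + 1)) :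
    bar β p x ∈ invariants p n := by
  obtain ⟨hd, ht⟩ := (mem_invariants p).1 hx
  refine (mem_invariants p).2 ⟨?_, by rw [hβ.rot_bar, ht, ht, sub_add_cancel]⟩
  exact hβ.bar_mem_degree hd

/-- The break-free words at `v` are exactly the nonempty words in the letters of `A_v`, with the
same weights and products, so this is an isomorphism of complexes. -/
theorem nonempty_vertex_equiv (v : V) (n : ℤ) :
    Nonempty (gradedHomology (bar (bA v) (fun _ => 1)) (invariants (fun _ => 1)) n ≃ₗ[k]
      gradedHomology 𝒟 (componentInvariants k ιA ιM (.inl v : V ⊕ Cyc s t)) n) := by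
  refine nonempty_homology_equiv_of_surjective (Φ v) 1 one_ne_zero
    (fun m x _ => by rw [one_smul, vertexWords_bar bA bM (s := s) (t := t)])
    (fun m x hx => ?_) (fun m y hy => ?_) (fun m x hx => ?_) (isGradedMul_vertex bA v).bar_bar
    (fun m x hx _ h0 => ⟨0, Submodule.zero_mem _, map_zero _, ?_⟩)
  · obtain ⟨hd, ht⟩ := (mem_invariants _).1 hx
    refine ⟨(mem_invariants _).2 ⟨?_, by rw [← vertexWords_rot, ht]⟩, ?_⟩
    · refine map_mem_of_wordSpan (fun w hw => ?_) hd
      rw [vertexWords_word]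
      exact word_mem_wordSpan ⟨by simpa using hw.1, by rw [wordDegree_map_vertexLetter, hw.2]⟩
    · refine map_mem_of_wordSpan (fun w hw => ?_) hd
      rw [vertexWords_word]
      exact word_mem_wordSpan (isVertexWord_map v hw.1)
  · obtain ⟨hd, ht⟩ := (mem_invariants _).1 hy.1
    obtain ⟨x, rfl⟩ := exists_vertexWords_eq (s := s) (v := v) hy.2
    refine ⟨x, (mem_invariants _).2 ⟨mem_wordSpan.2 fun w hw => ?_, ?_⟩, rfl⟩
    · rw [← repr_vertexWords (ιM := ιM)] at hw
      have := mem_wordSpan.1 hd _ hw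
      rw [wordDegree_map_vertexLetter] at this
      exact ⟨by simpa using this.1, this.2⟩
    · exact vertexWords_injective (ιM := ιM) v (by rw [vertexWords_rot, ht])
  · exact (isGradedMul_vertex bA v).bar_mem_invariants hx
  · rw [map_zero, vertexWords_injective v (h0.trans (map_zero _).symm)]

/-- The component of a vertex computes the cyclic homology of its algebra. -/
theorem nonempty_cyclicHomology_equiv_vertex [CharZero k] (v : V) (n : ℤ) :
    Nonempty (gradedHomology 𝒟 (componentInvariants k ιA ιM (.inl v : V ⊕ Cyc s t)) n ≃ₗ[k]
      cyclicHomology k (degreeZero k (A v)) n) := by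
  obtain ⟨e⟩ := nonempty_vertex_equiv (s := s) (t := t) bA bM v n
  obtain ⟨e'⟩ := (isGradedMul_vertex bA v).nonempty_cyclicHomology_equiv_invariants
    (𝒜 := degreeZero k (A v)) (fun x h => (h (by simp)).elim) n
  exact ⟨e.symm.trans e'.symm⟩

end VertexComponents

/-! ### Bar blocks as words -/

section Blocks

set_option linter.unusedSectionVars false

variable {k V E : Type*} [Field k] {s t : E → V} {A : V → Type*} {M : E → Type*}
  [∀ v, Ring (A v)] [∀ e, AddCommGroup (M e)] [∀ v, Algebra k (A v)] [∀ e, Module k (M e)]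
  {ιA : V → Type*} {ιM : E → Type*} (bA : ∀ v, Basis (ιA v) k (A v))
  (bM : ∀ e, Basis (ιM e) k (M e))

local notation "ℬ" => quiverBasis s t A M bA bM
local notation "𝒟" => bar (quiverBasis s t A M bA bM) letterWeight
local notation "Φ" => vertexWords k ιA ιM

variable (t ιA ιM) in
/-- The index set of a basis of the block of an edge. -/
abbrev BlockIndex (e : E) : Type _ := Σ n : ℕ, ιM e × (Fin n → ιA (t e))

/-- The basis of the block of an edge. -/
def blockBasis (e : E) : Basis (BlockIndex t ιA ιM e) k (Block k t A M e) :=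
  (DFinsupp.basis fun n => (bM e).tensorProduct (Basis.piTensorProduct fun _ : Fin n => bA (t e)) :
    Basis (BlockIndex t ιA ιM e) k (Π₀ n : ℕ, M e ⊗[k] (⨂[k]^n (A (t e)))))

theorem blockBasis_apply (e : E) (n : ℕ) (i : ιM e) (a : Fin n → ιA (t e)) :
    blockBasis (t := t) bA bM e ⟨n, i, a⟩ = BarBlock.incl k (A (t e)) (M e) n
      (bM e i ⊗ₜ PiTensorProduct.tprod k fun l => bA (t e) (a l)) := by
  refine (dfinsuppBasis_apply _ _ _).trans ?_
  rw [Basis.tensorProduct_apply, Basis.piTensorProduct_apply]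
  rfl

/-- The word of a basis element of a block. -/
def blockLetters (e : E) (b : BlockIndex t ιA ιM e) : List (Letter ιA ιM) :=
  .inr ⟨e, b.2.1⟩ :: (List.ofFn b.2.2).map (vertexLetter ιA ιM (t e))

theorem even_basis (e : E) (b : BlockIndex t ιA ιM e) :
    BarBlock.even k (A (t e)) (M e) (blockBasis bA bM e b) =
      if Even b.1 then blockBasis bA bM e b else 0 := by
  obtain ⟨n, i, a⟩ := b
  rw [blockBasis_apply, BarBlock.even, DirectSum.toModule_lof]
  split_ifs <;> rfl

theorem odd_basis (e : E) (b : BlockIndex t ιA ιM e) :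
    BarBlock.odd k (A (t e)) (M e) (blockBasis bA bM e b) =
      if Even b.1 then 0 else blockBasis bA bM e b := by
  obtain ⟨n, i, a⟩ := b
  rw [blockBasis_apply, BarBlock.odd, DirectSum.toModule_lof]
  split_ifs <;> rfl

theorem sgn_basis (e : E) (b : BlockIndex t ιA ιM e) :
    BarBlock.sgn k (A (t e)) (M e) (blockBasis bA bM e b) =
      (-1 : k) ^ b.1 • blockBasis bA bM e b := by
  rw [BarBlock.sgn, LinearMap.sub_apply, even_basis, odd_basis]
  rcases Nat.even_or_odd b.1 with h | h
  · rw [if_pos h, if_pos h, h.neg_one_pow, sub_zero, one_smul]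
  · rw [if_neg (Nat.not_even_iff_odd.2 h), if_neg (Nat.not_even_iff_odd.2 h), h.neg_one_pow,
      zero_sub]
    exact (neg_one_smul k _).symm

theorem wordDegree_blockLetters (e : E) (b : BlockIndex t ιA ιM e) :
    wordDegree letterWeight (blockLetters e b) = b.1 := by
  rw [blockLetters, wordDegree_cons, wordDegree_map_vertexLetter]
  simp [letterWeight, wordDegree, List.map_ofFn, List.sum_ofFn]

theorem strip_zero (e : E) (x : M e ⊗[k] (⨂[k]^0 (A (t e)))) :
    BarBlock.strip k (A (t e)) (M e) (BarBlock.incl k (A (t e)) (M e) 0 x) = 0 := by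
  rw [BarBlock.strip, DirectSum.toModule_lof]
  rfl

theorem splitLast_tprod {R : Type*} [NonUnitalRing R] [Module k R] (n : ℕ) (a : Fin (n + 1) → R) :
    splitLast k R n (PiTensorProduct.tprod k a) =
      (PiTensorProduct.tprod k fun l => a l.castSucc) ⊗ₜ a (Fin.last n) := by
  rw [splitLast, PiTensorProduct.lift.tprod]
  rfl

theorem splitFirst_tprod {R : Type*} [NonUnitalRing R] [Module k R] (n : ℕ) (a : Fin (n + 1) → R) :
    splitFirst k R n (PiTensorProduct.tprod k a) =
      a 0 ⊗ₜ (PiTensorProduct.tprod k fun l => a l.succ) := by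
  rw [splitFirst, PiTensorProduct.lift.tprod]
  rfl

theorem strip_succ (e : E) (n : ℕ) (m : M e) (a : Fin (n + 1) → A (t e)) :
    BarBlock.strip k (A (t e)) (M e)
      (BarBlock.incl k (A (t e)) (M e) (n + 1) (m ⊗ₜ PiTensorProduct.tprod k a)) =
    BarBlock.incl k (A (t e)) (M e) n (m ⊗ₜ PiTensorProduct.tprod k fun l => a l.castSucc) ⊗ₜ
      a (Fin.last n) := by
  rw [BarBlock.strip, DirectSum.toModule_lof]
  simp only [LinearMap.comp_apply, LinearMap.lTensor_tmul, splitLast_tprod]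
  rfl

/-- If all letters have degree zero, hence weight one, the twist is trivial. This makes
`IsGradedMul.tens_barB'` available for the untwisted words inside a block. -/
theorem tens_one (n : ℕ) {R B : Type*} [NonUnitalRing R] [Module k R] (β : Basis B k R)
    (x : ⨂[k]^n R) : tens β (fun _ => 1) n x = plainWord β n x := by
  have h : ∀ w : List B, Even (twistExp (fun _ => 1) w) := fun w => by
    induction w with
    | nil => simp [twistExp]
    | cons x w ih => rw [twistExp]; exact (even_two.mul_left _).add ih
  rw [tens, LinearMap.comp_apply, twist, diag_eq_smul (P := fun _ => True) (c := 1)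
    (fun w _ => (h w).neg_one_pow) (mem_wordSpan.2 fun _ _ => trivial), one_smul]

variable [∀ e, Module (A (s e)) (M e)] [∀ e, Module (A (t e))ᵐᵒᵖ (M e)]
  [∀ e, IsScalarTower k (A (s e)) (M e)] [∀ e, IsScalarTower k (A (t e))ᵐᵒᵖ (M e)]
  [∀ e, SMulCommClass (A (s e)) (A (t e))ᵐᵒᵖ (M e)]

variable (s) in
/-- The elements of the block of an edge, as combinations of words. -/
def blockWord (e : E) : Block k t A M e →ₗ[k] FreeAlgebra k (Letter ιA ιM) :=
  DirectSum.toModule k ℕ _ fun n => LinearMap.mul' k _ ∘ₗ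
    TensorProduct.map (emb ℬ ∘ₗ edgeIncl k s t A M e) (Φ (t e) ∘ₗ plainWord (bA (t e)) n)

theorem blockWord_incl (e : E) (n : ℕ) (m : M e) (x : ⨂[k]^n (A (t e))) :
    blockWord s bA bM e (BarBlock.incl k (A (t e)) (M e) n (m ⊗ₜ x)) =
      emb ℬ (edgeIncl k s t A M e m) * Φ (t e) (plainWord (bA (t e)) n x) := by
  rw [blockWord, DirectSum.toModule_lof]
  rfl

theorem blockWord_basis (e : E) (b : BlockIndex t ιA ιM e) :
    blockWord s bA bM e (blockBasis bA bM e b) = word k (blockLetters e b) := by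
  obtain ⟨n, i, a⟩ := b
  rw [blockBasis_apply, blockWord_incl, ← quiverBasis_inr bA bM, emb_basis, plainWord_tprod_basis,
    vertexWords_word, ← word_cons]
  rfl

theorem inner_zero (e : E) (x : M e ⊗[k] (⨂[k]^0 (A (t e)))) :
    BarBlock.inner k (A (t e)) (M e) (BarBlock.incl k (A (t e)) (M e) 0 x) = 0 := by
  rw [BarBlock.inner, DirectSum.toModule_lof]
  rfl

theorem inner_succ (e : E) (n : ℕ) (m : M e) (a : Fin (n + 1) → A (t e)) :
    BarBlock.inner k (A (t e)) (M e)
      (BarBlock.incl k (A (t e)) (M e) (n + 1) (m ⊗ₜ PiTensorProduct.tprod k a)) =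
    BarBlock.incl k (A (t e)) (M e) n
      ((MulOpposite.op (a 0) • m) ⊗ₜ PiTensorProduct.tprod k fun l => a l.succ) -
    BarBlock.incl k (A (t e)) (M e) n
      (m ⊗ₜ barB' k (A (t e)) n (PiTensorProduct.tprod k a)) := by
  rw [BarBlock.inner, DirectSum.toModule_lof, ← map_sub]
  simp only [LinearMap.comp_apply, LinearMap.add_apply, LinearMap.lTensor_tmul, splitFirst_tprod,
    LinearMap.sum_apply, LinearMap.smul_apply, barB']
  congr 1
  rw [sub_eq_add_neg, TensorProduct.tmul_sum, ← Finset.sum_neg_distrib]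
  congr 1
  refine Finset.sum_congr rfl fun l _ => ?_
  rw [TensorProduct.tmul_smul, pow_succ, mul_neg_one, neg_smul]

theorem edgeIncl_mem_sign (e : E) (m : M e) : edgeIncl k s t A M e m ∈
    Submodule.span k (ℬ '' {z | (-1 : k) ^ letterWeight z = 1}) := by
  refine Submodule.span_mono (Set.image_mono ?_) (edgeIncl_mem bA bM e m)
  rintro _ ⟨i, rfl⟩
  simp [letterWeight]

theorem vertexWords_plainWord_succ (v : V) (n : ℕ) (a : Fin (n + 1) → A v) :
    Φ v (plainWord (bA v) (n + 1) (PiTensorProduct.tprod k a)) =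
      emb ℬ (vertexIncl k s t A M v (a 0)) *
        Φ v (plainWord (bA v) n (PiTensorProduct.tprod k fun l => a l.succ)) := by
  rw [plainWord_tprod, List.ofFn_succ, List.prod_cons, vertexWords_mul,
    vertexWords_emb (s := s) (t := t) bA bM, plainWord_tprod]

/-- The edge letter has weight zero, so the differential passes it without sign. The product of the
first two letters is the right action on `M`, and the rest is `-b'` on the algebra letters. -/
theorem blockWord_inner_tprod (e : E) (n : ℕ) (m : M e) (a : Fin n → A (t e)) :
    blockWord s bA bM e (BarBlock.inner k (A (t e)) (M e)
      (BarBlock.incl k (A (t e)) (M e) n (m ⊗ₜ PiTensorProduct.tprod k a))) =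
    𝒟 (blockWord s bA bM e
      (BarBlock.incl k (A (t e)) (M e) n (m ⊗ₜ PiTensorProduct.tprod k a))) := by
  rw [blockWord_incl, bar_emb_mul ℬ letterWeight (ε := (1 : k)) (edgeIncl_mem_sign bA bM e m),
    one_smul, ← vertexWords_bar bA bM]
  rcases n with - | n
  · have h : plainWord (bA (t e)) 0 (PiTensorProduct.tprod k a) = 1 := by
      rw [plainWord_tprod]; simp
    have h' : Φ (t e) 1 = 1 := vertexWords_word (k := k) (ιM := ιM) (t e) []
    rw [inner_zero, map_zero, h, bar_one, map_zero, mul_zero, add_zero, h', mul_one, mulFirst_emb]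
  · rw [inner_succ, map_sub, blockWord_incl, blockWord_incl, ← tens_one (n + 1), ← tens_one n,
      ← tens_one n,
      (isGradedMul_vertex bA (t e)).tens_barB', map_neg, mul_neg, sub_neg_eq_add]
    congr 1
    rw [tens_one, tens_one, vertexWords_plainWord_succ (s := s) (t := t) bA bM,
      mulFirst_emb_mul ℬ letterWeight (ε := (1 : k)) (edgeIncl_mem_sign bA bM e m), one_smul,
      edgeIncl_mul_vertexIncl]

theorem blockWord_inner (e : E) (b : BlockIndex t ιA ιM e) :
    blockWord s bA bM e (BarBlock.inner k (A (t e)) (M e) (blockBasis bA bM e b)) =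
      𝒟 (word k (blockLetters e b)) := by
  rw [← blockWord_basis (s := s) bA bM]
  obtain ⟨n, i, a⟩ := b
  rw [blockBasis_apply, blockWord_inner_tprod]

theorem blockWord_leftAct {v : V} {e : E} (h : v = s e) (a : A v) (b : BlockIndex t ιA ιM e) :
    blockWord s bA bM e (blockLeftAct k s t A M h a (blockBasis bA bM e b)) =
      emb ℬ (vertexIncl k s t A M v a * ℬ (.inr ⟨e, b.2.1⟩)) *
        word k ((List.ofFn b.2.2).map (vertexLetter ιA ιM (t e))) := by
  -- Eliminating the equality removes the transport hidden in `blockLeftAct`.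
  subst h
  obtain ⟨n, i, x⟩ := b
  have h1 : blockLeftAct k s t A M rfl a (blockBasis bA bM e ⟨n, i, x⟩) =
      BarBlock.incl k (A (t e)) (M e) n
        ((a • bM e i) ⊗ₜ PiTensorProduct.tprod k fun l => bA (t e) (x l)) := by
    rw [blockBasis_apply, blockLeftAct]
    exact DirectSum.toModule_lof k n _
  rw [h1, blockWord_incl, plainWord_tprod_basis, vertexWords_word, quiverBasis_inr,
    vertexIncl_mul_edgeIncl]

end Blocks

/-! ### The bar differential of a concatenation -/

section Concatenation

set_option linter.unusedSectionVars false

variable {k : Type*} [Field k] {B : Type*} {R : Type*} [NonUnitalRing R] [Module k R]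
  [IsScalarTower k R R] [SMulCommClass k R R] (β : Basis B k R) (p : B → ℕ)

/-- The multiplication of the first letter of a word from the left. -/
def leftMulFirst (a : R) : FreeAlgebra k B →ₗ[k] FreeAlgebra k B :=
  (wordBasis k B).constr k fun w => match w with
    | x :: r => emb β (a * β x) * word k r
    | [] => 0

theorem leftMulFirst_word_cons (a : R) (x : B) (r : List B) :
    leftMulFirst β a (word k (x :: r)) = emb β (a * β x) * word k r := by
  rw [← wordBasis_apply, leftMulFirst, Basis.constr_basis]

@[simp] theorem leftMulFirst_one (a : R) : leftMulFirst β a 1 = 0 := by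
  rw [← word_nil, ← wordBasis_apply, leftMulFirst, Basis.constr_basis]

theorem leftMulFirst_word_mul (a : R) {w : List B} (hw : w ≠ []) (u : FreeAlgebra k B) :
    leftMulFirst β a (word k w * u) = leftMulFirst β a (word k w) * u := by
  obtain ⟨x, r, rfl⟩ := List.exists_cons_of_ne_nil hw
  refine LinearMap.congr_fun
    (f := leftMulFirst β a ∘ₗ LinearMap.mulLeft k (word k (x :: r)))
    (g := LinearMap.mulLeft k (leftMulFirst β a (word k (x :: r)))) (word_ext k fun v => ?_) u
  rw [LinearMap.comp_apply, LinearMap.mulLeft_apply, LinearMap.mulLeft_apply, ← word_append,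
    List.cons_append, leftMulFirst_word_cons, leftMulFirst_word_cons, word_append, mul_assoc]

theorem mulFirst_ι_mul (x : B) (u : FreeAlgebra k B) :
    mulFirst β p (FreeAlgebra.ι k x * u) = (-1 : k) ^ p x • leftMulFirst β (β x) u := by
  refine LinearMap.congr_fun
    (f := mulFirst β p ∘ₗ LinearMap.mulLeft k (FreeAlgebra.ι k x))
    (g := (-1 : k) ^ p x • leftMulFirst β (β x)) (word_ext k fun v => ?_) u
  rw [LinearMap.comp_apply, LinearMap.mulLeft_apply, LinearMap.smul_apply, ← word_cons]
  rcases v with - | ⟨y, r⟩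
  · simp
  · rw [mulFirst_word_cons_cons, leftMulFirst_word_cons]

theorem word_flatten (L : List (List B)) : word k L.flatten = (L.map (word k)).prod := by
  induction L with
  | nil => rfl
  | cons u L ih => rw [List.flatten_cons, word_append, ih, List.map_cons, List.prod_cons]

theorem word_flatten_ofFn {m : ℕ} (u : Fin m → List B) :
    word k (List.ofFn u).flatten = (List.ofFn fun i => word k (u i)).prod := by
  rw [word_flatten, List.map_ofFn]
  rfl

/-- The Leibniz rule for a concatenation, with one more term for the product across the seam; the
last letter `x` of the first word is kept explicit to name that term. -/
theorem bar_concat_mul (u : List B) (x : B) (w : FreeAlgebra k B) :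
    bar β p (word k (u ++ [x]) * w) = bar β p (word k (u ++ [x])) * w +
      (-1 : k) ^ wordDegree p (u ++ [x]) •
        (word k u * leftMulFirst β (β x) w + word k (u ++ [x]) * bar β p w) := by
  induction u with
  | nil =>
    rw [List.nil_append, word_cons, word_nil, mul_one, bar_letter_mul, mulFirst_ι_mul, bar_letter,
      zero_mul, zero_add, one_mul, ← smul_add]
    simp
  | cons y u ih =>
    have h1 : mulFirst β p (FreeAlgebra.ι k y * (word k (u ++ [x]) * w)) =
        mulFirst β p (FreeAlgebra.ι k y * word k (u ++ [x])) * w := by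
      rw [mulFirst_ι_mul, mulFirst_ι_mul, leftMulFirst_word_mul β _ (by simp), smul_mul_assoc]
    have h2 : (-1 : k) ^ wordDegree p (y :: (u ++ [x])) =
        (-1) ^ p y * (-1) ^ wordDegree p (u ++ [x]) := by rw [wordDegree_cons, pow_add]
    rw [List.cons_append, word_cons, mul_assoc, bar_letter_mul, h1, ih, bar_letter_mul, h2,
      word_cons]
    simp only [mul_add, add_mul, smul_add, smul_mul_assoc, mul_smul_comm, smul_smul, mul_assoc]
    abel

theorem mulFirst_rot_concat (u : List B) (x : B) :
    mulFirst β p (rot k p (word k (u ++ [x]))) =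
      (-1 : k) ^ (wordDegree p u * p x + p x) • leftMulFirst β (β x) (word k u) := by
  rw [rot_concat, map_smul, word_cons, mulFirst_ι_mul, smul_smul, pow_add]

/-- The bar differential of a concatenation of nonempty words. -/
theorem bar_flatten_ofFn {m : ℕ} (u : Fin (m + 1) → List B) (x : Fin (m + 1) → B) :
    bar β p (word k (List.ofFn fun i => u i ++ [x i]).flatten) =
      ∑ j : Fin (m + 1), (List.ofFn fun i =>
        if i < j then (-1 : k) ^ wordDegree p (u i ++ [x i]) • word k (u i ++ [x i])
        else if i = j then bar β p (word k (u i ++ [x i])) else word k (u i ++ [x i])).prod +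
      ∑ j : Fin m, (List.ofFn fun i =>
        if i < j.castSucc then (-1 : k) ^ wordDegree p (u i ++ [x i]) • word k (u i ++ [x i])
        else if i = j.castSucc then (-1 : k) ^ wordDegree p (u i ++ [x i]) • word k (u i)
        else if i = j.succ then leftMulFirst β (β (x j.castSucc)) (word k (u i ++ [x i]))
        else word k (u i ++ [x i])).prod := by
  induction m with
  | zero => simp
  | succ m ih =>
    -- The seam after block `0` affects only block `1`, because that block is nonempty.
    have h0 : leftMulFirst β (β (x 0))
          (word k (List.ofFn fun i : Fin (m + 1) => u i.succ ++ [x i.succ]).flatten) =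
        leftMulFirst β (β (x 0)) (word k (u 1 ++ [x 1])) *
          (List.ofFn fun i : Fin m => word k (u i.succ.succ ++ [x i.succ.succ])).prod := by
      rw [List.ofFn_succ, List.flatten_cons, word_append, leftMulFirst_word_mul β _ (by simp),
        word_flatten_ofFn]
      rfl
    rw [List.ofFn_succ, List.flatten_cons, word_append, bar_concat_mul, h0,
      ih (fun i => u i.succ) (fun i => x i.succ), word_flatten_ofFn]
    conv_rhs => congr <;> rw [Fin.sum_univ_succ]
    simp only [List.ofFn_succ (n := m + 1), List.prod_cons, Fin.castSucc_zero,
      Fin.not_lt_zero, if_false, if_true, Fin.succ_ne_zero, Fin.succ_lt_succ_iff,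
      Fin.succ_inj, Fin.succ_pos, ← Fin.succ_castSucc]
    have h1 : (List.ofFn fun i : Fin (m + 1) =>
          if i = 0 then leftMulFirst β (β (x 0)) (word k (u i.succ ++ [x i.succ]))
          else word k (u i.succ ++ [x i.succ])).prod =
        leftMulFirst β (β (x 0)) (word k (u 1 ++ [x 1])) *
          (List.ofFn fun i : Fin m => word k (u i.succ.succ ++ [x i.succ.succ])).prod := by
      rw [List.ofFn_succ, List.prod_cons]
      simp
    rw [h1]
    simp only [mul_add, smul_add, smul_mul_assoc, Finset.mul_sum, Finset.smul_sum]
    abel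

end Concatenation

/-! ### The cyclic bar complex as words -/

section CyclicWords

set_option linter.unusedSectionVars false

variable {k V E : Type*} [Field k] {s t : E → V} {A : V → Type*} {M : E → Type*}
  [∀ v, Ring (A v)] [∀ e, AddCommGroup (M e)] [∀ v, Algebra k (A v)] [∀ e, Module k (M e)]
  [∀ e, Module (A (s e)) (M e)] [∀ e, Module (A (t e))ᵐᵒᵖ (M e)]
  [∀ e, IsScalarTower k (A (s e)) (M e)] [∀ e, IsScalarTower k (A (t e))ᵐᵒᵖ (M e)]
  [∀ e, SMulCommClass (A (s e)) (A (t e))ᵐᵒᵖ (M e)]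
  {ιA : V → Type*} {ιM : E → Type*} (bA : ∀ v, Basis (ιA v) k (A v))
  (bM : ∀ e, Basis (ιM e) k (M e))

local notation "ℬ" => quiverBasis s t A M bA bM
local notation "𝒟" => bar (quiverBasis s t A M bA bM) letterWeight
local notation "Φ" => vertexWords k ιA ιM

/-- The word of a basis element of a block without its last letter. -/
def blockInit (e : E) : BlockIndex t ιA ιM e → List (Letter ιA ιM)
  | ⟨0, _⟩ => []
  | ⟨n + 1, i, a⟩ => blockLetters e ⟨n, i, fun l : Fin n => a l.castSucc⟩

/-- The last letter of the word of a basis element of a block. -/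
def blockLast (e : E) : BlockIndex t ιA ιM e → Letter ιA ιM
  | ⟨0, i, _⟩ => .inr ⟨e, i⟩
  | ⟨n + 1, _, a⟩ => .inl ⟨t e, a (Fin.last n)⟩

theorem blockLetters_eq (e : E) (b : BlockIndex t ιA ιM e) :
    blockLetters e b = blockInit e b ++ [blockLast e b] := by
  obtain ⟨n, i, a⟩ := b
  rcases n with - | n
  · simp [blockLetters, blockInit, blockLast]
  · simp only [blockLetters, blockInit, blockLast, ofFn_eq_concat a, List.map_append,
      List.map_singleton]
    rfl

/-- The relation `M M = 0`: a block without algebra letters has zero seam term, in agreement with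
`glue`. -/
theorem leftMulFirst_edge (e e' : E) (i : ιM e) (b : BlockIndex t ιA ιM e') :
    leftMulFirst ℬ (ℬ (.inr ⟨e, i⟩)) (word k (blockLetters e' b)) = 0 := by
  rw [blockLetters, leftMulFirst_word_cons, quiverBasis_inr, quiverBasis_inr,
    edgeIncl_mul_edgeIncl, map_zero, zero_mul]

variable {m : ℕ} (c : Fin (m + 1) → E)

/-- The basis of the cyclic bar complex. -/
def cyclicBarBasis : Basis (∀ j, BlockIndex t ιA ιM (c j)) k (CyclicBar k t A M c) :=
  Basis.piTensorProduct fun j => blockBasis bA bM (c j)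

theorem cyclicBarBasis_apply (b : ∀ j, BlockIndex t ιA ιM (c j)) :
    cyclicBarBasis bA bM c b = PiTensorProduct.tprod k fun j => blockBasis bA bM (c j) (b j) := by
  rw [cyclicBarBasis, Basis.piTensorProduct_apply]

variable (s) in
/-- The elements of the cyclic bar complex, as combinations of words. -/
def cyclicWords : CyclicBar k t A M c →ₗ[k] FreeAlgebra k (Letter ιA ιM) :=
  PiTensorProduct.lift ((MultilinearMap.mkPiAlgebraFin k (m + 1)
    (FreeAlgebra k (Letter ιA ιM))).compLinearMap fun j => blockWord s bA bM (c j))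

theorem cyclicWords_tprod (y : ∀ j, Block k t A M (c j)) :
    cyclicWords s bA bM c (PiTensorProduct.tprod k y) =
      (List.ofFn fun j => blockWord s bA bM (c j) (y j)).prod := by
  rw [cyclicWords, PiTensorProduct.lift.tprod]
  rfl

variable {c} in
/-- The word of a basis element of the cyclic bar complex. -/
def cyclicLetters (b : ∀ j, BlockIndex t ιA ιM (c j)) : List (Letter ιA ιM) :=
  (List.ofFn fun j => blockLetters (c j) (b j)).flatten

theorem cyclicWords_basis (b : ∀ j, BlockIndex t ιA ιM (c j)) :
    cyclicWords s bA bM c (cyclicBarBasis bA bM c b) = word k (cyclicLetters b) := by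
  rw [cyclicBarBasis_apply, cyclicWords_tprod, cyclicLetters, word_flatten_ofFn]
  simp only [blockWord_basis]

variable {c} (hc : IsPointedCycle s t c)

theorem glue_tprod (j : Fin (m + 1)) (y : ∀ j, Block k t A M (c j)) {z : Block k t A M (c j)}
    {a : A (t (c j))} (h : BarBlock.strip k (A (t (c j))) (M (c j)) (y j) = z ⊗ₜ a) :
    glue k t A M hc j (PiTensorProduct.tprod k y) = PiTensorProduct.tprod k fun i =>
      Function.update (β := fun i => Block k t A M (c i) →ₗ[k] Block k t A M (c i))
        (fun _ => LinearMap.id) (j + 1) (blockLeftAct k s t A M (hc j) a) i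
        (Function.update y j z i) := by
  rw [glue, LinearMap.comp_apply, extractAt, PiTensorProduct.lift.tprod]
  change TensorProduct.lift _ (TensorProduct.map _ LinearMap.id _) = _
  rw [h, TensorProduct.map_tmul, TensorProduct.lift.tmul]
  change PiTensorProduct.map (Function.update (fun _ => LinearMap.id) (j + 1) _)
    (PiTensorProduct.tprod k (Function.update y j z)) = _
  rw [PiTensorProduct.map_tprod]
  rfl

theorem glue_tprod_zero (j : Fin (m + 1)) (y : ∀ j, Block k t A M (c j))
    (h : BarBlock.strip k (A (t (c j))) (M (c j)) (y j) = 0) :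
    glue k t A M hc j (PiTensorProduct.tprod k y) = 0 := by
  rw [glue, LinearMap.comp_apply, extractAt, PiTensorProduct.lift.tprod]
  change TensorProduct.lift _ (TensorProduct.map _ LinearMap.id _) = _
  rw [h, map_zero, map_zero]

/-- The index `r` is kept apart from `j + 1`, so that it may appear as `j.succ` at an inner seam and
as `0` at the closing one. -/
theorem blockWord_update_self {j r : Fin (m + 1)} (hr : j + 1 = r) (a : A (t (c j)))
    (b : BlockIndex t ιA ιM (c r)) :
    blockWord s bA bM (c r)
      (Function.update (β := fun i => Block k t A M (c i) →ₗ[k] Block k t A M (c i))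
        (fun _ => LinearMap.id) (j + 1) (blockLeftAct k s t A M (hc j) a) r
        (blockBasis bA bM (c r) b)) =
      leftMulFirst ℬ (vertexIncl k s t A M (t (c j)) a) (word k (blockLetters (c r) b)) := by
  subst hr
  rw [Function.update_self, blockWord_leftAct, blockLetters, leftMulFirst_word_cons]

theorem cyclicWords_glue_castSucc (b : ∀ j, BlockIndex t ιA ιM (c j)) (j : Fin m) :
    cyclicWords s bA bM c (glue k t A M hc j.castSucc (cyclicBarBasis bA bM c b)) =
      (List.ofFn fun i =>
        if i < j.castSucc then word k (blockLetters (c i) (b i))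
        else if i = j.castSucc then word k (blockInit (c i) (b i))
        else if i = j.succ then leftMulFirst ℬ (ℬ (blockLast (c j.castSucc) (b j.castSucc)))
          (word k (blockLetters (c i) (b i)))
        else word k (blockLetters (c i) (b i))).prod := by
  have hne : j.succ ≠ j.castSucc := (Fin.castSucc_lt_succ).ne'
  have hj : j.castSucc + 1 = j.succ := Fin.coeSucc_eq_succ
  rw [cyclicBarBasis_apply]
  rcases h : b j.castSucc with ⟨n, i, a⟩
  rcases n with - | n
  · rw [glue_tprod_zero hc _ _ (by rw [h, blockBasis_apply, strip_zero]), map_zero]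
    refine (List.prod_eq_zero ?_).symm
    refine List.mem_ofFn.2 ⟨j.succ, ?_⟩
    rw [if_neg (Fin.castSucc_lt_succ).le.not_gt, if_neg hne, if_pos rfl, blockLast,
      leftMulFirst_edge]
  · rw [glue_tprod hc _ _ (z := blockBasis bA bM (c j.castSucc) ⟨n, i, fun l => a l.castSucc⟩)
      (a := bA _ (a (Fin.last n)))
      (by rw [h, blockBasis_apply, strip_succ, blockBasis_apply]), cyclicWords_tprod]
    congr 2
    funext r
    by_cases h1 : r = j.castSucc
    · subst h1
      rw [if_neg (lt_irrefl _), if_pos rfl, Function.update_of_ne (hj ▸ hne.symm),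
        Function.update_self, LinearMap.id_apply, blockWord_basis, h, blockInit]
    · rw [Function.update_of_ne h1]
      by_cases h2 : r = j.succ
      · subst h2
        rw [if_neg (Fin.castSucc_lt_succ).le.not_gt, if_neg hne, if_pos rfl,
          blockWord_update_self bA bM hc hj, blockLast, quiverBasis_inl]
      · rw [Function.update_of_ne (hj ▸ h2), LinearMap.id_apply, blockWord_basis, if_neg h1,
          if_neg h2, ite_self]

theorem leftMulFirst_blockLast_eq_zero (b : ∀ j, BlockIndex t ιA ιM (c j))
    (h : (b (Fin.last m)).1 = 0) :
    leftMulFirst ℬ (ℬ (blockLast (c (Fin.last m)) (b (Fin.last m))))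
        (word k ((List.ofFn fun i : Fin m => blockLetters (c i.castSucc) (b i.castSucc)).flatten ++
          blockInit (c (Fin.last m)) (b (Fin.last m)))) = 0 := by
  rcases h' : b (Fin.last m) with ⟨n, i, a⟩
  obtain rfl : n = 0 := by rw [h'] at h; exact h
  rw [blockInit, List.append_nil]
  rcases m with - | m
  · simp
  · rw [List.ofFn_succ, List.flatten_cons, word_append,
      leftMulFirst_word_mul ℬ _ (by simp [blockLetters]), blockLast, leftMulFirst_edge, zero_mul]

/-- The index `Fin.last m + 1` wraps around to `0`, so the last letter of the word is multiplied
into its first one, as in the last Hochschild face. -/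
theorem cyclicWords_glue_last (b : ∀ j, BlockIndex t ιA ιM (c j)) :
    cyclicWords s bA bM c (glue k t A M hc (Fin.last m) (cyclicBarBasis bA bM c b)) =
      leftMulFirst ℬ (ℬ (blockLast (c (Fin.last m)) (b (Fin.last m))))
        (word k ((List.ofFn fun i : Fin m => blockLetters (c i.castSucc) (b i.castSucc)).flatten ++
          blockInit (c (Fin.last m)) (b (Fin.last m)))) := by
  rcases h : b (Fin.last m) with ⟨n, i, a⟩
  rcases n with - | n
  · rw [← h, leftMulFirst_blockLast_eq_zero bA bM b (by rw [h]), cyclicBarBasis_apply,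
      glue_tprod_zero hc _ _ (by rw [h, blockBasis_apply, strip_zero]), map_zero]
  · rw [cyclicBarBasis_apply, glue_tprod hc _ _ (z := blockBasis bA bM (c (Fin.last m)) ⟨n, i, fun l => a l.castSucc⟩)
      (a := bA _ (a (Fin.last n)))
      (by rw [h, blockBasis_apply, strip_succ, blockBasis_apply]), cyclicWords_tprod,
      blockInit, blockLast, quiverBasis_inl]
    have h0 : Fin.last m + 1 = 0 := Fin.last_add_one m
    -- With a single block the letter is multiplied into the very block from which it was stripped,
    -- so both updates meet at one index.
    rcases m with - | m
    · rw [List.ofFn_succ, List.ofFn_zero, List.prod_singleton, List.ofFn_zero]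
      exact (congrArg _ (congrArg _ (Function.update_self ..))).trans
        (blockWord_update_self bA bM hc h0 _ _)
    · have h1 : (0 : Fin (m + 2)) ≠ Fin.last (m + 1) := Fin.last_pos.ne
      have h2 : (List.ofFn fun i : Fin (m + 1) =>
          blockLetters (c i.castSucc) (b i.castSucc)).flatten = blockLetters (c 0) (b 0) ++
          (List.ofFn fun i : Fin m => blockLetters (c i.succ.castSucc) (b i.succ.castSucc)).flatten
          := by rw [List.ofFn_succ, List.flatten_cons]; rfl
      rw [h2, List.ofFn_succ, List.prod_cons, Function.update_of_ne h1,
        blockWord_update_self bA bM hc h0, List.append_assoc, word_append,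
        leftMulFirst_word_mul ℬ _ (by simp [blockLetters])]
      congr 1
      rw [ofFn_eq_concat, List.prod_append, List.prod_singleton, word_append, word_flatten_ofFn]
      congr 1
      · congr 2
        funext r
        rw [Function.update_of_ne (h0 ▸ Fin.succ_ne_zero _), LinearMap.id_apply,
          Function.update_of_ne (by simp [Fin.ext_iff]; omega), blockWord_basis]
        rfl
      · rw [Function.update_of_ne (h0 ▸ Fin.succ_ne_zero _), LinearMap.id_apply]
        exact (congrArg _ (Function.update_self ..)).trans (blockWord_basis bA bM _ _)

theorem letterWeight_blockLast (e : E) (b : BlockIndex t ιA ιM e) :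
    letterWeight (blockLast e b) = if b.1 = 0 then 0 else 1 := by
  obtain ⟨n, i, a⟩ := b
  rcases n with - | n <;> simp [blockLast, letterWeight]

theorem prod_smul_prod_ofFn {R : Type*} [Ring R] [Algebra k R] {n : ℕ} (f : Fin n → k)
    (g : Fin n → R) : (∏ i, f i) • (List.ofFn g).prod = (List.ofFn fun i => f i • g i).prod := by
  have h := (MultilinearMap.mkPiAlgebraFin k n R).map_smul_univ f g
  simpa only [MultilinearMap.mkPiAlgebraFin_apply] using h.symm

theorem cyclicLetters_eq_concat (b : ∀ j, BlockIndex t ιA ιM (c j)) :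
    cyclicLetters b =
      ((List.ofFn fun i : Fin m => blockLetters (c i.castSucc) (b i.castSucc)).flatten ++
        blockInit (c (Fin.last m)) (b (Fin.last m))) ++
          [blockLast (c (Fin.last m)) (b (Fin.last m))] := by
  rw [cyclicLetters, ofFn_eq_concat, List.flatten_append, List.flatten_singleton,
    blockLetters_eq (c (Fin.last m)), List.append_assoc]

theorem wordDegree_cyclicLetters (b : ∀ j, BlockIndex t ιA ιM (c j)) :
    wordDegree letterWeight (cyclicLetters b) = ∑ j, (b j).1 := by
  rw [cyclicLetters, wordDegree, List.map_flatten, List.sum_flatten, List.map_map, List.map_ofFn,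
    List.sum_ofFn]
  exact Finset.sum_congr rfl fun j _ => wordDegree_blockLetters (c j) (b j)

/-- The bar differential is the Hochschild differential of words. -/
theorem cyclicWords_cyclicBarD (z : CyclicBar k t A M c) :
    cyclicWords s bA bM c (cyclicBarD k t A M hc z) =
      hoch ℬ letterWeight (cyclicWords s bA bM c z) := by
  refine LinearMap.congr_fun (f := cyclicWords s bA bM c ∘ₗ cyclicBarD k t A M hc)
    (g := hoch ℬ letterWeight ∘ₗ cyclicWords s bA bM c)
    ((cyclicBarBasis bA bM c).ext fun b => ?_) z
  have hsgn : ∀ j : Fin (m + 1), PiTensorProduct.map (fun i =>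
      if i ≤ j then BarBlock.sgn k (A (t (c i))) (M (c i)) else LinearMap.id)
        (cyclicBarBasis bA bM c b) =
      (∏ i, if i ≤ j then (-1 : k) ^ (b i).1 else 1) • cyclicBarBasis bA bM c b := fun j => by
    rw [cyclicBarBasis_apply, PiTensorProduct.map_tprod, ← MultilinearMap.map_smul_univ]
    congr 1
    funext i
    split_ifs
    · rw [sgn_basis]
    · rw [one_smul, LinearMap.id_apply]
  rw [LinearMap.comp_apply, LinearMap.comp_apply, cyclicWords_basis, cyclicLetters]
  simp only [cyclicBarD, LinearMap.sum_apply, LinearMap.add_apply, LinearMap.comp_apply, map_sum,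
    map_add, hsgn, map_smul, Finset.sum_add_distrib]
  rw [Fin.sum_univ_castSucc (fun j => _ • _)]
  simp only [cyclicWords_glue_castSucc bA bM hc b, cyclicWords_glue_last bA bM hc b]
  -- Splitting each block before its last letter separates `bar` into differentials inside blocks
  -- and inner seams. The closing seam is the remaining term of `hoch`.
  have hbar := bar_flatten_ofFn ℬ letterWeight (fun j => blockInit (c j) (b j))
    (fun j => blockLast (c j) (b j))
  simp only [← blockLetters_eq, wordDegree_blockLetters] at hbar
  rw [hoch, LinearMap.add_apply, hbar, ← add_assoc, LinearMap.comp_apply]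
  congr 1
  · congr 1
    · refine Finset.sum_congr rfl fun j _ => ?_
      rw [cyclicBarBasis_apply, PiTensorProduct.map_tprod, cyclicWords_tprod]
      congr 2
      funext i
      split_ifs with h1 h2
      · rw [sgn_basis, map_smul, blockWord_basis]
      · rw [blockWord_inner]
      · rw [LinearMap.id_apply, blockWord_basis]
    · refine Finset.sum_congr rfl fun j _ => ?_
      rw [prod_smul_prod_ofFn]
      congr 2
      funext i
      rcases lt_trichotomy i j.castSucc with h | h | h
      · rw [if_pos h.le, if_pos h, if_pos h]
      · rw [if_pos h.le, if_neg h.not_lt, if_neg h.not_lt, if_pos h, if_pos h]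
      · rw [if_neg h.not_ge, if_neg h.not_gt, if_neg h.not_gt, if_neg h.ne', if_neg h.ne',
          one_smul]
  · change _ = mulFirst ℬ letterWeight (rot k letterWeight (word k (cyclicLetters b)))
    have hdeg := wordDegree_cyclicLetters b
    rw [cyclicLetters_eq_concat, mulFirst_rot_concat]
    rw [cyclicLetters_eq_concat, wordDegree_append, wordDegree_cons, wordDegree_nil,
      letterWeight_blockLast, add_zero] at hdeg
    rw [letterWeight_blockLast]
    -- If the last block has no algebra letter, both sides vanish. Otherwise its last letter has
    -- weight one, and the exponent of the rotation plus one is the total number of algebra letters,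
    -- which is the sign in `cyclicBarD`.
    by_cases h : (b (Fin.last m)).1 = 0
    · rw [leftMulFirst_blockLast_eq_zero bA bM b h, smul_zero, smul_zero]
    · rw [if_neg h] at hdeg ⊢
      rw [mul_one, hdeg, ← Finset.prod_pow_eq_pow_sum]
      simp only [Fin.le_last, if_true]

end CyclicWords

/-! ### Rotation of words by blocks -/

section BlockRotation

set_option linter.unusedSectionVars false

variable {k : Type*} [Field k] {B : Type*} {R : Type*} [NonUnitalRing R] [Module k R]
  [IsScalarTower k R R] [SMulCommClass k R R] {β : Basis B k R} {p : B → ℕ}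

variable (p) in
/-- The word begins with a letter of weight zero. -/
def IsHeaded (w : List B) : Prop := ∃ x r, w = x :: r ∧ p x = 0

variable (p) in
/-- The word consists of a letter of weight zero, followed by letters of nonzero weight. -/
def IsBlock (w : List B) : Prop := ∃ x r, w = x :: r ∧ p x = 0 ∧ ∀ y ∈ r, p y ≠ 0

theorem IsBlock.isHeaded {v : List B} (h : IsBlock p v) : IsHeaded p v := by
  obtain ⟨x, r, h1, h2, -⟩ := h
  exact ⟨x, r, h1, h2⟩

theorem IsHeaded.append {u : List B} (h : IsHeaded p u) (v : List B) : IsHeaded p (u ++ v) := by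
  obtain ⟨x, r, rfl, h⟩ := h
  exact ⟨x, r ++ v, rfl, h⟩

theorem IsHeaded.ne_nil {u : List B} (h : IsHeaded p u) : u ≠ [] := by
  obtain ⟨x, r, rfl, h⟩ := h
  simp

/-- A headed word is a block or ends with a block. -/
theorem IsHeaded.exists_append {w : List B} (h : IsHeaded p w) :
    IsBlock p w ∨ ∃ u v, w = u ++ v ∧ IsHeaded p u ∧ IsBlock p v := by
  induction w using List.reverseRecOn with
  | nil => exact absurd rfl h.ne_nil
  | append_singleton w z ih =>
    rcases w with - | ⟨x, r⟩
    · obtain ⟨x, r, h1, h2⟩ := h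
      exact Or.inl ⟨x, r, h1, h2, by simp at h1; simp [h1.2]⟩
    · have hw : IsHeaded p (x :: r) := by
        obtain ⟨y, r', h1, h2⟩ := h
        simp only [List.cons_append, List.cons.injEq] at h1
        exact ⟨x, r, rfl, h1.1 ▸ h2⟩
      by_cases hz : p z = 0
      · exact Or.inr ⟨_, _, rfl, hw, z, [], rfl, hz, by simp⟩
      · have key : ∀ v, IsBlock p v → IsBlock p (v ++ [z]) := by
          rintro _ ⟨y, r, rfl, h1, h2⟩
          refine ⟨y, r ++ [z], rfl, h1, fun a ha => ?_⟩
          rcases List.mem_append.1 ha with ha | ha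
          · exact h2 a ha
          · rwa [List.mem_singleton.1 ha]
        rcases ih hw with h' | ⟨u, v, h1, h2, h3⟩
        · exact Or.inl (key _ h')
        · exact Or.inr ⟨u, v ++ [z], by rw [h1, List.append_assoc], h2, key _ h3⟩

variable (p) in
/-- The length of the last block of a word. -/
def lastBlockLength (w : List B) : ℕ := (w.reverse.takeWhile fun x => p x ≠ 0).length + 1

theorem lastBlockLength_append (u : List B) {v : List B} (hv : IsBlock p v) :
    lastBlockLength p (u ++ v) = v.length := by
  obtain ⟨x, r, rfl, h1, h2⟩ := hv
  rw [lastBlockLength, List.reverse_append, List.reverse_cons, List.append_assoc,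
    List.takeWhile_append_of_pos (by simpa using h2)]
  simp [h1]

variable (k p) in
/-- The rotation of a word that moves its last block to the front. -/
def blockRot : FreeAlgebra k B →ₗ[k] FreeAlgebra k B :=
  (wordBasis k B).constr k fun w => (rot k p ^ lastBlockLength p w) (word k w)

theorem blockRot_word (w : List B) :
    blockRot k p (word k w) = (rot k p ^ lastBlockLength p w) (word k w) := by
  rw [blockRot, ← wordBasis_apply, Basis.constr_basis, wordBasis_apply]

theorem blockRot_append (u : List B) {v : List B} (hv : IsBlock p v) :
    blockRot k p (word k (u ++ v)) =
      (-1 : k) ^ (wordDegree p u * wordDegree p v) • word k (v ++ u) := by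
  rw [blockRot_word, lastBlockLength_append u hv, rot_pow_append]

theorem blockRot_block {v : List B} (hv : IsBlock p v) :
    blockRot k p (word k v) = word k v := by
  have := blockRot_append (k := k) [] hv
  simpa using this

theorem cycNorm_blockRot (x : FreeAlgebra k B) : cycNorm k p (blockRot k p x) = cycNorm k p x := by
  refine LinearMap.congr_fun (f := cycNorm k p ∘ₗ blockRot k p) (word_ext k fun w => ?_) x
  rw [LinearMap.comp_apply, blockRot_word, cycNorm_rot_pow]

theorem blockRot_mem_headed {x : FreeAlgebra k B} (hx : x ∈ wordSpan k (IsHeaded p)) :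
    blockRot k p x ∈ wordSpan k (IsHeaded p) := by
  refine map_mem_of_wordSpan (fun w hw => ?_) hx
  rcases hw.exists_append with h | ⟨u, v, rfl, -, h⟩
  · rw [blockRot_block h]
    exact word_mem_wordSpan hw
  · rw [blockRot_append u h]
    exact Submodule.smul_mem _ _ (word_mem_wordSpan (h.isHeaded.append u))

/-- The condition `Even (wordDegree p w + a)` fixes the parity of the degree as that of `a`; the
sign requires no more, and it is what the differential respects. -/
theorem blockRot_mul {a d : ℕ} {U W : FreeAlgebra k B}
    (hU : U ∈ wordSpan k (fun w => Even (wordDegree p w + a)))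
    (hW : W ∈ wordSpan k (fun w => IsBlock p w ∧ Even (wordDegree p w + d))) :
    blockRot k p (U * W) = (-1 : k) ^ (a * d) • (W * U) := by
  refine eq_on_wordSpan (f := blockRot k p ∘ₗ LinearMap.mulRight k W)
    (g := (-1 : k) ^ (a * d) • LinearMap.mulLeft k W) (fun u hu => ?_) hU
  refine eq_on_wordSpan (f := blockRot k p ∘ₗ LinearMap.mulLeft k (word k u))
    (g := (-1 : k) ^ (a * d) • LinearMap.mulRight k (word k u)) (fun v hv => ?_) hW
  simp only [LinearMap.comp_apply, LinearMap.smul_apply, LinearMap.mulLeft_apply,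
    LinearMap.mulRight_apply]
  rw [← word_append, ← word_append, blockRot_append u hv.1]
  congr 1
  rw [neg_one_pow_congr]
  have h2 := hv.2
  simp only [Nat.even_add, Nat.even_mul] at hu h2 ⊢
  tauto

theorem IsGradedMul.leftMulFirst_mem (hβ : IsGradedMul β p) (a : B) {P Q : List B → Prop}
    (h : ∀ x z r, p z + 1 = p a + p x → P (x :: r) → Q (z :: r)) {w : List B} (hw : P w) :
    leftMulFirst β (β a) (word k w) ∈ wordSpan k Q := by
  rcases w with - | ⟨x, r⟩
  · simp
  · rw [leftMulFirst_word_cons]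
    have : Submodule.span k (β '' {z | p z + 1 = p a + p x}) ≤
        (wordSpan k Q).comap (LinearMap.mulRight k (word k r) ∘ₗ emb β) := by
      rw [Submodule.span_le]
      rintro _ ⟨z, hz, rfl⟩
      change emb β (β z) * word k r ∈ wordSpan k Q
      rw [emb_basis, ← word_cons]
      exact word_mem_wordSpan (h x z r hz hw)
    exact this (hβ a x)

/-- A product of two letters of weight zero would have weight `-1`. -/
theorem IsGradedMul.leftMulFirst_eq_zero (hβ : IsGradedMul β p) {a : B} (ha : p a = 0)
    {w : List B} (hw : IsHeaded p w) : leftMulFirst β (β a) (word k w) = 0 := by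
  have := hβ.leftMulFirst_mem a (P := IsHeaded p) (Q := fun _ => False) (fun x z r h1 h2 => by
    obtain ⟨y, r', h3, h4⟩ := h2
    rw [(List.cons.inj h3).1, h4, ha] at h1
    omega) hw
  simpa [wordSpan] using this

theorem IsGradedMul.bar_mem_even (hβ : IsGradedMul β p) (w : List B) :
    bar β p (word k w) ∈ wordSpan k (fun u => Even (wordDegree p u + (wordDegree p w + 1))) := by
  refine hβ.bar_mem_wordSpan hβ (P := fun u => wordDegree p u = wordDegree p w)
    (fun x y z r h1 h2 => ?_) (fun u x h => ?_) (fun u x h => ?_) (word_mem_wordSpan rfl)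
  · simp only [wordDegree_cons] at h2 ⊢
    rw [← h2]
    exact ⟨p x + p y + wordDegree p r, by omega⟩
  · simpa [add_comm] using h
  · simpa [add_comm] using h

/-- With weights at most one, the head of weight zero times a letter of weight one has weight zero
again, while products of two letters of nonzero weight keep nonzero weight. -/
theorem IsGradedMul.bar_block_mem (hβ : IsGradedMul β p) (hp : ∀ x, p x ≤ 1) {v : List B}
    (hv : IsBlock p v) : bar β p (word k v) ∈ wordSpan k (IsBlock p) := by
  obtain ⟨x, r, rfl, hx, hr⟩ := hv
  rw [word_cons, bar_letter_mul]
  refine Submodule.add_mem _ ?_ (Submodule.smul_mem _ _ ?_)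
  · rw [← word_cons]
    refine mulFirst_mem_wordSpan (C := fun x y z => p z + 1 = p x + p y) hβ
      (P := IsBlock p) (fun x y z r h1 h2 => ?_) (word_mem_wordSpan ⟨x, r, rfl, hx, hr⟩)
    obtain ⟨a, l, h3, h4, h5⟩ := h2
    obtain ⟨rfl, rfl⟩ := List.cons.inj h3
    have := hp y
    exact ⟨z, r, rfl, by omega, fun b hb => h5 b (List.mem_cons_of_mem _ hb)⟩
  · have h1 : bar β p (word k r) ∈ wordSpan k (fun w => ∀ y ∈ w, p y ≠ 0) := by
      refine hβ.bar_mem_wordSpan hβ (P := fun w => ∀ y ∈ w, p y ≠ 0)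
        (fun x y z r h1 h2 => ?_) (fun u x h => ?_) (fun u x h => ?_) (word_mem_wordSpan hr)
      · simp only [List.mem_cons, forall_eq_or_imp] at h2 ⊢
        exact ⟨by omega, h2.2.2⟩
      · simpa [or_comm] using h
      · simpa [or_comm] using h
    have h2 : FreeAlgebra.ι k x ∈ wordSpan k (fun w => w = [x]) := by
      have := word_mem_wordSpan (k := k) (P := fun w => w = [x]) (w := [x]) rfl
      simpa using this
    exact mul_mem_wordSpan (fun u w hu hw => ⟨x, w, by rw [hu]; rfl, hx, hw⟩) h2 h1

theorem IsGradedMul.bar_block_mem_even (hβ : IsGradedMul β p) (hp : ∀ x, p x ≤ 1) {v : List B}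
    (hv : IsBlock p v) : bar β p (word k v) ∈
      wordSpan k (fun u => IsBlock p u ∧ Even (wordDegree p u + (wordDegree p v + 1))) :=
  mem_wordSpan.2 fun w hw => ⟨mem_wordSpan.1 (hβ.bar_block_mem hp hv) w hw,
    mem_wordSpan.1 (hβ.bar_mem_even v) w hw⟩

/-- The Hochschild differential commutes with the rotation by blocks, for a word with at least two
blocks. -/
theorem IsGradedMul.hoch_blockRot_append (hβ : IsGradedMul β p) (hp : ∀ x, p x ≤ 1)
    {u v : List B} (hu : IsHeaded p u) (hv : IsBlock p v) :
    hoch β p (blockRot k p (word k (u ++ v))) = blockRot k p (hoch β p (word k (u ++ v))) := by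
  obtain ⟨u', x, rfl⟩ : ∃ u' x, u = u' ++ [x] :=
    ⟨_, _, (List.dropLast_append_getLast hu.ne_nil).symm⟩
  obtain ⟨v', y, rfl⟩ : ∃ v' y, v = v' ++ [y] :=
    ⟨_, _, (List.dropLast_append_getLast hv.isHeaded.ne_nil).symm⟩
  -- The Hochschild differential of two concatenated words: the differential of each, the seam
  -- between them, and the closing seam. The block rotation exchanges the first two and the last two
  -- of these, which the following four identities verify.
  have hoch_eq : ∀ (u' v' : List B) (x y : B), IsHeaded p (u' ++ [x]) →
      hoch β p (word k ((u' ++ [x]) ++ (v' ++ [y]))) =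
        bar β p (word k (u' ++ [x])) * word k (v' ++ [y]) +
        (-1 : k) ^ wordDegree p (u' ++ [x]) •
          (word k u' * leftMulFirst β (β x) (word k (v' ++ [y])) +
            word k (u' ++ [x]) * bar β p (word k (v' ++ [y]))) +
        (-1 : k) ^ (wordDegree p ((u' ++ [x]) ++ v') * p y + p y) •
          (leftMulFirst β (β y) (word k (u' ++ [x])) * word k v') := by
    intro u' v' x y h
    rw [hoch, LinearMap.add_apply, LinearMap.comp_apply, word_append k (u' ++ [x]),
      bar_concat_mul, ← word_append k (u' ++ [x]), ← List.append_assoc (u' ++ [x]),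
      mulFirst_rot_concat, word_append k (u' ++ [x]), leftMulFirst_word_mul β _ h.ne_nil]
  have h1 : blockRot k p (bar β p (word k (u' ++ [x])) * word k (v' ++ [y])) =
      (-1 : k) ^ ((wordDegree p (u' ++ [x]) + 1) * wordDegree p (v' ++ [y])) •
        (word k (v' ++ [y]) * bar β p (word k (u' ++ [x]))) :=
    blockRot_mul (hβ.bar_mem_even _) (word_mem_wordSpan ⟨hv, ⟨_, rfl⟩⟩)
  have h2 : blockRot k p (word k (u' ++ [x]) * bar β p (word k (v' ++ [y]))) =
      (-1 : k) ^ (wordDegree p (u' ++ [x]) * (wordDegree p (v' ++ [y]) + 1)) •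
        (bar β p (word k (v' ++ [y])) * word k (u' ++ [x])) :=
    blockRot_mul (word_mem_wordSpan ⟨_, rfl⟩) (hβ.bar_block_mem_even hp hv)
  have h3 : (-1 : k) ^ wordDegree p (u' ++ [x]) •
      blockRot k p (word k u' * leftMulFirst β (β x) (word k (v' ++ [y]))) =
      (-1 : k) ^ (wordDegree p (u' ++ [x]) * wordDegree p (v' ++ [y]) +
        (wordDegree p ((v' ++ [y]) ++ u') * p x + p x)) •
        (leftMulFirst β (β x) (word k (v' ++ [y])) * word k u') := by
    -- A weight-zero letter multiplied into a headed word gives zero, so only weight one matters.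
    rcases Nat.le_one_iff_eq_zero_or_eq_one.1 (hp x) with hx | hx
    · rw [hβ.leftMulFirst_eq_zero hx hv.isHeaded, mul_zero, zero_mul, map_zero, smul_zero,
        smul_zero]
    · have hl : leftMulFirst β (β x) (word k (v' ++ [y])) ∈ wordSpan k (fun w => IsBlock p w ∧
          Even (wordDegree p w + wordDegree p (v' ++ [y]))) := by
        refine hβ.leftMulFirst_mem x (P := fun w => IsBlock p w ∧
          wordDegree p w = wordDegree p (v' ++ [y])) (fun a z r h1 h2 => ?_) ⟨hv, rfl⟩
        obtain ⟨⟨b, l, h3, h4, h5⟩, h6⟩ := h2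
        obtain ⟨rfl, rfl⟩ := List.cons.inj h3
        refine ⟨⟨z, r, rfl, by omega, h5⟩, ?_⟩
        rw [← h6, wordDegree_cons, wordDegree_cons]
        exact ⟨wordDegree p r, by omega⟩
      rw [blockRot_mul (a := wordDegree p u') (word_mem_wordSpan ⟨_, rfl⟩) hl, smul_smul,
        ← pow_add]
      congr 1
      rw [neg_one_pow_congr]
      simp only [wordDegree_append, wordDegree_cons, wordDegree_nil, hx, Nat.even_add,
        Nat.even_mul]
      grind
  have h4 : (-1 : k) ^ (wordDegree p ((u' ++ [x]) ++ v') * p y + p y) •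
      blockRot k p (leftMulFirst β (β y) (word k (u' ++ [x])) * word k v') =
      (-1 : k) ^ (wordDegree p (u' ++ [x]) * wordDegree p (v' ++ [y]) +
        wordDegree p (v' ++ [y])) •
        (word k v' * leftMulFirst β (β y) (word k (u' ++ [x]))) := by
    rcases Nat.le_one_iff_eq_zero_or_eq_one.1 (hp y) with hy | hy
    · rw [hβ.leftMulFirst_eq_zero hy hu, mul_zero, zero_mul, map_zero, smul_zero, smul_zero]
    · have hl : leftMulFirst β (β y) (word k (u' ++ [x])) ∈ wordSpan k (fun w =>
          Even (wordDegree p w + wordDegree p (u' ++ [x]))) := by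
        refine hβ.leftMulFirst_mem y (P := fun w =>
          wordDegree p w = wordDegree p (u' ++ [x])) (fun a z r h1 h2 => ?_) rfl
        rw [← h2, wordDegree_cons, wordDegree_cons]
        exact ⟨p a + wordDegree p r, by omega⟩
      -- As `y` has weight one it is not the head of its block, so removing it leaves a block.
      have hv' : IsBlock p v' := by
        obtain ⟨b, l, h3, h4, h5⟩ := hv
        rcases v' with - | ⟨a, v'⟩
        · obtain ⟨rfl, -⟩ := List.cons.inj h3
          omega
        · obtain ⟨rfl, rfl⟩ := List.cons.inj h3
          exact ⟨a, v', rfl, h4, fun z hz => h5 z (List.mem_append_left _ hz)⟩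
      rw [blockRot_mul (d := wordDegree p v') hl (word_mem_wordSpan ⟨hv', ⟨_, rfl⟩⟩), smul_smul,
        ← pow_add]
      congr 1
      rw [neg_one_pow_congr]
      simp only [wordDegree_append, wordDegree_cons, wordDegree_nil, hy, Nat.even_add,
        Nat.even_mul]
      grind
  rw [blockRot_append _ hv, map_smul, hoch_eq _ _ _ _ hu, hoch_eq _ _ _ _ hv.isHeaded]
  simp only [map_add, map_smul, smul_add]
  rw [h1, h2, h3, h4]
  simp only [smul_smul, ← pow_add]
  have e1 : (-1 : k) ^ (wordDegree p (u' ++ [x]) + wordDegree p (u' ++ [x]) *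
      (wordDegree p (v' ++ [y]) + 1)) =
      (-1 : k) ^ (wordDegree p (u' ++ [x]) * wordDegree p (v' ++ [y])) := by
    rw [neg_one_pow_congr]
    simp only [Nat.even_add, Nat.even_mul]
    grind
  have e2 : (-1 : k) ^ ((wordDegree p (u' ++ [x]) + 1) * wordDegree p (v' ++ [y])) =
      (-1 : k) ^ (wordDegree p (u' ++ [x]) * wordDegree p (v' ++ [y]) +
        wordDegree p (v' ++ [y])) := by
    rw [add_one_mul]
  rw [e1, e2]
  abel

theorem IsGradedMul.hoch_blockRot (hβ : IsGradedMul β p) (hp : ∀ x, p x ≤ 1)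
    {x : FreeAlgebra k B} (hx : x ∈ wordSpan k (IsHeaded p)) :
    hoch β p (blockRot k p x) = blockRot k p (hoch β p x) := by
  refine eq_on_wordSpan (f := hoch β p ∘ₗ blockRot k p) (g := blockRot k p ∘ₗ hoch β p)
    (fun w hw => ?_) hx
  simp only [LinearMap.comp_apply]
  rcases hw.exists_append with h | ⟨u, v, rfl, hu, hv⟩
  · rw [blockRot_block h]
    -- The Hochschild differential of a single block consists of single blocks, which the block
    -- rotation fixes.
    refine (eq_on_wordSpan (P := IsBlock p) (g := LinearMap.id) (fun v hv => ?_) ?_).symm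
    · exact blockRot_block hv
    · change bar β p (word k w) + mulFirst β p (rot k p (word k w)) ∈ _
      refine Submodule.add_mem _ (hβ.bar_block_mem hp h) ?_
      obtain ⟨v', y, rfl⟩ : ∃ v' y, w = v' ++ [y] :=
        ⟨_, _, (List.dropLast_append_getLast hw.ne_nil).symm⟩
      rw [mulFirst_rot_concat]
      refine Submodule.smul_mem _ _ ?_
      rcases v' with - | ⟨a, r⟩
      · simp
      · obtain ⟨b, l, h3, h4, h5⟩ := h
        obtain ⟨rfl, rfl⟩ := List.cons.inj h3
        refine hβ.leftMulFirst_mem y (P := fun w => w = a :: r) (fun b z l h1 h2 => ?_) rfl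
        obtain ⟨rfl, rfl⟩ := List.cons.inj h2
        have := hp y
        exact ⟨z, l, rfl, by omega, fun c hc => h5 c (List.mem_append_left _ hc)⟩
  · exact hβ.hoch_blockRot_append hp hu hv

theorem IsGradedMul.hoch_blockRot_pow (hβ : IsGradedMul β p) (hp : ∀ x, p x ≤ 1)
    {x : FreeAlgebra k B} (hx : x ∈ wordSpan k (IsHeaded p)) (i : ℕ) :
    hoch β p ((blockRot k p ^ i) x) = (blockRot k p ^ i) (hoch β p x) := by
  induction i generalizing x with
  | zero => rfl
  | succ i ih =>
    rw [pow_succ, Module.End.mul_apply, Module.End.mul_apply, ih (blockRot_mem_headed hx),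
      hβ.hoch_blockRot hp hx]

/-- Fewer than `v.length` rotations, but at least one, produce a word beginning in the middle of the
block `v`, thus with a letter of nonzero weight. -/
theorem wordProj_rot_pow_block (u : List B) {v : List B} (hv : IsBlock p v)
    (h : IsHeaded p (u ++ v)) :
    ∑ i ∈ Finset.range v.length, wordProj k (IsHeaded p) ((rot k p ^ i) (word k (u ++ v))) =
      word k (u ++ v) := by
  obtain ⟨x, r, rfl, hx, hr⟩ := hv
  rw [List.length_cons, Finset.sum_range_succ', pow_zero, Module.End.one_apply,
    wordProj_word_of h, Finset.sum_eq_zero, zero_add]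
  intro i hi
  have hi := Finset.mem_range.1 hi
  have h1 : (r.drop (r.length - (i + 1))).length = i + 1 := by simp; omega
  have h2 := rot_pow_append k p (u ++ x :: r.take (r.length - (i + 1)))
    (r.drop (r.length - (i + 1)))
  rw [h1, List.append_assoc, List.cons_append, List.take_append_drop] at h2
  rw [h2, map_smul, wordProj_word_of_not, smul_zero]
  rintro ⟨y, l, h3, h4⟩
  have h5 : r.drop (r.length - (i + 1)) ≠ [] := by
    intro h; rw [h] at h1; simp at h1
  obtain ⟨z, l', h6⟩ := List.exists_cons_of_ne_nil h5
  rw [h6, List.cons_append] at h3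
  refine hr z (List.mem_of_mem_drop (i := r.length - (i + 1)) (by rw [h6]; simp)) ?_
  rw [(List.cons.inj h3).1, h4]

/-- Take off the blocks from the right. The rotations that carry the last block to the front
contribute one headed word, and all of them together are one block rotation. -/
theorem wordProj_rot_pow_flatten (xs ys : List (List B)) (h : ∀ v ∈ xs ++ ys, IsBlock p v) :
    ∑ i ∈ Finset.range ys.flatten.length,
      wordProj k (IsHeaded p) ((rot k p ^ i) (word k (xs ++ ys).flatten)) =
      ∑ j ∈ Finset.range ys.length, (blockRot k p ^ j) (word k (xs ++ ys).flatten) := by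
  induction ys using List.reverseRecOn generalizing xs with
  | nil => simp
  | append_singleton ys v ih =>
    have hv : IsBlock p v := h v (by simp)
    have hw : IsHeaded p ((xs ++ ys).flatten ++ v) := by
      rcases hL : xs ++ ys with - | ⟨a, L⟩
      · exact hv.isHeaded
      · rw [List.flatten_cons, List.append_assoc]
        exact (h a (by rw [← List.append_assoc, hL]; simp)).isHeaded.append _
    have e : (xs ++ (ys ++ [v])).flatten = (xs ++ ys).flatten ++ v := by simp
    have e' : v ++ (xs ++ ys).flatten = ((v :: xs) ++ ys).flatten := by simp
    have hl : (ys ++ [v]).flatten.length = v.length + ys.flatten.length := by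
      simp [add_comm]
    rw [e, hl, Finset.sum_range_add, wordProj_rot_pow_block _ hv hw, List.length_append,
      List.length_singleton, Finset.sum_range_succ', pow_zero, Module.End.one_apply, add_comm]
    congr 1
    simp only [pow_succ, add_comm v.length, pow_add, Module.End.mul_apply, rot_pow_append,
      blockRot_append _ hv, map_smul, ← Finset.smul_sum, e']
    rw [ih (v :: xs) (fun a ha => h a (by simp at ha ⊢; tauto))]

theorem wordProj_cycNorm_flatten (L : List (List B)) (h : ∀ v ∈ L, IsBlock p v) :
    wordProj k (IsHeaded p) (cycNorm k p (word k L.flatten)) =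
      ∑ j ∈ Finset.range L.length, (blockRot k p ^ j) (word k L.flatten) := by
  rw [cycNorm_of_mem k p (word_mem_wordSpan rfl), map_sum]
  exact wordProj_rot_pow_flatten [] L h

end BlockRotation

/-! ### The words of the cyclic bar complex -/

section CyclicLetters

set_option linter.unusedSectionVars false

variable {V E : Type*} {s t : E → V} {ιA : V → Type*} {ιM : E → Type*}

theorem letterWeight_le_one (x : Letter ιA ιM) : letterWeight x ≤ 1 := by
  rcases x with x | x <;> simp [letterWeight]

theorem isBlock_blockLetters (e : E) (b : BlockIndex t ιA ιM e) :
    IsBlock letterWeight (blockLetters e b) :=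
  ⟨_, _, rfl, rfl, fun y hy => by
    obtain ⟨a, -, rfl⟩ := List.mem_map.1 hy
    simp [vertexLetter, letterWeight]⟩

theorem edges_blockLetters (e : E) (b : BlockIndex t ιA ιM e) : edges (blockLetters e b) = [e] := by
  rw [blockLetters, edges_cons, edges, List.flatMap_eq_nil_iff.2]
  · rfl
  · intro x hx
    obtain ⟨a, -, rfl⟩ := List.mem_map.1 hx
    rfl

variable (t ιA ιM) in
/-- The word of a list of basis elements of blocks. -/
def blocksWord (L : List (Σ e, BlockIndex t ιA ιM e)) : List (Letter ιA ιM) :=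
  (L.map fun x => blockLetters x.1 x.2).flatten

@[simp] theorem blocksWord_nil : blocksWord t ιA ιM [] = [] := rfl

theorem blocksWord_cons (x : Σ e, BlockIndex t ιA ιM e) (L : List (Σ e, BlockIndex t ιA ιM e)) :
    blocksWord t ιA ιM (x :: L) = blockLetters x.1 x.2 ++ blocksWord t ιA ιM L := by
  simp [blocksWord]

theorem blocksWord_append (L L' : List (Σ e, BlockIndex t ιA ιM e)) :
    blocksWord t ιA ιM (L ++ L') = blocksWord t ιA ιM L ++ blocksWord t ιA ιM L' := by
  simp [blocksWord]

theorem blocksWord_ofFn {m : ℕ} {c : Fin (m + 1) → E} (b : ∀ j, BlockIndex t ιA ιM (c j)) :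
    blocksWord t ιA ιM (List.ofFn fun j => ⟨c j, b j⟩) = cyclicLetters b := by
  rw [blocksWord, List.map_ofFn]
  rfl

theorem edges_blocksWord (L : List (Σ e, BlockIndex t ιA ιM e)) :
    edges (blocksWord t ιA ιM L) = L.map Sigma.fst := by
  induction L with
  | nil => rfl
  | cons x L ih => rw [blocksWord_cons, edges_append, edges_blockLetters, ih]; rfl

theorem blocksWord_eq_nil_or_isHeaded (L : List (Σ e, BlockIndex t ιA ιM e)) :
    blocksWord t ιA ιM L = [] ∨ IsHeaded letterWeight (blocksWord t ιA ιM L) := by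
  rcases L with - | ⟨x, L⟩
  · exact Or.inl rfl
  · rw [blocksWord_cons]
    exact Or.inr ((isBlock_blockLetters _ _).isHeaded.append _)

/-- The head letter determines the edge and its basis index; the following maximal run of letters of
nonzero weight determines the tensor factors. -/
theorem blockLetters_append_inj {x x' : Σ e, BlockIndex t ιA ιM e} {u u' : List (Letter ιA ιM)}
    (hu : u = [] ∨ IsHeaded letterWeight u) (hu' : u' = [] ∨ IsHeaded letterWeight u')
    (h : blockLetters x.1 x.2 ++ u = blockLetters x'.1 x'.2 ++ u') : x = x' ∧ u = u' := by
  have key : ∀ (v : V) (l : List (ιA v)) (u : List (Letter ιA ιM)),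
      (u = [] ∨ IsHeaded letterWeight u) →
      (l.map (vertexLetter ιA ιM v) ++ u).takeWhile (fun x => letterWeight x ≠ 0) =
        l.map (vertexLetter ιA ιM v) := by
    intro v l u hu
    rw [List.takeWhile_append_of_pos (by simp [vertexLetter, letterWeight])]
    rcases hu with rfl | ⟨y, r, rfl, hy⟩
    · simp
    · simp [hy]
  obtain ⟨e, n, i, a⟩ := x
  obtain ⟨e', n', i', a'⟩ := x'
  obtain ⟨h1, h2⟩ := List.cons.inj h
  obtain ⟨rfl, h1⟩ := Sigma.mk.inj_iff.1 (Sum.inr.inj h1)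
  obtain rfl := eq_of_heq h1
  change (List.ofFn a).map (vertexLetter ιA ιM (t e)) ++ u =
    (List.ofFn a').map (vertexLetter ιA ιM (t e)) ++ u' at h2
  have h3 := congrArg (List.takeWhile fun x => letterWeight x ≠ 0) h2
  rw [key _ _ _ hu, key _ _ _ hu'] at h3
  have h4 : Function.Injective (vertexLetter ιA ιM (t e)) := fun a b hab => by
    simpa [vertexLetter] using hab
  have h5 := List.ofFn_inj'.1 (List.map_injective_iff.2 h4 h3)
  obtain ⟨rfl, h5⟩ := Sigma.mk.inj_iff.1 h5
  obtain rfl := eq_of_heq h5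
  exact ⟨rfl, List.append_cancel_left h2⟩

theorem blocksWord_injective : Function.Injective (blocksWord t ιA ιM) := by
  intro L L' h
  induction L generalizing L' with
  | nil =>
    rcases L' with - | ⟨x', L'⟩
    · rfl
    · rw [blocksWord_cons] at h
      simp [blockLetters] at h
  | cons x L ih =>
    rcases L' with - | ⟨x', L'⟩
    · rw [blocksWord_cons] at h
      simp [blockLetters] at h
    · rw [blocksWord_cons, blocksWord_cons] at h
      obtain ⟨rfl, h'⟩ := blockLetters_append_inj (blocksWord_eq_nil_or_isHeaded L)
        (blocksWord_eq_nil_or_isHeaded L') h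
      rw [ih h']

theorem cyclicLetters_injective {m : ℕ} {c : Fin (m + 1) → E} :
    Function.Injective (cyclicLetters : (∀ j, BlockIndex t ιA ιM (c j)) → _) := by
  intro b b' h
  rw [← blocksWord_ofFn, ← blocksWord_ofFn] at h
  funext j
  have := congrFun (List.ofFn_injective (blocksWord_injective h)) j
  exact eq_of_heq (Sigma.mk.inj_iff.1 this).2

theorem edges_cyclicLetters {m : ℕ} {c : Fin (m + 1) → E} (b : ∀ j, BlockIndex t ιA ιM (c j)) :
    edges (cyclicLetters b) = List.ofFn c := by
  rw [← blocksWord_ofFn, edges_blocksWord, List.map_ofFn]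
  rfl

theorem isHeaded_cyclicLetters {m : ℕ} {c : Fin (m + 1) → E}
    (b : ∀ j, BlockIndex t ιA ιM (c j)) : IsHeaded letterWeight (cyclicLetters b) := by
  rw [cyclicLetters, List.ofFn_succ, List.flatten_cons]
  exact (isBlock_blockLetters _ _).isHeaded.append _

theorem breaks_blockLetters_append (e : E) (b : BlockIndex t ιA ιM e) (x : Letter ιA ιM)
    (r : List (Letter ιA ιM)) :
    breaks s t (blockLetters e b ++ x :: r) =
      breakAt (t e) (letterSrc s x) + breaks s t (x :: r) := by
  have key : ∀ (l : List (ιA (t e))) (y : Letter ιA ιM), letterTgt t y = t e →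
      breaks s t (y :: (l.map (vertexLetter ιA ιM (t e)) ++ x :: r)) =
        breakAt (t e) (letterSrc s x) + breaks s t (x :: r) := by
    intro l
    induction l with
    | nil => intro y hy; simp [breaks, hy]
    | cons a l ih =>
      intro y hy
      rw [List.map_cons, List.cons_append, breaks, ih _ rfl, hy]
      simp [vertexLetter, letterSrc, breakAt]
  exact key _ _ rfl

theorem breaks_blocksWord {L : List (Σ e, BlockIndex t ιA ιM e)} {z : Letter ιA ιM}
    (h : (L.map Sigma.fst).IsChain (fun e e' => t e = s e'))
    (hz : ∀ e ∈ (L.map Sigma.fst).getLast?, t e = letterSrc s z) :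
    breaks s t (blocksWord t ιA ιM L ++ [z]) = 0 := by
  induction L with
  | nil => rfl
  | cons x L ih =>
    rcases L with - | ⟨y, L⟩
    · rw [blocksWord_cons, blocksWord_nil, List.append_nil, breaks_blockLetters_append,
        breakAt_eq_zero.2 (hz x.1 rfl)]
      rfl
    · have h' := h
      rw [List.map_cons, List.map_cons, List.isChain_cons_cons] at h'
      have ih' := ih h'.2 (by simpa using hz)
      have : blocksWord t ιA ιM (y :: L) ++ [z] = .inr ⟨y.1, y.2.2.1⟩ ::
          ((List.ofFn y.2.2.2).map (vertexLetter ιA ιM (t y.1)) ++ blocksWord t ιA ιM L ++ [z]) := by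
        rw [blocksWord_cons, blockLetters]
        simp
      rw [this] at ih'
      rw [blocksWord_cons, List.append_assoc, this, breaks_blockLetters_append, ih']
      exact breakAt_eq_zero.2 h'.1

theorem cycBreaks_cyclicLetters {m : ℕ} {c : Fin (m + 1) → E} (hc : IsPointedCycle s t c)
    (b : ∀ j, BlockIndex t ιA ιM (c j)) : cycBreaks s t (cyclicLetters b) = 0 := by
  obtain ⟨r, hr⟩ : ∃ r, cyclicLetters b = .inr ⟨c 0, (b 0).2.1⟩ :: r := by
    rw [cyclicLetters, List.ofFn_succ, List.flatten_cons]
    exact ⟨_, rfl⟩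
  rw [hr, cycBreaks, ← List.cons_append, ← hr, ← blocksWord_ofFn]
  apply breaks_blocksWord
  · rw [List.map_ofFn, List.isChain_iff_getElem]
    intro i hi
    have hi' : i < m := by simpa using hi
    have := hc (Fin.castSucc ⟨i, hi'⟩)
    rw [Fin.coeSucc_eq_succ] at this
    rw [List.getElem_ofFn, List.getElem_ofFn]
    exact this
  · rw [List.map_ofFn, List.getLast?_eq_getElem?]
    intro e he
    have h0 := hc (Fin.last m)
    rw [Fin.last_add_one] at h0
    simp [-List.ofFn_succ] at he
    rw [← he]
    exact h0

/-- Parse the word from the right: an edge letter opens a new block, and a vertex letter extends the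
block before it. -/
theorem exists_blocksWord {w : List (Letter ιA ιM)} {z : Letter ιA ιM}
    (hw : IsHeaded letterWeight w) (h : breaks s t (w ++ [z]) = 0) :
    ∃ L, blocksWord t ιA ιM L = w := by
  induction w using List.reverseRecOn generalizing z with
  | nil => exact absurd rfl hw.ne_nil
  | append_singleton w x ih =>
    rw [List.append_assoc, List.singleton_append, breaks_append_cons, Nat.add_eq_zero_iff] at h
    rcases w.eq_nil_or_concat with rfl | ⟨w', y, hy⟩
    · obtain ⟨x', r, h1, h2⟩ := hw
      obtain ⟨rfl, -⟩ := List.cons.inj h1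
      rcases x with x | ⟨e, i⟩
      · simp [letterWeight] at h2
      · exact ⟨[⟨e, 0, i, Fin.elim0⟩], by simp [blocksWord, blockLetters]⟩
    · rw [List.concat_eq_append] at hy
      have hw' : IsHeaded letterWeight w := by
        obtain ⟨a, r, h1, h2⟩ := hw
        rcases w with - | ⟨a', w⟩
        · simp at hy
        · exact ⟨a', w, rfl, (List.cons.inj h1).1 ▸ h2⟩
      obtain ⟨L, rfl⟩ := ih hw' h.1
      rcases x with ⟨v, a⟩ | ⟨e, i⟩
      · rcases L.eq_nil_or_concat with rfl | ⟨L', ⟨e, n, i, f⟩, hL⟩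
        · simp at hy
        · rw [List.concat_eq_append] at hL
          subst hL
          rw [blocksWord_append, blocksWord_cons, blocksWord_nil, List.append_nil,
            blockLetters_eq, ← List.append_assoc, List.append_assoc _ [_],
            List.singleton_append, breaks_append_cons] at h
          -- The absence of a break places the vertex letter at the target of the edge of the
          -- preceding block.
          have hv : t e = v := by
            have h2 := (Nat.add_eq_zero_iff.1 h.1).2
            rw [breaks, Nat.add_eq_zero_iff, breakAt_eq_zero] at h2
            rw [← show letterSrc s (Sum.inl ⟨v, a⟩ : Letter ιA ιM) = v from rfl, ← h2.1]
            rcases n with - | n <;> rfl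
          subst hv
          refine ⟨L' ++ [⟨e, n + 1, i, Fin.snoc (α := fun _ => ιA (t e)) f a⟩], ?_⟩
          rw [blocksWord_append, blocksWord_append, List.append_assoc, blocksWord_cons,
            blocksWord_cons, blocksWord_nil, List.append_nil, List.append_nil]
          congr 1
          rw [blockLetters, blockLetters, ofFn_eq_concat (Fin.snoc (α := fun _ => ιA (t e)) f a)]
          simp only [Fin.snoc_castSucc, Fin.snoc_last, List.map_append]
          rfl
      · exact ⟨L ++ [⟨e, 0, i, Fin.elim0⟩], by simp [blocksWord, blockLetters]⟩

/-- The words of the cyclic bar complex of a pointed cycle. -/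
theorem exists_cyclicLetters_iff {m : ℕ} {c : Fin (m + 1) → E} (hc : IsPointedCycle s t c)
    {w : List (Letter ιA ιM)} :
    (∃ b : ∀ j, BlockIndex t ιA ιM (c j), cyclicLetters b = w) ↔
      IsHeaded letterWeight w ∧ cycBreaks s t w = 0 ∧ edges w = List.ofFn c := by
  constructor
  · rintro ⟨b, rfl⟩
    exact ⟨isHeaded_cyclicLetters b, cycBreaks_cyclicLetters hc b, edges_cyclicLetters b⟩
  · rintro ⟨h1, h2, h3⟩
    obtain ⟨L, rfl⟩ : ∃ L, blocksWord t ιA ιM L = w := by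
      obtain ⟨x, r, rfl, -⟩ := id h1
      exact exists_blocksWord h1 h2
    rw [edges_blocksWord] at h3
    have hl : L.length = m + 1 := by simpa using congrArg List.length h3
    have h4 : ∀ j : Fin (m + 1), ∃ b : BlockIndex t ιA ιM (c j),
        L[(j : ℕ)]'(by omega) = ⟨c j, b⟩ := by
      intro j
      have h5 : (L[(j : ℕ)]'(by omega)).1 = c j := by
        have := List.getElem_of_eq h3 (i := j) (by simp; omega)
        rwa [List.getElem_map, List.getElem_ofFn] at this
      generalize L[(j : ℕ)]'(by omega) = x at h5
      obtain ⟨e, b⟩ := x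
      subst h5
      exact ⟨b, rfl⟩
    choose b hb using h4
    refine ⟨b, ?_⟩
    rw [← blocksWord_ofFn]
    congr 1
    refine List.ext_getElem (by simp [hl]) fun i h5 h6 => ?_
    rw [List.getElem_ofFn, ← hb]

end CyclicLetters

/-! ### Rotation of the cyclic bar complex -/

section Unword

set_option linter.unusedSectionVars false

variable {k V E : Type*} [Field k] {s t : E → V} {A : V → Type*} {M : E → Type*}
  [∀ v, Ring (A v)] [∀ e, AddCommGroup (M e)] [∀ v, Algebra k (A v)] [∀ e, Module k (M e)]
  [∀ e, Module (A (s e)) (M e)] [∀ e, Module (A (t e))ᵐᵒᵖ (M e)]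
  [∀ e, IsScalarTower k (A (s e)) (M e)] [∀ e, IsScalarTower k (A (t e))ᵐᵒᵖ (M e)]
  [∀ e, SMulCommClass (A (s e)) (A (t e))ᵐᵒᵖ (M e)]
  {ιA : V → Type*} {ιM : E → Type*} (bA : ∀ v, Basis (ιA v) k (A v))
  (bM : ∀ e, Basis (ιM e) k (M e)) {m : ℕ}

variable (t ιA ιM) in
/-- The words of the cyclic bar complex. -/
def IsCyclicBarWord (c : Fin (m + 1) → E) (w : List (Letter ιA ιM)) : Prop :=
  ∃ b : ∀ j, BlockIndex t ιA ιM (c j), cyclicLetters b = w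

open Classical in
variable (t) in
/-- The elements of the cyclic bar complex that are given by combinations of words. -/
def unword (c : Fin (m + 1) → E) : FreeAlgebra k (Letter ιA ιM) →ₗ[k] CyclicBar k t A M c :=
  (wordBasis k (Letter ιA ιM)).constr k fun w =>
    if h : IsCyclicBarWord t ιA ιM c w then cyclicBarBasis bA bM c h.choose else 0

theorem unword_cyclicLetters {c : Fin (m + 1) → E} (b : ∀ j, BlockIndex t ιA ιM (c j)) :
    unword t bA bM c (word k (cyclicLetters b)) = cyclicBarBasis bA bM c b := by
  have h : IsCyclicBarWord t ιA ιM c (cyclicLetters b) := ⟨b, rfl⟩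
  rw [← wordBasis_apply, unword, Basis.constr_basis, dif_pos h,
    cyclicLetters_injective h.choose_spec]

theorem unword_of_not {c : Fin (m + 1) → E} {w : List (Letter ιA ιM)}
    (h : ¬ IsCyclicBarWord t ιA ιM c w) :
    unword t bA bM c (word k w) = 0 := by
  rw [← wordBasis_apply, unword, Basis.constr_basis, dif_neg h]

theorem unword_cyclicWords {c : Fin (m + 1) → E} (z : CyclicBar k t A M c) :
    unword t bA bM c (cyclicWords s bA bM c z) = z := by
  refine LinearMap.congr_fun (f := unword t bA bM c ∘ₗ cyclicWords s bA bM c) (g := LinearMap.id)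
    ((cyclicBarBasis bA bM c).ext fun b => ?_) z
  rw [LinearMap.comp_apply, cyclicWords_basis, unword_cyclicLetters, LinearMap.id_apply]

theorem unword_cyclicWords_of_ne {c c' : Fin (m + 1) → E} (h : c ≠ c') (z : CyclicBar k t A M c) :
    unword t bA bM c' (cyclicWords s bA bM c z) = 0 := by
  refine LinearMap.congr_fun (f := unword t bA bM c' ∘ₗ cyclicWords s bA bM c) (g := 0)
    ((cyclicBarBasis bA bM c).ext fun b => ?_) z
  rw [LinearMap.comp_apply, cyclicWords_basis, unword_of_not, LinearMap.zero_apply]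
  rintro ⟨b', hb'⟩
  refine h (List.ofFn_injective ?_)
  rw [← edges_cyclicLetters b, ← edges_cyclicLetters b', hb']

theorem cyclicWords_unword (c : Fin (m + 1) → E) (x : FreeAlgebra k (Letter ιA ιM)) :
    cyclicWords s bA bM c (unword t bA bM c x) = wordProj k (IsCyclicBarWord t ιA ιM c) x := by
  refine LinearMap.congr_fun (f := cyclicWords s bA bM c ∘ₗ unword t bA bM c)
    (word_ext k fun w => ?_) x
  rw [LinearMap.comp_apply]
  by_cases h : IsCyclicBarWord t ιA ιM c w
  · rw [wordProj_word_of h]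
    obtain ⟨b, rfl⟩ := h
    rw [unword_cyclicLetters, cyclicWords_basis]
  · rw [unword_of_not bA bM h, map_zero, wordProj_word_of_not h]

theorem blockBasis_mem_range (e : E) (b : BlockIndex t ιA ιM e) :
    blockBasis bA bM e b ∈ LinearMap.range (BarBlock.incl k (A (t e)) (M e) b.1) := by
  obtain ⟨n, i, a⟩ := b
  rw [blockBasis_apply]
  exact ⟨_, rfl⟩

theorem mem_span_blockBasis {e : E} {d : ℕ} {y : Block k t A M e}
    (hy : y ∈ LinearMap.range (BarBlock.incl k (A (t e)) (M e) d)) {b : BlockIndex t ιA ιM e}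
    (h : (blockBasis bA bM e).repr y b ≠ 0) : b.1 = d := by
  obtain ⟨x, rfl⟩ := hy
  obtain ⟨n, i, a⟩ := b
  by_contra hn
  refine h ?_
  have h1 : BarBlock.incl k (A (t e)) (M e) d x n = 0 :=
    DirectSum.of_eq_of_ne (β := fun n => M e ⊗[k] (⨂[k]^n (A (t e)))) d n x hn
  change ((bM e).tensorProduct (Basis.piTensorProduct fun _ : Fin n => bA (t e))).repr
    (BarBlock.incl k (A (t e)) (M e) d x n) (i, a) = 0
  rw [h1, map_zero, Finsupp.zero_apply]

theorem cyclicBarDegree_eq_span (c : Fin (m + 1) → E) (n : ℤ) :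
    cyclicBarDegree k t A M c n =
      Submodule.span k (cyclicBarBasis bA bM c '' {b | ((∑ j, (b j).1 : ℕ) : ℤ) = n}) := by
  refine le_antisymm (Submodule.span_le.2 ?_) (Submodule.span_le.2 ?_)
  · rintro _ ⟨y, d, hy, hd, rfl⟩
    rw [SetLike.mem_coe, Basis.mem_span_image]
    intro b hb
    have hb' := Finsupp.mem_support_iff.1 hb
    rw [cyclicBarBasis, Basis.piTensorProduct_repr_tprod_apply] at hb'
    have h1 : ∀ j, (b j).1 = d j := fun j =>
      mem_span_blockBasis bA bM (hy j) (Finset.prod_ne_zero_iff.1 hb' j (Finset.mem_univ j))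
    simp only [Set.mem_ofPred_eq, h1, hd]
  · rintro _ ⟨b, hb, rfl⟩
    exact Submodule.subset_span ⟨_, fun j => (b j).1,
      fun j => blockBasis_mem_range bA bM (c j) (b j), hb, cyclicBarBasis_apply bA bM c b⟩

theorem cyclicWords_mem {c : Fin (m + 1) → E} {n : ℤ} {z : CyclicBar k t A M c}
    (hz : z ∈ cyclicBarDegree k t A M c n) : cyclicWords s bA bM c z ∈
      wordSpan k (fun w => IsCyclicBarWord t ιA ιM c w ∧ (wordDegree letterWeight w : ℤ) = n) := by
  rw [cyclicBarDegree_eq_span bA bM] at hz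
  have : Submodule.span k (cyclicBarBasis bA bM c '' {b | ((∑ j, (b j).1 : ℕ) : ℤ) = n}) ≤
      (wordSpan k (fun w => IsCyclicBarWord t ιA ιM c w ∧
        (wordDegree letterWeight w : ℤ) = n)).comap (cyclicWords (t := t) s bA bM c) := by
    rw [Submodule.span_le]
    rintro _ ⟨b, hb, rfl⟩
    change cyclicWords s bA bM c (cyclicBarBasis bA bM c b) ∈ wordSpan k _
    rw [cyclicWords_basis]
    exact word_mem_wordSpan ⟨⟨b, rfl⟩, by rw [wordDegree_cyclicLetters]; exact hb⟩
  exact this hz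

theorem cyclicWords_mem_cyclicBarWord {c : Fin (m + 1) → E} (z : CyclicBar k t A M c) :
    cyclicWords s bA bM c z ∈ wordSpan k (IsCyclicBarWord t ιA ιM c) := by
  have := cyclicWords_unword (s := s) (t := t) bA bM c (cyclicWords s bA bM c z)
  rw [unword_cyclicWords] at this
  rw [this]
  exact wordProj_mem _ _

theorem unword_mem {c : Fin (m + 1) → E} {n : ℤ} {x : FreeAlgebra k (Letter ιA ιM)}
    (hx : x ∈ wordSpan k (fun w => (wordDegree letterWeight w : ℤ) = n)) :
    unword t bA bM c x ∈ cyclicBarDegree k t A M c n := by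
  have : wordSpan k (fun w => (wordDegree letterWeight w : ℤ) = n) ≤
      (cyclicBarDegree k t A M c n).comap (unword t bA bM c) := by
    rw [wordSpan, Submodule.span_le, cyclicBarDegree_eq_span bA bM]
    rintro _ ⟨w, hw, rfl⟩
    rw [SetLike.mem_coe, Submodule.mem_comap]
    by_cases h : IsCyclicBarWord t ιA ιM c w
    · obtain ⟨b, rfl⟩ := h
      rw [unword_cyclicLetters]
      refine Submodule.subset_span ⟨b, ?_, rfl⟩
      rw [Set.mem_ofPred_eq, wordDegree_cyclicLetters] at hw
      exact hw
    · rw [unword_of_not bA bM h]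
      exact Submodule.zero_mem _
  exact this hx

open Classical in
variable (s) in
/-- The elements of all the cyclic bar complexes, as combinations of words. -/
def totalWords (m : ℕ) : (⨁ c : Fin (m + 1) → E, CyclicBar k t A M c) →ₗ[k]
    FreeAlgebra k (Letter ιA ιM) :=
  DirectSum.toModule k _ _ fun c => cyclicWords s bA bM c

open Classical in
theorem totalWords_lof (c : Fin (m + 1) → E) (z : CyclicBar k t A M c) :
    totalWords s bA bM m (DirectSum.lof k _ _ c z) = cyclicWords s bA bM c z :=
  DirectSum.toModule_lof k c z

-- Both rotations move the last block to the front, with a sign given by the numbers of algebra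
-- letters. The comparison takes place on the sum over all `c`, since the rotation changes `c`.
open Classical in
theorem totalWords_blockRotate (X : ⨁ c : Fin (m + 1) → E, CyclicBar k t A M c) :
    totalWords s bA bM m (blockRotate k t A M m X) =
      blockRot k letterWeight (totalWords s bA bM m X) := by
  refine LinearMap.congr_fun (f := totalWords s bA bM m ∘ₗ blockRotate k t A M m)
    (g := blockRot k letterWeight ∘ₗ totalWords s bA bM m)
    (DirectSum.linearMap_ext k fun c => (cyclicBarBasis bA bM c).ext fun b => ?_) X
  simp only [LinearMap.comp_apply]
  have h1 : cyclicLetters b =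
      (List.ofFn fun i : Fin m => blockLetters (c i.castSucc) (b i.castSucc)).flatten ++
        blockLetters (c (Fin.last m)) (b (Fin.last m)) := by
    rw [cyclicLetters, ofFn_eq_concat, List.flatten_append, List.flatten_singleton]
  have h2 : cyclicLetters (c := c ∘ (finRotate (m + 1)).symm)
      (fun i => b ((finRotate (m + 1)).symm i)) =
      blockLetters (c (Fin.last m)) (b (Fin.last m)) ++
      (List.ofFn fun i : Fin m => blockLetters (c i.castSucc) (b i.castSucc)).flatten := by
    have := ofFn_comp_finRotate_symm (fun j => blockLetters (c j) (b j))
    rw [← List.flatten_cons, ← this]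
    rfl
  have h3 : wordDegree letterWeight
      (List.ofFn fun i : Fin m => blockLetters (c i.castSucc) (b i.castSucc)).flatten =
      ∑ i : Fin m, (b i.castSucc).1 := by
    rw [wordDegree, List.map_flatten, List.sum_flatten, List.map_map, List.map_ofFn,
      List.sum_ofFn]
    exact Finset.sum_congr rfl fun j _ => wordDegree_blockLetters (c j.castSucc) (b j.castSucc)
  rw [totalWords_lof, cyclicWords_basis, h1, blockRot_append _ (isBlock_blockLetters _ _), ← h2,
    h3, wordDegree_blockLetters, blockRotate, DirectSum.toModule_lof, LinearMap.comp_apply,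
    cyclicBarBasis_apply,
    koszulRotate_tprod _ _ _ (fun i => (b i).1) (fun i => even_basis bA bM (c i) (b i))
      (fun i => odd_basis bA bM (c i) (b i)), map_smul, map_smul, totalWords_lof]
  congr 1
  rw [← cyclicWords_basis (s := s) bA bM, cyclicBarBasis_apply]
  rfl

open Classical in
theorem unword_totalWords (c : Fin (m + 1) → E) (X : ⨁ c : Fin (m + 1) → E, CyclicBar k t A M c) :
    unword t bA bM c (totalWords s bA bM m X) = DirectSum.component k _ _ c X := by
  refine LinearMap.congr_fun (f := unword t bA bM c ∘ₗ totalWords s bA bM m)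
    (DirectSum.linearMap_ext k fun c' => LinearMap.ext fun z => ?_) X
  simp only [LinearMap.comp_apply]
  rw [totalWords_lof]
  by_cases h : c' = c
  · subst h
    rw [unword_cyclicWords, DirectSum.component.lof_self]
  · rw [unword_cyclicWords_of_ne bA bM h]
    exact (DirectSum.of_eq_of_ne _ _ _ (Ne.symm h)).symm

theorem blockRotation_eq (c : Fin (m + 1) → E) (r : ℕ) (z : CyclicBar k t A M c) :
    blockRotation k t A M c r z =
      unword t bA bM c ((blockRot k letterWeight ^ r) (cyclicWords s bA bM c z)) := by
  classical
  have h : ∀ X, totalWords s bA bM m ((blockRotate k t A M m ^ r) X) =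
      (blockRot k letterWeight ^ r) (totalWords s bA bM m X) := by
    induction r with
    | zero => intro X; rfl
    | succ r ih =>
      intro X
      rw [pow_succ, Module.End.mul_apply, ih, totalWords_blockRotate, pow_succ,
        Module.End.mul_apply]
  rw [← totalWords_lof, ← h, unword_totalWords, blockRotation, LinearMap.comp_apply,
    LinearMap.comp_apply]

theorem cyclicWords_blockRotation (c : Fin (m + 1) → E) (r : ℕ) (z : CyclicBar k t A M c) :
    cyclicWords s bA bM c (blockRotation k t A M c r z) =
      wordProj k (IsCyclicBarWord t ιA ιM c)
        ((blockRot k letterWeight ^ r) (cyclicWords s bA bM c z)) := by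
  rw [blockRotation_eq (s := s) bA bM, cyclicWords_unword]

end Unword

/-! ### The periods of a pointed cycle -/

section Periods

variable {V E : Type*} {s t : E → V} {m : ℕ} (c : Fin (m + 1) → E)

/-- Extended periodically to `ℕ`, the sequence turns rotations into translations, without case
distinctions at the wrap-around. -/
theorem rotate_ofFn_eq_iff (r : ℕ) : (List.ofFn c).rotate r = List.ofFn c ↔
    Function.Periodic (fun i : ℕ => c (Fin.ofNat (m + 1) i)) r := by
  constructor
  · intro h i
    have h1 : i % (m + 1) < (List.ofFn c).length := by
      rw [List.length_ofFn]; exact Nat.mod_lt _ (Nat.succ_pos m)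
    have h2 := List.getElem_of_eq h (i := i % (m + 1)) (by rw [List.length_rotate]; exact h1)
    rw [List.getElem_rotate, List.getElem_ofFn, List.getElem_ofFn] at h2
    refine Eq.trans (congrArg c (Fin.ext ?_)) h2
    simp [Fin.ofNat]
  · intro h
    refine List.ext_getElem (by simp) fun i h1 h2 => ?_
    have hi : i < m + 1 := by simpa using h2
    rw [List.getElem_rotate, List.getElem_ofFn, List.getElem_ofFn]
    refine Eq.trans (congrArg c (Fin.ext ?_)) ((h i).trans (congrArg c (Fin.ext ?_)))
    · simp [Fin.ofNat]
    · simp [Fin.ofNat, Nat.mod_eq_of_lt hi]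

variable {c}

/-- The periods of a pointed cycle are the multiples of its length divided by its degree. -/
theorem cycleDegree_spec (hc : IsPointedCycle s t c) :
    cycleDegree s t c * ((m + 1) / cycleDegree s t c) = m + 1 ∧
      ∀ r, (List.ofFn c).rotate r = List.ofFn c ↔ (m + 1) / cycleDegree s t c ∣ r := by
  -- The rotations fixing `c` are the multiples of the least one, `q`, and the degree will be `(m +
  -- 1) / q`.
  set q := Function.minimalPeriod (fun l : List E => l.rotate 1) (List.ofFn c) with hq
  have hit : ∀ r, (fun l : List E => l.rotate 1)^[r] (List.ofFn c) = (List.ofFn c).rotate r := by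
    intro r
    induction r with
    | zero => simp
    | succ r ih => rw [Function.iterate_succ_apply', ih, List.rotate_rotate]
  have hdvd : ∀ r, (List.ofFn c).rotate r = List.ofFn c ↔ q ∣ r := fun r => by
    rw [← Function.isPeriodicPt_iff_minimalPeriod_dvd, Function.IsPeriodicPt,
      Function.IsFixedPt, hit]
  have hm : q ∣ m + 1 := (hdvd _).1 (by
    have := List.rotate_length (List.ofFn c)
    rwa [List.length_ofFn] at this)
  have hq0 : 0 < q := Nat.pos_of_dvd_of_pos hm (Nat.succ_pos m)
  have hper := (rotate_ofFn_eq_iff c q).1 ((hdvd q).2 dvd_rfl)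
  have hdeg : cycleDegree s t c = (m + 1) / q := by
    refine IsGreatest.csSup_eq ⟨?_, ?_⟩
    · obtain ⟨l, hl⟩ : ∃ l, q = l + 1 := ⟨q - 1, by omega⟩
      rw [hl] at hm hper ⊢
      refine ⟨l, fun i => c (Fin.ofNat (m + 1) i), fun i => ?_, Nat.div_mul_cancel hm,
        fun i => ?_⟩
      · have h1 := hc (Fin.ofNat (m + 1) i)
        have h2 : c (Fin.ofNat (m + 1) i + 1) = c (Fin.ofNat (m + 1) (i + 1 : ℕ)) :=
          congrArg c (Fin.ext (by simp [Fin.val_add, Fin.ofNat]))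
        rw [h1, h2]
        change s (c (Fin.ofNat (m + 1) (i + 1 : ℕ))) = s (c (Fin.ofNat (m + 1) (i + 1 : Fin (l + 1))))
        -- The successor in `Fin (l + 1)` wraps around at `l + 1 = q`, a period of `c`, so the first
        -- `q` edges close up.
        rw [Fin.val_add, ← hper.map_mod_nat (i + 1 : ℕ)]
        simp
      · refine Eq.trans (congrArg c (Fin.ext ?_)) (hper.map_mod_nat (i : ℕ)).symm
        simp [Fin.ofNat, Nat.mod_eq_of_lt i.2]
    · rintro d ⟨l, c₀, -, h1, h2⟩
      -- The length of any root is a period of `c`, hence at least `q`, which bounds the exponent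
      -- `d`.
      have h3 : q ∣ l + 1 := by
        rw [← hdvd, rotate_ofFn_eq_iff]
        intro i
        simp only [h2]
        congr 1
        refine Fin.ext ?_
        have : l + 1 ∣ m + 1 := ⟨d, by rw [← h1, mul_comm]⟩
        simp [Fin.ofNat, Nat.mod_mod_of_dvd _ this]
      rw [Nat.le_div_iff_mul_le hq0, ← h1]
      exact Nat.mul_le_mul_left d (Nat.le_of_dvd (Nat.succ_pos l) h3)
  rw [hdeg, Nat.div_div_self hm (Nat.succ_ne_zero m)]
  exact ⟨Nat.div_mul_cancel hm, hdvd⟩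

end Periods

/-! ### Edge sequences under rotation by blocks -/

section BlockEdges

set_option linter.unusedSectionVars false

variable {k V E : Type*} [Field k] {s t : E → V} {ιA : V → Type*} {ιM : E → Type*}

theorem cycBreaks_append_comm (u v : List (Letter ιA ιM)) :
    cycBreaks s t (u ++ v) = cycBreaks s t (v ++ u) := by
  induction u generalizing v with
  | nil => simp
  | cons x u ih => rw [List.cons_append, cycBreaks_rotate, List.append_assoc, ih]; simp

theorem IsBlock.exists_edges_eq {v : List (Letter ιA ιM)} (hv : IsBlock letterWeight v) :
    ∃ e, edges v = [e] := by
  obtain ⟨x, r, rfl, h1, h2⟩ := hv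
  rcases x with x | x
  · simp [letterWeight] at h1
  · refine ⟨x.1, ?_⟩
    rw [edges_cons, edges, List.flatMap_eq_nil_iff.2]
    · rfl
    · rintro (y | y) hy
      · rfl
      · exact absurd rfl (h2 _ hy)

/-- Each block contains one edge letter, so moving the last block to the front rotates the edges to
the right by one, which is a left rotation by `l.length - 1`. -/
theorem blockRot_mem_edges {l : List E} {x : FreeAlgebra k (Letter ιA ιM)}
    (hx : x ∈ wordSpan k (fun w => IsHeaded letterWeight w ∧ cycBreaks s t w = 0 ∧ edges w = l)) :
    blockRot k letterWeight x ∈ wordSpan k (fun w => IsHeaded letterWeight w ∧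
      cycBreaks s t w = 0 ∧ edges w = l.rotate (l.length - 1)) := by
  refine map_mem_of_wordSpan (fun w hw => ?_) hx
  obtain ⟨h1, h2, rfl⟩ := hw
  rcases h1.exists_append with h | ⟨u, v, rfl, -, h⟩
  · rw [blockRot_block h]
    obtain ⟨e, he⟩ := h.exists_edges_eq
    exact word_mem_wordSpan ⟨h1, h2, by simp [he]⟩
  · rw [blockRot_append u h]
    obtain ⟨e, he⟩ := h.exists_edges_eq
    refine Submodule.smul_mem _ _ (word_mem_wordSpan ⟨h.isHeaded.append u,
      by rwa [cycBreaks_append_comm], ?_⟩)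
    have := List.rotate_append_length_eq (edges u) [e]
    simp [he, this]

theorem blockRot_pow_mem_edges {l : List E} {x : FreeAlgebra k (Letter ιA ιM)}
    (hx : x ∈ wordSpan k (fun w => IsHeaded letterWeight w ∧ cycBreaks s t w = 0 ∧ edges w = l))
    (r : ℕ) : (blockRot k letterWeight ^ r) x ∈ wordSpan k (fun w => IsHeaded letterWeight w ∧
      cycBreaks s t w = 0 ∧ edges w = l.rotate (r * (l.length - 1))) := by
  induction r with
  | zero => simpa using hx
  | succ r ih =>
    have := blockRot_mem_edges ih
    rw [List.rotate_rotate, List.length_rotate] at this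
    rw [pow_succ', Module.End.mul_apply, add_one_mul]
    exact this

/-- Rotating by `r` and by `r * (l.length - 1)` amounts to `r` full turns, so the two rotations are
inverse and fix the same lists. -/
theorem rotate_mul_pred_eq_iff {l : List E} (r : ℕ) :
    l.rotate (r * (l.length - 1)) = l ↔ l.rotate r = l := by
  rcases l.eq_nil_or_concat with rfl | ⟨l', e, rfl⟩
  · simp
  generalize hl : l'.concat e = l
  have hn : l.length = (l.length - 1) + 1 := by rw [← hl]; simp
  have h : l.rotate (r + r * (l.length - 1)) = l := by
    have := List.rotate_length_mul l r
    rw [hn, add_one_mul, add_comm, mul_comm] at this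
    exact this
  constructor
  · intro h'
    conv_rhs => rw [← h, add_comm, ← List.rotate_rotate, h']
  · intro h'
    conv_rhs => rw [← h, ← List.rotate_rotate, h']

end BlockEdges

/-! ### The component of a cycle -/

section Shift

variable {k : Type*} [Field k] {T T' : Type*} [AddCommGroup T] [Module k T]
  [AddCommGroup T'] [Module k T'] {D : T →ₗ[k] T} {D' : T' →ₗ[k] T'}
  {G : ℤ → Submodule k T} {G' : ℤ → Submodule k T'} {n : ℤ}

/-- Homology of invariants and coinvariants of homology, for maps of degree `1` and `-1` that
become inverse to each other on invariants up to the order of the group. -/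
theorem nonempty_homology_equiv_coinvariants_shift {J : Type*} (f : T →ₗ[k] T')
    (g : T' →ₗ[k] T) (ρ : J → T →ₗ[k] T) (F : Finset J) (hd : (F.card : k) ≠ 0)
    (R : Submodule k (gradedHomology D G (n + 1)))
    (hR : R = Submodule.span k {q | ∃ (j : J) (z z' : cycles D G (n + 1)), (z' : T) = ρ j z ∧
      q = homologyClass D G (n + 1) z - homologyClass D G (n + 1) z'})
    (hfD : ∀ x, D' (f x) = f (D x)) (hfG : ∀ m, ∀ x ∈ G (m + 1), f x ∈ G' m)
    (hsurj : ∀ m, ∀ x ∈ G' m, ∃ y ∈ G (m + 1), f y = x) (hgG : ∀ m, ∀ x ∈ G' m, g x ∈ G (m + 1))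
    (hρ : ∀ j m, ∀ x ∈ G m, ρ j x ∈ G m) (hρD : ∀ j x, D (ρ j x) = ρ j (D x))
    (hgf : ∀ x, g (f x) = ∑ j ∈ F, ρ j x) (hfρ : ∀ j x, f (ρ j x) = f x) :
    Nonempty (gradedHomology D' G' n ≃ₗ[k] gradedHomology D G (n + 1) ⧸ R) := by
  refine nonempty_homology_equiv_coinvariants (G := fun m => G (m + 1)) f g ρ F F.card hd R hR hfD
    hfG (fun m x hx => ?_) hgG (fun j m => hρ j (m + 1)) (fun j x hx => ?_) rfl
    (fun m x _ => hgf x) (fun m x hx => ?_) hfρ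
  -- That `g` commutes with the differentials is checked on the image of `f`, where `g f` is a sum
  -- of chain maps.
  · obtain ⟨y, -, rfl⟩ := hsurj m x hx
    rw [hfD, hgf, hgf, map_sum]
    exact Finset.sum_congr rfl fun j _ => hρD j y
  · rw [hρD, hx, map_zero]
  · obtain ⟨y, -, rfl⟩ := hsurj m x hx
    rw [hgf, map_sum]
    simp only [hfρ, Finset.sum_const]
    exact (Nat.cast_smul_eq_nsmul k _ _).symm

end Shift

/-! ### Invariant words along a cycle and the cyclic bar complex -/

section CycleComponent

set_option linter.unusedSectionVars false

variable {k V E : Type*} [Field k] {s t : E → V} {A : V → Type*} {M : E → Type*}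
  [∀ v, Ring (A v)] [∀ e, AddCommGroup (M e)] [∀ v, Algebra k (A v)] [∀ e, Module k (M e)]
  [∀ e, Module (A (s e)) (M e)] [∀ e, Module (A (t e))ᵐᵒᵖ (M e)]
  [∀ e, IsScalarTower k (A (s e)) (M e)] [∀ e, IsScalarTower k (A (t e))ᵐᵒᵖ (M e)]
  [∀ e, SMulCommClass (A (s e)) (A (t e))ᵐᵒᵖ (M e)]
  {ιA : V → Type*} {ιM : E → Type*} (bA : ∀ v, Basis (ιA v) k (A v))
  (bM : ∀ e, Basis (ιM e) k (M e)) {m : ℕ} {c : Fin (m + 1) → E}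

local notation "𝒟" => bar (quiverBasis s t A M bA bM) letterWeight

/-- The vertex letters before the first edge of `l'` all go to `u`, so that `v` begins with an edge
letter. -/
theorem exists_append_of_edges {w : List (Letter ιA ιM)} {l l' : List E} (hl : l' ≠ [])
    (h : edges w = l ++ l') :
    ∃ u v, w = u ++ v ∧ IsHeaded letterWeight v ∧ edges u = l ∧ edges v = l' := by
  induction w generalizing l with
  | nil => simp at h; exact absurd h.2 hl
  | cons x w ih =>
    rcases x with x | x
    · obtain ⟨u, v, rfl, h1, h2, h3⟩ := ih h
      exact ⟨_, v, (List.cons_append ..).symm, h1, h2, h3⟩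
    · rcases l with - | ⟨e, l⟩
      · exact ⟨[], _, rfl, ⟨_, _, rfl, rfl⟩, rfl, h⟩
      · obtain ⟨rfl, h'⟩ := List.cons.inj h
        obtain ⟨u, v, rfl, h1, h2, h3⟩ := ih h'
        exact ⟨_, v, (List.cons_append ..).symm, h1, by rw [edges_cons, h2]; rfl, h3⟩

-- Starting the word at the edge letter where the reading of `c` begins gives a word of the cyclic
-- bar complex, so dividing by the count is legitimate in characteristic zero.
open Classical in
theorem rotationCount_ne_zero (hc : IsPointedCycle s t c) {w : List (Letter ιA ιM)}
    (h : cycBreaks s t w = 0) (he : edges w ~r List.ofFn c) :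
    rotationCount (IsCyclicBarWord t ιA ιM c) w ≠ 0 := by
  have hlen : (edges w).length = m + 1 := by simpa using he.perm.length_eq
  obtain ⟨r, hr⟩ := he
  have hlt : r % (edges w).length < (edges w).length := Nat.mod_lt _ (by omega)
  rw [← List.rotate_mod, List.rotate_eq_drop_append_take hlt.le] at hr
  have hl : (edges w).drop (r % (edges w).length) ≠ [] := by
    rw [Ne, List.drop_eq_nil_iff]; omega
  obtain ⟨u, v, rfl, h1, h2, h3⟩ := exists_append_of_edges hl (List.take_append_drop _ _).symm
  rw [rotationCount]
  refine (Finset.sum_pos' (fun _ _ => Nat.zero_le _)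
    ⟨u.length, ?_, ?_⟩).ne'
  · have := List.length_pos_iff.2 h1.ne_nil
    rw [Finset.mem_range, List.length_append]
    omega
  · rw [List.rotate_append_length_eq, if_pos]
    · exact one_pos
    · refine (exists_cyclicLetters_iff hc).2 ⟨h1.append u, by rwa [cycBreaks_append_comm], ?_⟩
      rw [edges_append, ← hr, ← h2, ← h3]

theorem rotationCount_rotate {B : Type*} (P : List B → Prop) [DecidablePred P] (u : List B) (x : B) :
    rotationCount P (x :: u) = rotationCount P (u ++ [x]) := by
  rw [rotationCount, rotationCount, List.length_cons, List.length_append, List.length_singleton,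
    Finset.sum_range_succ', Finset.sum_range_succ]
  congr 1
  · refine Finset.sum_congr rfl fun i _ => ?_
    rw [List.rotate_cons_succ]
  · have h := List.rotate_append_length_eq u [x]
    rw [h, List.rotate_zero]
    rfl

theorem blockRot_pow_mem_degree {n : ℤ} {x : FreeAlgebra k (Letter ιA ιM)}
    (hx : x ∈ wordSpan k (fun w => (wordDegree letterWeight w : ℤ) = n)) (r : ℕ) :
    (blockRot k letterWeight ^ r) x ∈
      wordSpan k (fun w => (wordDegree letterWeight w : ℤ) = n) := by
  induction r with
  | zero => exact hx
  | succ r ih =>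
    rw [pow_succ', Module.End.mul_apply]
    refine map_mem_of_wordSpan (fun w hw => ?_) ih
    rw [blockRot_word]
    refine rot_pow_mem_wordSpan k letterWeight (fun u x h => ?_) (word_mem_wordSpan hw) _
    rw [← h]
    simp [add_comm]

/-- If the rotation fixes `c`, the rotated words read `c` again and the projection does nothing. -/
theorem cyclicWords_blockRotation_of_period (hc : IsPointedCycle s t c) {r : ℕ}
    (hr : (List.ofFn c).rotate r = List.ofFn c) (z : CyclicBar k t A M c) :
    cyclicWords s bA bM c (blockRotation k t A M c r z) =
      (blockRot k letterWeight ^ r) (cyclicWords s bA bM c z) := by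
  rw [cyclicWords_blockRotation]
  refine wordProj_eq_self (wordSpan_mono (fun w hw => (exists_cyclicLetters_iff hc).2 hw) ?_)
  have := blockRot_pow_mem_edges (wordSpan_mono
    (fun w hw => (exists_cyclicLetters_iff hc).1 hw) (cyclicWords_mem_cyclicBarWord (s := s) bA bM z)) r
  rwa [(rotate_mul_pred_eq_iff r).2 hr] at this

/-- The rotated words read a sequence other than `c`, and the component at `c` does not see them. -/
theorem blockRotation_eq_zero (hc : IsPointedCycle s t c) {r : ℕ}
    (hr : (List.ofFn c).rotate r ≠ List.ofFn c) (z : CyclicBar k t A M c) :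
    blockRotation k t A M c r z = 0 := by
  let bA := fun v => Basis.ofVectorSpace k (A v)
  let bM := fun e => Basis.ofVectorSpace k (M e)
  rw [← unword_cyclicWords (s := s) bA bM (blockRotation k t A M c r z),
    cyclicWords_blockRotation, wordProj_eq_zero _ (blockRot_pow_mem_edges (wordSpan_mono
    (fun w hw => (exists_cyclicLetters_iff hc).1 hw) (cyclicWords_mem_cyclicBarWord (s := s) bA bM z)) r),
    map_zero]
  intro w hw hw'
  refine hr ((rotate_mul_pred_eq_iff r).1 ?_)
  rw [← hw.2.2, ((exists_cyclicLetters_iff hc).1 hw').2.2]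

/-- On words this is the commutation of `hoch` with the block rotation; it is carried back along the
injective `cyclicWords`. -/
theorem cyclicBarD_blockRotation (hc : IsPointedCycle s t c) {r : ℕ}
    (hr : (List.ofFn c).rotate r = List.ofFn c) (z : CyclicBar k t A M c) :
    cyclicBarD k t A M hc (blockRotation k t A M c r z) =
      blockRotation k t A M c r (cyclicBarD k t A M hc z) := by
  let bA := fun v => Basis.ofVectorSpace k (A v)
  let bM := fun e => Basis.ofVectorSpace k (M e)
  refine (Function.LeftInverse.injective (unword_cyclicWords (s := s) bA bM)) ?_
  rw [cyclicWords_cyclicBarD, cyclicWords_blockRotation_of_period bA bM hc hr,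
    cyclicWords_blockRotation_of_period bA bM hc hr, cyclicWords_cyclicBarD,
    (isGradedMul_quiverBasis bA bM).hoch_blockRot_pow letterWeight_le_one]
  exact wordSpan_mono (fun w hw => ((exists_cyclicLetters_iff hc).1 hw).1)
    (cyclicWords_mem_cyclicBarWord (s := s) bA bM z)

theorem cycNorm_blockRot_pow (r : ℕ) (x : FreeAlgebra k (Letter ιA ιM)) :
    cycNorm k letterWeight ((blockRot k letterWeight ^ r) x) = cycNorm k letterWeight x := by
  induction r with
  | zero => rfl
  | succ r ih => rw [pow_succ', Module.End.mul_apply, cycNorm_blockRot, ih]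

theorem unword_wordProj_isHeaded (x : FreeAlgebra k (Letter ιA ιM)) :
    unword t bA bM c (wordProj k (IsHeaded letterWeight) x) = unword t bA bM c x := by
  refine LinearMap.congr_fun (f := unword t bA bM c ∘ₗ wordProj k (IsHeaded letterWeight))
    ((wordBasis k _).ext fun w => ?_) x
  rw [LinearMap.comp_apply, wordBasis_apply]
  by_cases h : IsHeaded letterWeight w
  · rw [wordProj_word_of h]
  · rw [wordProj_word_of_not h, map_zero, unword_of_not]
    rintro ⟨b, rfl⟩
    exact h (isHeaded_cyclicLetters b)

/-- Only rotations beginning with an edge letter can be words of the cyclic bar complex, and these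
are the rotations by whole blocks. -/
theorem unword_cycNorm_cyclicWords (z : CyclicBar k t A M c) :
    unword t bA bM c (cycNorm k letterWeight (cyclicWords s bA bM c z)) =
      ∑ r ∈ Finset.range (m + 1), blockRotation k t A M c r z := by
  rw [← LinearMap.sum_apply]
  refine LinearMap.congr_fun
    (f := unword t bA bM c ∘ₗ cycNorm k letterWeight ∘ₗ cyclicWords s bA bM c)
    ((cyclicBarBasis bA bM c).ext fun b => ?_) z
  rw [LinearMap.comp_apply, LinearMap.comp_apply, ← unword_wordProj_isHeaded, cyclicWords_basis,
    cyclicLetters, wordProj_cycNorm_flatten, map_sum, LinearMap.sum_apply, List.length_ofFn]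
  · refine Finset.sum_congr rfl fun r _ => ?_
    rw [blockRotation_eq (s := s) bA bM, cyclicWords_basis]
    rfl
  · intro v hv
    obtain ⟨j, rfl⟩ := List.mem_ofFn.1 hv
    exact isBlock_blockLetters _ _

/-- Rotations that move `c` contribute zero. By `cycleDegree_spec` the others are the multiples of
the period, one for each element of `ℤ/(deg c)`. -/
theorem sum_blockRotation (hc : IsPointedCycle s t c) (z : CyclicBar k t A M c) :
    ∑ r ∈ Finset.range (m + 1), blockRotation k t A M c r z =
      ∑ j ∈ Finset.range (cycleDegree s t c),
        blockRotation k t A M c (j * ((m + 1) / cycleDegree s t c)) z := by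
  obtain ⟨h1, h2⟩ := cycleDegree_spec hc
  have hq : 0 < (m + 1) / cycleDegree s t c := Nat.pos_of_ne_zero fun h => by
    rw [h, mul_zero] at h1; omega
  refine (Finset.sum_of_injOn (fun j => j * ((m + 1) / cycleDegree s t c))
    (fun i _ j _ h => Nat.eq_of_mul_eq_mul_right hq h) (fun j hj => ?_) (fun r hr hr' => ?_)
    (fun j _ => rfl)).symm
  · rw [Finset.mem_coe, Finset.mem_range] at hj ⊢
    exact (Nat.mul_lt_mul_of_pos_right hj hq).trans_eq h1
  · refine blockRotation_eq_zero hc (fun h => hr' ?_) z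
    obtain ⟨j, rfl⟩ := (h2 r).1 h
    refine ⟨j, ?_, mul_comm _ _⟩
    rw [Finset.mem_range] at hr
    rw [Finset.mem_coe, Finset.mem_range]
    refine Nat.lt_of_mul_lt_mul_right (a := (m + 1) / cycleDegree s t c) ?_
    rwa [h1, mul_comm]

theorem cycNorm_cyclicWords_mem (hc : IsPointedCycle s t c) {ℓ : Cyc s t}
    (hℓ : List.ofFn c = cycleEdges ℓ) {n : ℤ} {z : CyclicBar k t A M c}
    (hz : z ∈ cyclicBarDegree k t A M c (n + 1)) :
    cycNorm k letterWeight (cyclicWords s bA bM c z) ∈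
      componentInvariants k ιA ιM (.inr ℓ : V ⊕ Cyc s t) n := by
  have h := cyclicWords_mem (s := s) bA bM hz
  refine ⟨cycNorm_mem_invariants (wordSpan_mono (fun w hw => ⟨?_, hw.2⟩) h),
    cycNorm_mem_wordSpan letterWeight
      (fun u x => (isComponentWord_rotate (.inr ℓ : V ⊕ Cyc s t) u x).2)
      (wordSpan_mono (fun w hw => ?_) h)⟩
  · obtain ⟨-, h1, h2⟩ := (exists_cyclicLetters_iff hc).1 hw.1
    exact ⟨h1, by rw [h2, hℓ]⟩
  · exact ((exists_cyclicLetters_iff hc).1 hw.1).1.ne_nil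

/-- Weight each word of `x` by the inverse of the number of its rotations that read `c`, and keep
the words that read `c`. Each orbit is then counted once, and `N` restores `x`. -/
theorem exists_cycNorm_cyclicWords_eq [CharZero k] (hc : IsPointedCycle s t c) {ℓ : Cyc s t}
    (hℓ : List.ofFn c = cycleEdges ℓ) {n : ℤ} {x : FreeAlgebra k (Letter ιA ιM)}
    (hx : x ∈ componentInvariants k ιA ιM (.inr ℓ : V ⊕ Cyc s t) n) :
    ∃ z ∈ cyclicBarDegree k t A M c (n + 1),
      cycNorm k letterWeight (cyclicWords s bA bM c z) = x := by
  classical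
  obtain ⟨h1, h2⟩ := (mem_invariants _).1 hx.1
  refine ⟨unword t bA bM c
    (diag k (fun w => ((rotationCount (IsCyclicBarWord t ιA ιM c) w : k))⁻¹) x),
    unword_mem bA bM (diag_mem_wordSpan _ (wordSpan_mono (fun w hw => hw.2) h1)), ?_⟩
  rw [cyclicWords_unword, cycNorm_wordProj_of_invariant, diag_diag]
  · refine (diag_eq_smul (c := (1 : k)) (fun w hw => ?_) hx.2).trans (one_smul k x)
    exact mul_inv_cancel₀ (Nat.cast_ne_zero.2
      (rotationCount_ne_zero hc hw.1 (by rw [hℓ]; exact hw.2)))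
  · rw [rot_diag k letterWeight (fun u x => by rw [rotationCount_rotate]), h2]

/-- The homology of the component of a cycle is given by the coinvariants of the homology of the
cyclic bar complex. -/
theorem nonempty_component_equiv_coinvariants [CharZero k] (hc : IsPointedCycle s t c)
    {ℓ : Cyc s t} (hℓ : List.ofFn c = cycleEdges ℓ) (n : ℤ) :
    Nonempty (gradedHomology 𝒟 (componentInvariants k ιA ιM (.inr ℓ : V ⊕ Cyc s t)) n ≃ₗ[k]
      cyclicTorsion k t A M hc (n + 1) ⧸ rotationRelations k t A M hc (n + 1)) := by
  obtain ⟨hd, hper⟩ := cycleDegree_spec hc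
  have hd0 : cycleDegree s t c ≠ 0 := fun h => by rw [h, zero_mul] at hd; omega
  have hjper : ∀ j : ℕ, (List.ofFn c).rotate (j * ((m + 1) / cycleDegree s t c)) = List.ofFn c :=
    fun j => (hper _).2 (Dvd.intro_left j rfl)
  have hgf : ∀ z : CyclicBar k t A M c,
      unword t bA bM c (cycNorm k letterWeight (cyclicWords s bA bM c z)) =
      ∑ j ∈ Finset.range (cycleDegree s t c),
        blockRotation k t A M c (j * ((m + 1) / cycleDegree s t c)) z := fun z => by
    rw [unword_cycNorm_cyclicWords, sum_blockRotation hc]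
  have hfρ : ∀ (j : ℕ) (z : CyclicBar k t A M c), cycNorm k letterWeight (cyclicWords s bA bM c
      (blockRotation k t A M c (j * ((m + 1) / cycleDegree s t c)) z)) =
      cycNorm k letterWeight (cyclicWords s bA bM c z) := fun j z => by
    rw [cyclicWords_blockRotation_of_period bA bM hc (hjper j), cycNorm_blockRot_pow]
  have hfD : ∀ z : CyclicBar k t A M c, 𝒟 (cycNorm k letterWeight (cyclicWords s bA bM c z)) =
      cycNorm k letterWeight (cyclicWords s bA bM c (cyclicBarD k t A M hc z)) := fun z => by
    rw [cyclicWords_cyclicBarD, (isGradedMul_quiverBasis bA bM).cycNorm_hoch]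
  have hcard : ((Finset.range (cycleDegree s t c)).card : k) ≠ 0 := by
    rw [Finset.card_range]
    exact Nat.cast_ne_zero.2 hd0
  have hρ : ∀ (j : ℕ) (i : ℤ), ∀ z ∈ cyclicBarDegree k t A M c i,
      blockRotation k t A M c (j * ((m + 1) / cycleDegree s t c)) z ∈
        cyclicBarDegree k t A M c i := fun j i z hz => by
    rw [blockRotation_eq (s := s) bA bM]
    exact unword_mem bA bM (blockRot_pow_mem_degree (wordSpan_mono (fun w hw => hw.2)
      (cyclicWords_mem (s := s) bA bM hz)) _)
  have hg : ∀ i, ∀ x ∈ componentInvariants k ιA ιM (.inr ℓ : V ⊕ Cyc s t) i,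
      unword t bA bM c x ∈ cyclicBarDegree k t A M c (i + 1) := fun i x hx =>
    unword_mem bA bM (wordSpan_mono (fun w hw => hw.2) ((mem_invariants _).1 hx.1).1)
  -- Averaging is `N` after `cyclicWords`, the way back is `unword`, and the group acts through
  -- rotations by multiples of the period, one for each `j` below the degree.
  have key := @nonempty_homology_equiv_coinvariants_shift k _ (CyclicBar k t A M c)
    (FreeAlgebra k (Letter ιA ιM)) _ _ _ _ (cyclicBarD k t A M hc) 𝒟
    (fun m => cyclicBarDegree k t A M c m) (componentInvariants k ιA ιM (.inr ℓ : V ⊕ Cyc s t)) n ℕ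
    (cycNorm k letterWeight ∘ₗ cyclicWords s bA bM c) (unword t bA bM c)
    (fun j : ℕ => blockRotation k t A M c (j * ((m + 1) / cycleDegree s t c)))
    (Finset.range (cycleDegree s t c)) hcard
  exact key (rotationRelations k t A M hc (n + 1)) rfl hfD
    (fun i z hz => cycNorm_cyclicWords_mem bA bM hc hℓ hz)
    (fun i x hx => exists_cycNorm_cyclicWords_eq bA bM hc hℓ hx) hg hρ
    (fun j z => cyclicBarD_blockRotation hc (hjper j) z) hgf hfρ

end CycleComponent

theorem nonempty_directSum_sum_equiv {k I J : Type*} [CommRing k] (X : I ⊕ J → Type*)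
    [∀ i, AddCommGroup (X i)] [∀ i, Module k (X i)] :
    Nonempty ((⨁ i, X i) ≃ₗ[k] (⨁ i, X (.inl i)) × ⨁ j, X (.inr j)) := by
  classical
  refine ⟨LinearEquiv.ofLinearMap
    (DirectSum.toModule k _ _ (Sum.rec
      (fun i => LinearMap.inl k _ _ ∘ₗ DirectSum.lof k I (fun i => X (.inl i)) i)
      (fun j => LinearMap.inr k _ _ ∘ₗ DirectSum.lof k J (fun j => X (.inr j)) j)))
    (LinearMap.coprod (DirectSum.toModule k _ _ fun i => DirectSum.lof k _ X (.inl i))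
      (DirectSum.toModule k _ _ fun j => DirectSum.lof k _ X (.inr j))) ?_ ?_⟩
  · refine LinearMap.prod_ext ?_ ?_ <;>
      refine DirectSum.linearMap_ext k fun i => LinearMap.ext fun x => ?_ <;>
      simp [DirectSum.toModule_lof]
  · refine DirectSum.linearMap_ext k fun i => LinearMap.ext fun x => ?_
    rcases i with i | j <;> simp [DirectSum.toModule_lof]

end QuiverCyclic

end

/-! ### The decomposition of the cyclic homology of the algebra of a quiver -/

theorem mainTheorem3 {k V E : Type*} [Field k] [CharZero k] (s t : E → V)
    (A : V → Type*) [∀ v, Ring (A v)] [∀ v, Algebra k (A v)]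
    (M : E → Type*) [∀ e, AddCommGroup (M e)] [∀ e, Module k (M e)]
    [∀ e, Module (A (s e)) (M e)] [∀ e, Module (A (t e))ᵐᵒᵖ (M e)]
    [∀ e, IsScalarTower k (A (s e)) (M e)] [∀ e, IsScalarTower k (A (t e))ᵐᵒᵖ (M e)]
    [∀ e, SMulCommClass (A (s e)) (A (t e))ᵐᵒᵖ (M e)] (n : ℤ) :
    Nonempty (QuiverCyclic.cyclicHomology k (QuiverCyclic.quiverGrading k s t A M) n ≃ₗ[k]
      (⨁ v, QuiverCyclic.cyclicHomology k (QuiverCyclic.degreeZero k (A v)) n) ×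
        ⨁ ℓ : QuiverCyclic.Cyc s t, QuiverCyclic.cycleHomology k t A M ℓ (n + 1)) := by
  classical
  let bA := fun v => Module.Basis.ofVectorSpace k (A v)
  let bM := fun e => Module.Basis.ofVectorSpace k (M e)
  obtain ⟨e₁⟩ := (QuiverCyclic.isGradedMul_quiverBasis (s := s) (t := t) bA
    bM).nonempty_cyclicHomology_equiv_invariants (𝒜 := QuiverCyclic.quiverGrading k s t A M)
      (QuiverCyclic.quiverBasis_mem_grading bA bM) n
  obtain ⟨e₂⟩ := QuiverCyclic.nonempty_invariants_equiv_components (s := s) (t := t) bA bM n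
  obtain ⟨e₃⟩ := QuiverCyclic.nonempty_directSum_sum_equiv (k := k)
    fun i : V ⊕ QuiverCyclic.Cyc s t => QuiverCyclic.gradedHomology
      (QuiverCyclic.bar (QuiverCyclic.quiverBasis s t A M bA bM) QuiverCyclic.letterWeight)
      (QuiverCyclic.componentInvariants k _ _ i) n
  have e₄ := fun v => (QuiverCyclic.nonempty_cyclicHomology_equiv_vertex (s := s) (t := t)
    bA bM v n).some
  -- The equality of edge lists holds by `rfl`, as `cycleEdges` uses the same representative as
  -- `cycleHomology`.
  have e₅ := fun ℓ : QuiverCyclic.Cyc s t => (QuiverCyclic.nonempty_component_equiv_coinvariants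
    bA bM ℓ.2.out.2 (ℓ := ℓ) rfl n).some
  exact ⟨e₁ ≪≫ₗ e₂ ≪≫ₗ e₃ ≪≫ₗ (DFinsupp.mapRange.linearEquiv e₄).prodCongr
    (DFinsupp.mapRange.linearEquiv e₅)⟩
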